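/- A \emph{quasi-threshold graph} is a member of the smallest family of (finite simple) graphs, closed under isomorphism, that contains $K_1$ and is closed under adding a dominating vertex and under taking disjoint unions. Let $qt_n$ be the number of labelled quasi-threshold graphs on $[n]=\{1,\dots,n\}$, and let $S(n,k)$ be the Stirling numbers of the second kind. Then for all $n\ge 1$, $$qt_n=\sum_{k=0}^n(-1)^{n-k}S(n,k)(k+1)^{k-1}.$$ Moreover, let $A$ be a finite non-empty set of natural numbers. A \emph{rooted partition forest} on $A$ is a rooted forest whose vertices are the blocks of a partition of $A$ into non-empty blocks; let $\mathcal F_A$ be the set of these forests. \textbf{Encoding.} To a quasi-threshold graph $G$ with vertex set $A$ associate a rooted partition forest $F(G)$ with one tree for each component of $G$. The tree of a component that is a complete graph with vertex set $C$ is the single vertex $C$. The tree of a non-complete component with vertex set $C$ has as root the set $D$ of dominating vertices of the component, and the subtrees at the children of the root are the trees associated in the same way with the components that remain after deleting $D$. Then replace every vertex $C$ of $F(G)$ by a path of $|C|$ singleton vertices, labelled by the elements of $C$ in increasing order moving away from the root. Let $\mathcal Q_A$ be the set of the resulting \emph{quasi-threshold forests}. \textbf{The map $\iota$.} For $F\in\mathcal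 F_A$ let $h(F)$ be the path that starts at the root $a$ of the component containing $\min A$ and descends as long as the current vertex has exactly one child; let $b$ be its last vertex. If the labels on $h(F)$ are not all singletons in increasing order, let $v$ be the first vertex from $a$ that witnesses this. (A) If $v$ is not a singleton and either $v=a$ or some element of $v$ is larger than the label of the parent of $v$, replace $v$ by a vertex $v'=\{\max v\}$ in its place below its parent (if any) and a child $v''=v\setminus\{\max v\}$ of $v'$, where $v''$ becomes the parent of all children of $v$. (B) If $v\ne a$ and all elements of $v$ are smaller than the label of the parent $u$ of $v$, contract the edge joining $u$ and $v$ to a vertex labelled $u\cup v$. In both cases the result is $\iota(F)$. If the labels on $h(F)$ are all singletons in increasing order, delete $h(F)$. If nothing remains, $\iota(F)=F$. Otherwise apply $\iota$ recursively to the remaining rooted partition forest, restore $h(F)$, and join $b$ to the roots of those components of the resulting forest that correspond to (have the same union of labels as) the components that were below $b$ in $F$; the result is $\iota(F)$. Then: \begin{enumerate} \item the encoding is a well-defined bijection from the quasi-threshold graphs with vertex set $A$ onto $\mathcal Q_A\subseteq\mathcal F_A$, and all vertices of every forest in $\mathcal Q_A$ are singletons; \item $\iota$ is a well-defined map $\mathcal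 F_A\to\mathcal F_A$ and an involution; \item if $\iota(F)\neq F$, then of the two numbers $|A|-k(F)$ and $|A|-k(\iota(F))$, where $k$ denotes the number of vertices of a forest, one is even and the other is odd; \item the set of fixed points of $\iota$ is exactly $\mathcal Q_A$. \end{enumerate} -/

import Mathlib

/-- The graph obtained from `G` by adding one new vertex `none` adjacent to every vertex of `G`. -/
def addDominating {V : Type} (G : SimpleGraph V) : SimpleGraph (Option V) where
  Adj x y := match x, y with
    | some u, some w => G.Adj u w
    | none, none => False
    | none, some _ => True
    | some _, none => True
  symm := ⟨by
    rintro (_ | u) (_ | w) h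
    · exact h
    · trivial
    · trivial
    · exact SimpleGraph.Adj.symm h⟩
  loopless := ⟨by
    rintro (_ | u) h
    · exact h
    · exact SimpleGraph.irrefl G h⟩

/-- Quasi-threshold graphs: the smallest (isomorphism-closed) family of graphs that contains `K₁`
and is closed under adding dominating vertices and taking disjoint unions. -/
inductive IsQuasiThreshold : {V : Type} → SimpleGraph V → Prop
  | single : IsQuasiThreshold (⊥ : SimpleGraph Unit)
  | dominating {V : Type} {G : SimpleGraph V} :
      IsQuasiThreshold G → IsQuasiThreshold (addDominating G)
  | disjointUnion {V W : Type} {G : SimpleGraph V} {H : SimpleGraph W} :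
      IsQuasiThreshold G → IsQuasiThreshold H → IsQuasiThreshold (G.sum H)
  | iso {V W : Type} {G : SimpleGraph V} {H : SimpleGraph W} :
      Nonempty (G ≃g H) → IsQuasiThreshold G → IsQuasiThreshold H

/-- The quasi-threshold graphs with vertex set `A`. -/
abbrev QTGraph (A : Finset ℕ) : Type := {G : SimpleGraph A // IsQuasiThreshold G}

/-- The number of labelled quasi-threshold graphs on `[n] = {1, …, n}`. -/
noncomputable def qtCount (n : ℕ) : ℕ := Nat.card (QTGraph (Finset.Icc 1 n))

/-- The data of a rooted forest whose vertices (`blocks`) are finite sets of natural numbers;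
`(c, p) ∈ edges` means that `p` is the parent of `c`. -/
@[ext]
structure BlockForest where
  blocks : Finset (Finset ℕ)
  edges : Finset (Finset ℕ × Finset ℕ)

namespace BlockForest

/-- `F.ParentOf c p`: the parent of `c` is `p`. -/
def ParentOf (F : BlockForest) (c p : Finset ℕ) : Prop := (c, p) ∈ F.edges

/-- `F` is a rooted partition forest on `A`: a rooted forest (each vertex has at most one parent,
and following parents never returns to the start) whose vertices are the blocks of a partition
of `A` into non-empty blocks. -/
structure IsPartitionForest (A : Finset ℕ) (F : BlockForest) : Prop where
  empty_notMem : ∅ ∉ F.blocks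
  disjoint : ∀ u ∈ F.blocks, ∀ v ∈ F.blocks, u ≠ v → Disjoint u v
  union : F.blocks.biUnion id = A
  mem_blocks : ∀ c p, F.ParentOf c p → c ∈ F.blocks ∧ p ∈ F.blocks
  parent_unique : ∀ c p p', F.ParentOf c p → F.ParentOf c p' → p = p'
  acyclic : ∀ v, ¬ Relation.TransGen F.ParentOf v v

/-- All the elements occurring in labels of `F`. -/
def ground (F : BlockForest) : Finset ℕ := F.blocks.biUnion id

/-- The vertices without a parent. -/
def roots (F : BlockForest) : Finset (Finset ℕ) :=
  F.blocks.filter fun r => ∀ p ∈ F.blocks, (r, p) ∉ F.edges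

/-- The children of the vertex `v`. -/
def children (F : BlockForest) (v : Finset ℕ) : Finset (Finset ℕ) :=
  F.blocks.filter fun c => (c, v) ∈ F.edges

open Classical in
/-- All the elements in labels of `v` and its descendants. If `v` is a root, these are the
elements in the labels of the component of `v`. -/
noncomputable def labelsBelow (F : BlockForest) (v : Finset ℕ) : Finset ℕ :=
  (F.blocks.filter fun c => Relation.ReflTransGen F.ParentOf c v).biUnion id

/-! ### Encoding graphs by forests -/

/-- The forest with one vertex. -/
def single (C : Finset ℕ) : BlockForest := ⟨{C}, ∅⟩

/-- Add to `F` a new root `D`, joined to all roots of `F`. -/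
def addRoot (D : Finset ℕ) (F : BlockForest) : BlockForest where
  blocks := insert D F.blocks
  edges := F.edges ∪ F.roots.image fun r => (r, D)

/-- The union of the forests `T C`, `C ∈ I`. -/
def union (I : Finset (Finset ℕ)) (T : Finset ℕ → BlockForest) : BlockForest where
  blocks := I.biUnion fun C => (T C).blocks
  edges := I.biUnion fun C => (T C).edges

open Classical in
/-- The vertex sets of the connected components of the subgraph of `G` induced by `S`. -/
noncomputable def components (G : SimpleGraph ℕ) (S : Finset ℕ) : Finset (Finset ℕ) :=
  S.powerset.filter fun C =>
    (G.induce (C : Set ℕ)).Connected ∧ ∀ x ∈ C, ∀ y ∈ S, y ∉ C → ¬ G.Adj x y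

open Classical in
/-- The dominating vertices of the subgraph of `G` induced by `C`. -/
noncomputable def dominatingVertices (G : SimpleGraph ℕ) (C : Finset ℕ) : Finset ℕ :=
  C.filter fun x => ∀ y ∈ C, y ≠ x → G.Adj x y

/-- `EncodesTree G C T`: the rooted tree associated with the connected induced subgraph of `G` on
`C` is `T`. If that subgraph is complete, the tree is the single vertex `C`; otherwise, its root is
the set `D` of dominating vertices, and below the root are the trees of the components that
remain when `D` is deleted. -/
inductive EncodesTree (G : SimpleGraph ℕ) : Finset ℕ → BlockForest → Prop
  | complete {C : Finset ℕ} : C.Nonempty → G.IsClique (C : Set ℕ) → EncodesTree G C (single C)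
  | step {C : Finset ℕ} (T : Finset ℕ → BlockForest) :
      ¬ G.IsClique (C : Set ℕ) →
      (∀ K ∈ components G (C \ dominatingVertices G C), EncodesTree G K (T K)) →
      EncodesTree G C (addRoot (dominatingVertices G C)
        (union (components G (C \ dominatingVertices G C)) T))

/-- `EncodesForest G S F`: the forest associated with the induced subgraph of `G` on `S` is `F`;
it consists of the trees associated with the components. -/
def EncodesForest (G : SimpleGraph ℕ) (S : Finset ℕ) (F : BlockForest) : Prop :=
  ∃ T : Finset ℕ → BlockForest,
    (∀ K ∈ components G S, EncodesTree G K (T K)) ∧ F = union (components G S) T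

open Classical in
/-- Replace each vertex `v` of `F` by a path whose vertices are the singletons `{x}`, `x ∈ v`, in
increasing order when moving away from the root. So `{x}` is the parent of `{y}` if `x` immediately
precedes `y` in a block, or if `x` is the largest element of a block and `y` is the smallest element
of a child of this block. -/
noncomputable def expand (F : BlockForest) : BlockForest where
  blocks := F.ground.image fun x => {x}
  edges := ((F.ground ×ˢ F.ground).filter fun yx =>
      (∃ v ∈ F.blocks, yx.1 ∈ v ∧ yx.2 ∈ v ∧ yx.2 < yx.1 ∧ ∀ z ∈ v, ¬ (yx.2 < z ∧ z < yx.1)) ∨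
      (∃ c p, (c, p) ∈ F.edges ∧ IsLeast (c : Set ℕ) yx.1 ∧ IsGreatest (p : Set ℕ) yx.2)).image
    fun yx => (({yx.1} : Finset ℕ), ({yx.2} : Finset ℕ))

/-- `F` is the forest that encodes the graph `G` with vertex set `A`: first form the forest
associated with `G`, then expand every vertex into an increasing path of singletons. -/
def Encodes {A : Finset ℕ} (G : SimpleGraph A) (F : BlockForest) : Prop :=
  ∃ F₀, EncodesForest (G.map (Function.Embedding.subtype fun x => x ∈ A)) A F₀ ∧ F = expand F₀

/-! ### The recursive map on rooted partition forests -/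

/-- `p` is the list of vertices of the path `h(F)`: it starts at the root of the component that
contains the smallest element among the labels of `F`, and descends as long as there is exactly one
child. -/
structure IsMinPath (F : BlockForest) (p : List (Finset ℕ)) : Prop where
  start : ∃ a ∈ p.head?, a ∈ F.roots ∧ ∃ m ∈ F.labelsBelow a, ∀ x ∈ F.ground, m ≤ x
  chain : p.IsChain fun u w => F.children u = {w}
  last : ∃ b ∈ p.getLast?, (F.children b).card ≠ 1

/-- All the labels on the path `p` are singletons, and they occur in increasing order. -/
def IncreasingSingletons (p : List (Finset ℕ)) : Prop :=
  ∃ l : List ℕ, l.Pairwise (· < ·) ∧ p = l.map fun x => {x}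

/-- Replace `v` by two vertices: `v' = {max v}`, which takes the place of `v` below its parent (if
any), and its child `v'' = v \ {max v}`, which becomes the parent of all children of `v`. -/
def split (F : BlockForest) (v : Finset ℕ) : BlockForest :=
  let v' : Finset ℕ := {v.sup id}
  let v'' : Finset ℕ := v.erase (v.sup id)
  { blocks := insert v' (insert v'' (F.blocks.erase v))
    edges := insert (v'', v') (F.edges.image fun e =>
      (if e.1 = v then v' else e.1, if e.2 = v then v'' else e.2)) }

/-- Contract the edge between `v` and its parent `u`; the new vertex is labelled `u ∪ v`. -/
def contract (F : BlockForest) (u v : Finset ℕ) : BlockForest where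
  blocks := insert (u ∪ v) ((F.blocks.erase u).erase v)
  edges := (F.edges.erase (v, u)).image fun e =>
    (if e.1 = u ∨ e.1 = v then u ∪ v else e.1, if e.2 = u ∨ e.2 = v then u ∪ v else e.2)

/-- Delete the vertices in `p` (and all edges at them). -/
def delete (F : BlockForest) (p : List (Finset ℕ)) : BlockForest where
  blocks := F.blocks.filter fun v => v ∉ p
  edges := F.edges.filter fun e => e.1 ∉ p ∧ e.2 ∉ p

/-- Put the path `p`, with last vertex `b`, back onto a forest `F'` obtained from `F.delete p`: the
vertex `b` becomes the parent of those roots of `F'` whose components have the same label elements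
as the components of `F.delete p` that were below `b` in `F`. -/
noncomputable def restore (F : BlockForest) (p : List (Finset ℕ)) (b : Finset ℕ)
    (F' : BlockForest) : BlockForest where
  blocks := p.toFinset ∪ F'.blocks
  edges := (F.edges.filter fun e => e.1 ∈ p ∧ e.2 ∈ p) ∪ F'.edges ∪
    (F'.roots.filter fun r => ∃ c ∈ F.children b,
      (F.delete p).labelsBelow c = F'.labelsBelow r).image fun r => (r, b)

/-- `Iota F F'`: the recursive procedure turns `F` into `F'`. In the cases `split` and `contract`,
the vertex `v` is the first one on the path `h(F)` at which the path stops to have singleton labels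
in increasing order. -/
inductive Iota : BlockForest → BlockForest → Prop
  /-- `v` is not a singleton, and it is the root or has an element larger than the label of its
  parent (the last vertex of `p`). -/
  | split {F : BlockForest} (p : List (Finset ℕ)) (v : Finset ℕ) (q : List (Finset ℕ)) :
      F.IsMinPath (p ++ v :: q) → IncreasingSingletons p → 2 ≤ v.card →
      (∀ u ∈ p.getLast?, ∃ x ∈ v, ∀ y ∈ u, y < x) → Iota F (F.split v)
  /-- `v` has a parent `u`, and all elements of `v` are smaller than the label of `u`. -/
  | contract {F : BlockForest} (p : List (Finset ℕ)) (u v : Finset ℕ) (q : List (Finset ℕ)) :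
      F.IsMinPath (p ++ u :: v :: q) → IncreasingSingletons (p ++ [u]) →
      (∀ x ∈ v, ∀ y ∈ u, x < y) → Iota F (F.contract u v)
  /-- `h(F)` has increasing singleton labels, and it is all of `F`. -/
  | done {F : BlockForest} (p : List (Finset ℕ)) :
      F.IsMinPath p → IncreasingSingletons p → (F.delete p).blocks = ∅ → Iota F F
  /-- `h(F)` has increasing singleton labels, and other vertices remain when it is deleted. -/
  | recurse {F F' : BlockForest} (p : List (Finset ℕ)) (b : Finset ℕ) :
      F.IsMinPath p → b ∈ p.getLast? → IncreasingSingletons p → (F.delete p).blocks ≠ ∅ →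
      Iota (F.delete p) F' → Iota F (F.restore p b F')

end BlockForest

/-- The rooted partition forests on `A`. -/
abbrev PartitionForest (A : Finset ℕ) : Type :=
  {F : BlockForest // BlockForest.IsPartitionForest A F}

/-- The quasi-threshold forests on `A`: the forests that encode the quasi-threshold graphs with
vertex set `A`. -/
def quasiThresholdForests (A : Finset ℕ) : Set (PartitionForest A) :=
  {F | ∃ G : QTGraph A, BlockForest.Encodes G.1 F.1}

/-! The formula is a sign-reversing cancellation. Weight a rooted partition forest with `k` vertices
by `(-1)^(n-k)`. The total weight is the right-hand side: the Stirling numbers count the possible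
vertex sets (`sum_partitions`), and `k` blocks carry `(k+1)^(k-1)` rooted forests
(`card_forests_of_blocks`, from the Cayley-type count `AcyclicMap.card_mul`). The involution flips
the sign off its fixed points, and each fixed point has only singleton vertices and so weight 1
(`card_qtGraph`).

Splitting off `max v` and contracting an edge are mutually inverse. Each changes the path `h(F)`
only at the witness, and after either step the guard of the other one holds there. In the recursive
case the processed forest is reattached according to the label sets of its components, so one must
know that these sets never change. Hence `Iota.spec` proves involutivity, parity and this invariance
in a single induction.

Fixed points and encodings meet in the class `IsIncreasing`. On the side of the involution this is
`Iota.eq_iff`. On the side of graphs, a finite non-empty graph is quasi-threshold exactly if every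
connected set of vertices has a dominating vertex. Deleting all dominating vertices never leaves
exactly one component, so no block of the encoding forest has exactly one child. After expansion, an
only child therefore comes from the same block as its parent and has the larger label, and the graph
is the comparability graph of the forest (`IsEncoding.represents_expand`). Conversely, the order of
an increasing forest can be read off its comparability graph: going up means passing to a larger
closed neighbourhood, with ties decided by the labels (`Represents.transGen_iff`). So a graph has
only one increasing forest, and every increasing forest is the encoding of its comparability graph
(`exists_encodes_iff`). -/

open Relation

/-! ### Rooted partition forests: ranks, roots and components -/

namespace BlockForest

variable {A : Finset ℕ} {F : BlockForest}

/-- Reduces acyclicity to an inequality on single edges; nearly every forest constructed below is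
shown acyclic by exhibiting such a rank. -/
theorem acyclic_of_rank (r : Finset ℕ → ℕ) (h : ∀ c p, F.ParentOf c p → r p < r c) (v : Finset ℕ) :
    ¬ TransGen F.ParentOf v v := by
  have key : ∀ a b, TransGen F.ParentOf a b → r b < r a := by
    intro a b hab
    induction hab with
    | single h1 => exact h _ _ h1
    | tail _ h2 ih => exact (h _ _ h2).trans ih
  exact fun hv => lt_irrefl _ (key v v hv)

theorem transGen_mem_blocks (hm : ∀ c p, F.ParentOf c p → c ∈ F.blocks ∧ p ∈ F.blocks)
    {a b : Finset ℕ} (h : TransGen F.ParentOf a b) : a ∈ F.blocks ∧ b ∈ F.blocks := by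
  induction h with
  | single h1 => exact hm _ _ h1
  | tail _ h2 ih => exact ⟨ih.1, (hm _ _ h2).2⟩

namespace IsPartitionForest

/-- The depth works: every proper ancestor of `p` is one of `c`, and `p` is a proper ancestor of `c`
but not of itself. -/
theorem exists_rank (hF : IsPartitionForest A F) :
    ∃ r : Finset ℕ → ℕ, ∀ c p, F.ParentOf c p → r p < r c := by
  classical
  refine ⟨fun c => (F.blocks.filter fun p => TransGen F.ParentOf c p).card, fun c p h => ?_⟩
  refine Finset.card_lt_card (Finset.ssubset_iff_subset_ne.2 ⟨fun x hx => ?_, fun he => ?_⟩)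
  · rw [Finset.mem_filter] at hx ⊢
    exact ⟨hx.1, TransGen.head h hx.2⟩
  · have : p ∈ F.blocks.filter fun q => TransGen F.ParentOf p q := by
      rw [he, Finset.mem_filter]
      exact ⟨(hF.mem_blocks _ _ h).2, TransGen.single h⟩
    exact hF.acyclic p (Finset.mem_filter.1 this).2

/-- Reversed depth, for inductions that go down the forest. The truncated subtraction is harmless
because `r c` is at most the supremum over the blocks. -/
theorem exists_height (hF : IsPartitionForest A F) :
    ∃ r : Finset ℕ → ℕ, ∀ c p, F.ParentOf c p → r c < r p := by
  obtain ⟨r, hr⟩ := hF.exists_rank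
  refine ⟨fun c => F.blocks.sup r - r c, fun c p h => ?_⟩
  have h1 := hr c p h
  have h2 : r c ≤ F.blocks.sup r := Finset.le_sup (hF.mem_blocks _ _ h).1
  dsimp only
  omega

theorem nonempty (hF : IsPartitionForest A F) {v : Finset ℕ} (hv : v ∈ F.blocks) : v.Nonempty :=
  Finset.nonempty_iff_ne_empty.2 fun h => hF.empty_notMem (h ▸ hv)

theorem eq_of_mem (hF : IsPartitionForest A F) {u v : Finset ℕ} {x : ℕ} (hu : u ∈ F.blocks)
    (hv : v ∈ F.blocks) (hxu : x ∈ u) (hxv : x ∈ v) : u = v := by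
  by_contra h
  exact Finset.disjoint_left.1 (hF.disjoint u hu v hv h) hxu hxv

theorem mem_ground_iff (hF : IsPartitionForest A F) {x : ℕ} :
    x ∈ A ↔ ∃ v ∈ F.blocks, x ∈ v := by
  rw [← hF.union]; simp

theorem subset (hF : IsPartitionForest A F) {v : Finset ℕ} (hv : v ∈ F.blocks) : v ⊆ A :=
  fun _ hx => hF.mem_ground_iff.2 ⟨v, hv, hx⟩

theorem parent_ne (hF : IsPartitionForest A F) {c p : Finset ℕ} (h : F.ParentOf c p) : c ≠ p := by
  rintro rfl
  exact hF.acyclic c (TransGen.single h)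

theorem mem_roots (hF : IsPartitionForest A F) {r : Finset ℕ} :
    r ∈ F.roots ↔ r ∈ F.blocks ∧ ∀ p, ¬ F.ParentOf r p := by
  simp only [roots, Finset.mem_filter]
  exact and_congr_right fun _ => ⟨fun h p hp => h p (hF.mem_blocks _ _ hp).2 hp, fun h p _ => h p⟩

theorem mem_children (hF : IsPartitionForest A F) {c v : Finset ℕ} :
    c ∈ F.children v ↔ F.ParentOf c v := by
  simp only [children, Finset.mem_filter]
  exact ⟨fun h => h.2, fun h => ⟨(hF.mem_blocks _ _ h).1, h⟩⟩

theorem mem_labelsBelow {x : ℕ} {v : Finset ℕ} :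
    x ∈ F.labelsBelow v ↔ ∃ c ∈ F.blocks, ReflTransGen F.ParentOf c v ∧ x ∈ c := by
  simp [labelsBelow, and_assoc]

theorem exists_root (hF : IsPartitionForest A F) {c : Finset ℕ} (hc : c ∈ F.blocks) :
    ∃ r ∈ F.roots, ReflTransGen F.ParentOf c r := by
  obtain ⟨k, hk⟩ := hF.exists_rank
  induction hn : k c using Nat.strong_induction_on generalizing c with
  | _ n ih =>
    by_cases h : ∃ p, F.ParentOf c p
    · obtain ⟨p, hp⟩ := h
      obtain ⟨r, hr, hpr⟩ := ih (k p) (hn ▸ hk c p hp) (hF.mem_blocks _ _ hp).2 rfl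
      exact ⟨r, hr, ReflTransGen.head hp hpr⟩
    · exact ⟨c, hF.mem_roots.2 ⟨hc, not_exists.1 h⟩, .refl⟩

theorem reach_total (hF : IsPartitionForest A F) {a b c : Finset ℕ}
    (h1 : ReflTransGen F.ParentOf a b) (h2 : ReflTransGen F.ParentOf a c) :
    ReflTransGen F.ParentOf b c ∨ ReflTransGen F.ParentOf c b :=
  ReflTransGen.total_of_right_unique (fun _ _ _ h h' => hF.parent_unique _ _ _ h h') h1 h2

theorem eq_of_reach_root (hF : IsPartitionForest A F) {r b : Finset ℕ} (hr : r ∈ F.roots)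
    (h : ReflTransGen F.ParentOf r b) : r = b := by
  rcases ReflTransGen.cases_head h with h | ⟨c, hc, _⟩
  · exact h
  · exact ((hF.mem_roots.1 hr).2 _ hc).elim

theorem root_unique (hF : IsPartitionForest A F) {r r' c : Finset ℕ} (hr : r ∈ F.roots)
    (hr' : r' ∈ F.roots) (h : ReflTransGen F.ParentOf c r) (h' : ReflTransGen F.ParentOf c r') :
    r = r' := by
  rcases hF.reach_total h h' with h1 | h1
  · exact hF.eq_of_reach_root hr h1
  · exact (hF.eq_of_reach_root hr' h1).symm

theorem mem_blocks_of_reach (hF : IsPartitionForest A F) {a b : Finset ℕ} (ha : a ∈ F.blocks)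
    (h : ReflTransGen F.ParentOf a b) : b ∈ F.blocks := by
  rcases reflTransGen_iff_eq_or_transGen.1 h with h | h
  · exact h ▸ ha
  · exact (transGen_mem_blocks hF.mem_blocks h).2

theorem mem_blocks_of_reach' (hF : IsPartitionForest A F) {a b : Finset ℕ} (hb : b ∈ F.blocks)
    (h : ReflTransGen F.ParentOf a b) : a ∈ F.blocks := by
  rcases reflTransGen_iff_eq_or_transGen.1 h with h | h
  · exact h ▸ hb
  · exact (transGen_mem_blocks hF.mem_blocks h).1

theorem subset_labelsBelow {v : Finset ℕ} (hv : v ∈ F.blocks) : v ⊆ F.labelsBelow v :=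
  fun _ hx => mem_labelsBelow.2 ⟨v, hv, .refl, hx⟩

theorem root_eq_of_mem_labelsBelow (hF : IsPartitionForest A F) {r r' : Finset ℕ} {x : ℕ}
    (hr : r ∈ F.roots) (hr' : r' ∈ F.roots) (h : x ∈ F.labelsBelow r) (h' : x ∈ F.labelsBelow r') :
    r = r' := by
  obtain ⟨c, hc, h1, h2⟩ := mem_labelsBelow.1 h
  obtain ⟨c', hc', h1', h2'⟩ := mem_labelsBelow.1 h'
  obtain rfl := hF.eq_of_mem hc hc' h2 h2'
  exact hF.root_unique hr hr' h1 h1'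

/-- This is what allows `restore` to identify components by their label sets. -/
theorem labelsBelow_injOn (hF : IsPartitionForest A F) {r r' : Finset ℕ}
    (hr : r ∈ F.roots) (hr' : r' ∈ F.roots) (h : F.labelsBelow r = F.labelsBelow r') : r = r' := by
  obtain ⟨x, hx⟩ := hF.nonempty (hF.mem_roots.1 hr).1
  have := subset_labelsBelow (hF.mem_roots.1 hr).1 hx
  exact hF.root_eq_of_mem_labelsBelow hr hr' this (h ▸ this)

theorem exists_root_of_mem (hF : IsPartitionForest A F) {x : ℕ} (hx : x ∈ A) :
    ∃ r ∈ F.roots, x ∈ F.labelsBelow r := by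
  obtain ⟨v, hv, hxv⟩ := hF.mem_ground_iff.1 hx
  obtain ⟨r, hr, h⟩ := hF.exists_root hv
  exact ⟨r, hr, mem_labelsBelow.2 ⟨v, hv, h, hxv⟩⟩

end IsPartitionForest

/-! ### The path `h(F)`: existence and uniqueness -/

/-- `F.Descends p`: the list `p` follows only children, and stops at the first vertex
that does not have exactly one child. -/
def Descends (F : BlockForest) (p : List (Finset ℕ)) : Prop :=
  p.IsChain (fun u w => F.children u = {w}) ∧ ∃ b ∈ p.getLast?, (F.children b).card ≠ 1

theorem descends_singleton {v : Finset ℕ} : F.Descends [v] ↔ (F.children v).card ≠ 1 := by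
  simp [Descends]

theorem descends_cons_cons {u v : Finset ℕ} {p : List (Finset ℕ)} :
    F.Descends (u :: v :: p) ↔ F.children u = {v} ∧ F.Descends (v :: p) := by
  simp [Descends, and_assoc]

/-- At each vertex the number of children decides whether to stop, and an only child leaves no
choice of continuation. -/
theorem Descends.unique {u : Finset ℕ} {p q : List (Finset ℕ)} (hp : F.Descends (u :: p))
    (hq : F.Descends (u :: q)) : p = q := by
  induction p generalizing u q with
  | nil =>
    cases q with
    | nil => rfl
    | cons w q =>
      rw [descends_singleton] at hp
      rw [descends_cons_cons] at hq
      simp [hq.1] at hp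
  | cons v p ih =>
    rw [descends_cons_cons] at hp
    cases q with
    | nil =>
      rw [descends_singleton] at hq
      simp [hp.1] at hq
    | cons w q =>
      rw [descends_cons_cons] at hq
      obtain rfl : v = w := by simpa using hp.1.symm.trans hq.1
      rw [ih hp.2 hq.2]

theorem IsPartitionForest.exists_descends (hF : IsPartitionForest A F) (v : Finset ℕ) :
    ∃ p, F.Descends (v :: p) := by
  obtain ⟨k, hk⟩ := hF.exists_height
  induction hn : k v using Nat.strong_induction_on generalizing v with
  | _ n ih =>
    by_cases h : (F.children v).card = 1
    · obtain ⟨w, hw⟩ := Finset.card_eq_one.1 h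
      have hwv : F.ParentOf w v := hF.mem_children.1 (hw ▸ Finset.mem_singleton_self w)
      obtain ⟨p, hp⟩ := ih (k w) (hn ▸ hk _ _ hwv) w rfl
      exact ⟨w :: p, descends_cons_cons.2 ⟨hw, hp⟩⟩
    · exact ⟨[], descends_singleton.2 h⟩

/-- `F.IsMinRoot a`: the vertex `a` is the root of the component with the least label. -/
def IsMinRoot (F : BlockForest) (a : Finset ℕ) : Prop :=
  a ∈ F.roots ∧ ∃ m ∈ F.labelsBelow a, ∀ x ∈ F.ground, m ≤ x

theorem isMinPath_cons {a : Finset ℕ} {p : List (Finset ℕ)} :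
    F.IsMinPath (a :: p) ↔ F.IsMinRoot a ∧ F.Descends (a :: p) := by
  constructor
  · rintro ⟨h1, h2, h3⟩
    exact ⟨by simpa [IsMinRoot] using h1, h2, h3⟩
  · rintro ⟨h1, h2, h3⟩
    exact ⟨by simpa [IsMinRoot] using h1, h2, h3⟩

theorem not_isMinPath_nil : ¬ F.IsMinPath [] := by
  rintro ⟨⟨a, ha, _⟩, _, _⟩
  simp at ha

theorem IsMinPath.exists_cons {p : List (Finset ℕ)} (h : F.IsMinPath p) :
    ∃ a t, p = a :: t ∧ F.IsMinRoot a ∧ F.Descends (a :: t) := by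
  cases p with
  | nil => exact (not_isMinPath_nil h).elim
  | cons a t => exact ⟨a, t, rfl, isMinPath_cons.1 h⟩

/-- Both witnesses are the least label of `F`, and a label lies in only one component. -/
theorem IsPartitionForest.isMinRoot_unique (hF : IsPartitionForest A F) {a b : Finset ℕ}
    (ha : F.IsMinRoot a) (hb : F.IsMinRoot b) : a = b := by
  obtain ⟨ha, m, hm, hm'⟩ := ha
  obtain ⟨hb, k, hk, hk'⟩ := hb
  have hmem : ∀ {x v}, x ∈ F.labelsBelow v → x ∈ F.ground := fun h => by
    obtain ⟨c, hc, _, hx⟩ := IsPartitionForest.mem_labelsBelow.1 h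
    exact Finset.mem_biUnion.2 ⟨c, hc, hx⟩
  obtain rfl : m = k := le_antisymm (hm' _ (hmem hk)) (hk' _ (hmem hm))
  exact hF.root_eq_of_mem_labelsBelow ha hb hm hk

theorem IsPartitionForest.isMinPath_unique (hF : IsPartitionForest A F) {p q : List (Finset ℕ)}
    (hp : F.IsMinPath p) (hq : F.IsMinPath q) : p = q := by
  obtain ⟨a, p, rfl, ha, hp⟩ := hp.exists_cons
  obtain ⟨b, q, rfl, hb, hq⟩ := hq.exists_cons
  obtain rfl := hF.isMinRoot_unique ha hb
  rw [hp.unique hq]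

theorem IsPartitionForest.exists_isMinPath (hF : IsPartitionForest A F) (hA : A.Nonempty) :
    ∃ p, F.IsMinPath p := by
  obtain ⟨r, hr, h⟩ := hF.exists_root_of_mem (A.min'_mem hA)
  obtain ⟨p, hp⟩ := hF.exists_descends r
  exact ⟨r :: p, isMinPath_cons.2 ⟨⟨hr, _, h, fun x hx => A.min'_le x (hF.union ▸ hx)⟩, hp⟩⟩

/-- The label sets of the components. -/
noncomputable def componentLabels (F : BlockForest) : Finset (Finset ℕ) :=
  F.roots.image F.labelsBelow

end BlockForest

/-! ### Splitting a vertex -/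

namespace BlockForest

variable {A : Finset ℕ} {F : BlockForest}

/-- Replace the vertex `v` by an edge from `b` to its parent `a`. -/
def splitAt (F : BlockForest) (v a b : Finset ℕ) : BlockForest where
  blocks := insert a (insert b (F.blocks.erase v))
  edges := insert (b, a) (F.edges.image fun e =>
    (if e.1 = v then a else e.1, if e.2 = v then b else e.2))

theorem split_eq_splitAt (F : BlockForest) (v : Finset ℕ) :
    F.split v = F.splitAt v {v.sup id} (v.erase (v.sup id)) := rfl

theorem splitAt_parentOf {v a b c p : Finset ℕ} :
    (F.splitAt v a b).ParentOf c p ↔ (c = b ∧ p = a) ∨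
      ∃ c₀ p₀, F.ParentOf c₀ p₀ ∧ c = (if c₀ = v then a else c₀) ∧
        p = if p₀ = v then b else p₀ := by
  simp only [ParentOf, splitAt, Finset.mem_insert, Finset.mem_image, Prod.exists, Prod.mk.injEq]
  constructor
  · rintro (h | ⟨c₀, p₀, h1, h2, h3⟩)
    · exact .inl h
    · exact .inr ⟨c₀, p₀, h1, h2.symm, h3.symm⟩
  · rintro (h | ⟨c₀, p₀, h1, h2, h3⟩)
    · exact .inl h
    · exact .inr ⟨c₀, p₀, h1, h2.symm, h3.symm⟩

/-- `v` is a vertex that is the union of two disjoint non-empty sets `a` and `b`. -/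
structure IsSplitting (F : BlockForest) (v a b : Finset ℕ) : Prop where
  mem : v ∈ F.blocks
  union : a ∪ b = v
  disjoint : Disjoint a b
  left : a.Nonempty
  right : b.Nonempty

namespace IsSplitting

variable {v a b : Finset ℕ}

theorem ne (h : IsSplitting F v a b) : a ≠ b := by
  rintro rfl
  obtain ⟨x, hx⟩ := h.left
  exact Finset.disjoint_left.1 h.disjoint hx hx

theorem left_subset (h : IsSplitting F v a b) : a ⊆ v := h.union ▸ Finset.subset_union_left

theorem right_subset (h : IsSplitting F v a b) : b ⊆ v := h.union ▸ Finset.subset_union_right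

theorem left_ne (h : IsSplitting F v a b) : a ≠ v := by
  rintro rfl
  obtain ⟨x, hx⟩ := h.right
  exact Finset.disjoint_left.1 h.disjoint (h.right_subset hx) hx

theorem right_ne (h : IsSplitting F v a b) : b ≠ v := by
  rintro rfl
  obtain ⟨x, hx⟩ := h.left
  exact Finset.disjoint_left.1 h.disjoint hx (h.left_subset hx)

/-- A block meeting `v` is `v` itself. Hence the new names never collide with old ones, and the case
distinctions in `splitAt` can be undone. -/
theorem left_notMem (h : IsSplitting F v a b) (hF : IsPartitionForest A F) : a ∉ F.blocks := by
  intro ha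
  obtain ⟨x, hx⟩ := h.left
  exact h.left_ne (hF.eq_of_mem ha h.mem hx (h.left_subset hx))

theorem right_notMem (h : IsSplitting F v a b) (hF : IsPartitionForest A F) : b ∉ F.blocks := by
  intro hb
  obtain ⟨x, hx⟩ := h.right
  exact h.right_ne (hF.eq_of_mem hb h.mem hx (h.right_subset hx))

theorem isPartitionForest (h : IsSplitting F v a b) (hF : IsPartitionForest A F) :
    IsPartitionForest A (F.splitAt v a b) := by
  have hla := h.left_notMem hF
  have hlb := h.right_notMem hF
  have hab := h.ne
  have hdis : ∀ w ∈ F.blocks, w ≠ v → Disjoint v w := fun w hw hne =>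
    hF.disjoint v h.mem w hw hne.symm
  refine ⟨?_, ?_, ?_, ?_, ?_, ?_⟩
  · have := hF.empty_notMem
    have := h.left.ne_empty
    have := h.right.ne_empty
    simp only [splitAt, Finset.mem_insert, Finset.mem_erase]
    grind
  · have h1 : ∀ w ∈ F.blocks, w ≠ v → Disjoint a w := fun w hw hne =>
      Finset.disjoint_of_subset_left h.left_subset (hdis w hw hne)
    have h2 : ∀ w ∈ F.blocks, w ≠ v → Disjoint b w := fun w hw hne =>
      Finset.disjoint_of_subset_left h.right_subset (hdis w hw hne)
    intro x hx y hy hxy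
    simp only [splitAt, Finset.mem_insert, Finset.mem_erase] at hx hy
    rcases hx with rfl | rfl | ⟨hxv, hx⟩ <;> rcases hy with rfl | rfl | ⟨hyv, hy⟩
    · exact (hxy rfl).elim
    · exact h.disjoint
    · exact h1 y hy hyv
    · exact h.disjoint.symm
    · exact (hxy rfl).elim
    · exact h2 y hy hyv
    · exact (h1 x hx hxv).symm
    · exact (h2 x hx hxv).symm
    · exact hF.disjoint x hx y hy hxy
  · ext x
    rw [hF.mem_ground_iff]
    simp only [splitAt, Finset.mem_biUnion, Finset.mem_insert, Finset.mem_erase, id]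
    constructor
    · rintro ⟨w, rfl | rfl | ⟨_, hw⟩, hx⟩
      · exact ⟨v, h.mem, h.left_subset hx⟩
      · exact ⟨v, h.mem, h.right_subset hx⟩
      · exact ⟨w, hw, hx⟩
    · rintro ⟨w, hw, hx⟩
      by_cases hwv : w = v
      · subst hwv
        rw [← h.union, Finset.mem_union] at hx
        rcases hx with hx | hx
        · exact ⟨a, .inl rfl, hx⟩
        · exact ⟨b, .inr (.inl rfl), hx⟩
      · exact ⟨w, .inr (.inr ⟨hwv, hw⟩), hx⟩
  · intro c p hcp
    rw [splitAt_parentOf] at hcp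
    simp only [splitAt, Finset.mem_insert, Finset.mem_erase]
    rcases hcp with ⟨rfl, rfl⟩ | ⟨c₀, p₀, h1, rfl, rfl⟩
    · simp
    · have := hF.mem_blocks _ _ h1
      grind
  · intro c p p' hp hp'
    rw [splitAt_parentOf] at hp hp'
    rcases hp with ⟨rfl, rfl⟩ | ⟨c₀, p₀, h1, rfl, rfl⟩ <;>
      rcases hp' with ⟨h5, h6⟩ | ⟨c₁, p₁, h2, h5, h6⟩
    · exact h6.symm
    · have := hF.mem_blocks _ _ h2
      grind
    · have := hF.mem_blocks _ _ h1
      grind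
    · have := hF.mem_blocks _ _ h1
      have := hF.mem_blocks _ _ h2
      obtain rfl : c₀ = c₁ := by grind
      rw [h6, hF.parent_unique _ _ _ h1 h2]
  · obtain ⟨k, hk⟩ := hF.exists_rank
    -- Doubling the old ranks makes room for `b` strictly between `a`, which inherits the rank of
    -- `v`, and the former children of `v`, whose new rank is at least `2 * k v + 2`.
    refine acyclic_of_rank (fun x => if x = a then 2 * k v else if x = b then 2 * k v + 1
      else 2 * k x) ?_
    intro c p hcp
    rw [splitAt_parentOf] at hcp
    rcases hcp with ⟨rfl, rfl⟩ | ⟨c₀, p₀, h1, rfl, rfl⟩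
    · grind
    · have h2 := hF.mem_blocks _ _ h1
      have h3 := hk _ _ h1
      have h4 := hF.parent_ne h1
      have h5 : c₀ ≠ a := fun e => hla (e ▸ h2.1)
      have h6 : c₀ ≠ b := fun e => hlb (e ▸ h2.1)
      have h7 : p₀ ≠ a := fun e => hla (e ▸ h2.2)
      have h8 : p₀ ≠ b := fun e => hlb (e ▸ h2.2)
      grind

theorem card_blocks (h : IsSplitting F v a b) (hF : IsPartitionForest A F) :
    (F.splitAt v a b).blocks.card = F.blocks.card + 1 := by
  have hla := h.left_notMem hF
  have hlb := h.right_notMem hF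
  have hab := h.ne
  have := Finset.card_pos.2 ⟨v, h.mem⟩
  rw [splitAt, Finset.card_insert_of_notMem (by simp [hab, hla]),
    Finset.card_insert_of_notMem (by simp [hlb]), Finset.card_erase_of_mem h.mem]
  omega

theorem contract_splitAt (h : IsSplitting F v a b) (hF : IsPartitionForest A F) :
    (F.splitAt v a b).contract a b = F := by
  have hla := h.left_notMem hF
  have hlb := h.right_notMem hF
  have hab := h.ne
  have hv := h.mem
  have hu := h.union
  ext1
  · ext x
    simp only [contract, splitAt, Finset.mem_insert, Finset.mem_erase]
    grind
  · ext ⟨c, p⟩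
    have e : (c, p) ∈ ((F.splitAt v a b).contract a b).edges ↔ ∃ c₁ p₁,
        ¬ (c₁ = b ∧ p₁ = a) ∧ (F.splitAt v a b).ParentOf c₁ p₁ ∧
        (if c₁ = a ∨ c₁ = b then a ∪ b else c₁) = c ∧
        (if p₁ = a ∨ p₁ = b then a ∪ b else p₁) = p := by
      simp [contract, ParentOf, Finset.mem_image, and_assoc]
    rw [e]
    constructor
    · rintro ⟨c₁, p₁, h1, h2, rfl, rfl⟩
      rw [splitAt_parentOf] at h2
      rcases h2 with h2 | ⟨c₀, p₀, h2, rfl, rfl⟩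
      · exact (h1 h2).elim
      · have h3 := hF.mem_blocks _ _ h2
        have h4 : (c₀, p₀) ∈ F.edges := h2
        clear e
        convert h4 <;> grind
    · intro hcp
      have h3 := hF.mem_blocks _ _ hcp
      refine ⟨_, _, ?_, splitAt_parentOf.2 (.inr ⟨c, p, hcp, rfl, rfl⟩), ?_, ?_⟩ <;> grind

theorem mem_blocks_iff {x : Finset ℕ} :
    x ∈ (F.splitAt v a b).blocks ↔ x = a ∨ x = b ∨ x ≠ v ∧ x ∈ F.blocks := by
  simp [splitAt]

/-- An old edge now leaves the upper copy of its child and enters the lower copy of its parent. Both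
starting points are carried through the induction because the next edge resumes from the lower copy.
-/
theorem reach_splitAt {c r : Finset ℕ}
    (hcr : ReflTransGen F.ParentOf c r) :
    ReflTransGen (F.splitAt v a b).ParentOf (if c = v then b else c) (if r = v then a else r) ∧
    ReflTransGen (F.splitAt v a b).ParentOf (if c = v then a else c) (if r = v then a else r) := by
  have key : ∀ c, ReflTransGen (F.splitAt v a b).ParentOf (if c = v then b else c)
      (if c = v then a else c) := by
    intro c
    split_ifs
    · exact .single (splitAt_parentOf.2 (.inl ⟨rfl, rfl⟩))
    · exact .refl
  induction hcr using ReflTransGen.head_induction_on with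
  | refl => exact ⟨key r, .refl⟩
  | head h1 _ ih =>
    rename_i c p _
    have : ReflTransGen (F.splitAt v a b).ParentOf (if c = v then a else c)
        (if r = v then a else r) :=
      .head (splitAt_parentOf.2 (.inr ⟨c, p, h1, rfl, rfl⟩)) ih.1
    exact ⟨(key c).trans this, this⟩

/-- Collapsing `a` and `b` back to `v` sends the new edge to a point and every other edge to an edge
of `F`. -/
theorem reach_of_splitAt (h : IsSplitting F v a b) (hF : IsPartitionForest A F) {c r : Finset ℕ}
    (hcr : ReflTransGen (F.splitAt v a b).ParentOf c r) :
    ReflTransGen F.ParentOf (if c = a ∨ c = b then v else c) (if r = a ∨ r = b then v else r) := by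
  have hla := h.left_notMem hF
  have hlb := h.right_notMem hF
  induction hcr using ReflTransGen.head_induction_on with
  | refl => exact .refl
  | head h1 _ ih =>
    rename_i c p _
    rw [splitAt_parentOf] at h1
    rcases h1 with ⟨rfl, rfl⟩ | ⟨c₀, p₀, h1, rfl, rfl⟩
    · simpa using ih
    · have h3 := hF.mem_blocks _ _ h1
      have e1 : (if (if c₀ = v then a else c₀) = a ∨ (if c₀ = v then a else c₀) = b then v
        else (if c₀ = v then a else c₀)) = c₀ := by grind
      have e2 : (if (if p₀ = v then b else p₀) = a ∨ (if p₀ = v then b else p₀) = b then v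
        else (if p₀ = v then b else p₀)) = p₀ := by grind
      rw [e1]
      rw [e2] at ih
      exact .head h1 ih

theorem labelsBelow_splitAt (h : IsSplitting F v a b) (hF : IsPartitionForest A F)
    {r : Finset ℕ} (hr : r ∈ F.blocks) :
    (F.splitAt v a b).labelsBelow (if r = v then a else r) = F.labelsBelow r := by
  have hla := h.left_notMem hF
  have hlb := h.right_notMem hF
  ext x
  simp only [IsPartitionForest.mem_labelsBelow]
  constructor
  · rintro ⟨c, hc, hcr, hx⟩
    have h1 := h.reach_of_splitAt hF hcr
    have e2 : (if (if r = v then a else r) = a ∨ (if r = v then a else r) = b then v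
        else (if r = v then a else r)) = r := by grind
    rw [e2] at h1
    rw [mem_blocks_iff] at hc
    refine ⟨_, hF.mem_blocks_of_reach' hr h1, h1, ?_⟩
    rcases hc with rfl | rfl | hc
    · simpa using h.left_subset hx
    · simpa using h.right_subset hx
    · rw [if_neg (by grind)]
      exact hx
  · rintro ⟨c, hc, hcr, hx⟩
    have h1 := reach_splitAt (a := a) (b := b) (v := v) hcr
    by_cases hcv : c = v
    · rw [if_pos hcv, if_pos hcv] at h1
      rw [hcv, ← h.union, Finset.mem_union] at hx
      rcases hx with hx | hx
      · exact ⟨a, by simp [mem_blocks_iff], h1.2, hx⟩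
      · exact ⟨b, by simp [mem_blocks_iff], h1.1, hx⟩
    · rw [if_neg hcv] at h1
      exact ⟨c, by simp [mem_blocks_iff, hcv, hc], h1.1, hx⟩

theorem mem_roots_splitAt (h : IsSplitting F v a b) (hF : IsPartitionForest A F)
    {r : Finset ℕ} :
    r ∈ (F.splitAt v a b).roots ↔ ∃ r₀ ∈ F.roots, r = if r₀ = v then a else r₀ := by
  have hla := h.left_notMem hF
  have hlb := h.right_notMem hF
  have hab := h.ne
  have hv := h.mem
  have hlv := h.left_ne
  rw [(h.isPartitionForest hF).mem_roots, mem_blocks_iff]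
  constructor
  · rintro ⟨h1, h2⟩
    have hb : r ≠ b := fun e => h2 a (splitAt_parentOf.2 (.inl ⟨e, rfl⟩))
    refine ⟨if r = a then v else r, hF.mem_roots.2 ⟨by grind, fun p hp => ?_⟩, by grind⟩
    refine h2 _ (splitAt_parentOf.2 (.inr ⟨_, p, hp, ?_, rfl⟩))
    grind
  · rintro ⟨r₀, hr₀, rfl⟩
    rw [hF.mem_roots] at hr₀
    refine ⟨by grind, fun p hp => ?_⟩
    rw [splitAt_parentOf] at hp
    rcases hp with hp | ⟨c₀, p₀, h1, h2, -⟩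
    · grind
    · have h3 := hF.mem_blocks _ _ h1
      obtain rfl : r₀ = c₀ := by grind
      exact hr₀.2 _ h1

/-- This is the invariant on which the recursive case depends; for contractions it is obtained by
reading a contraction as the inverse of a splitting. -/
theorem componentLabels_splitAt (h : IsSplitting F v a b) (hF : IsPartitionForest A F) :
    (F.splitAt v a b).componentLabels = F.componentLabels := by
  ext L
  simp only [componentLabels, Finset.mem_image]
  constructor
  · rintro ⟨r, hr, rfl⟩
    obtain ⟨r₀, hr₀, rfl⟩ := (h.mem_roots_splitAt hF).1 hr
    exact ⟨r₀, hr₀, (h.labelsBelow_splitAt hF (hF.mem_roots.1 hr₀).1).symm⟩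
  · rintro ⟨r, hr, rfl⟩
    exact ⟨_, (h.mem_roots_splitAt hF).2 ⟨r, hr, rfl⟩,
      h.labelsBelow_splitAt hF (hF.mem_roots.1 hr).1⟩

theorem isMinRoot_splitAt (h : IsSplitting F v a b) (hF : IsPartitionForest A F) {r : Finset ℕ}
    (hr : r ∈ F.blocks) :
    (F.splitAt v a b).IsMinRoot (if r = v then a else r) ↔ F.IsMinRoot r := by
  have hla := h.left_notMem hF
  have hg : (F.splitAt v a b).ground = F.ground :=
    (h.isPartitionForest hF).union.trans hF.union.symm
  rw [IsMinRoot, IsMinRoot, hg, h.labelsBelow_splitAt hF hr, h.mem_roots_splitAt hF]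
  refine and_congr_left fun _ => ⟨?_, fun h => ⟨r, h, rfl⟩⟩
  rintro ⟨r₀, hr₀, e⟩
  have := (hF.mem_roots.1 hr₀).1
  obtain rfl : r = r₀ := by grind
  exact hr₀

theorem children_left (h : IsSplitting F v a b) (hF : IsPartitionForest A F) :
    (F.splitAt v a b).children a = {b} := by
  have hla := h.left_notMem hF
  have hab := h.ne
  ext c
  rw [(h.isPartitionForest hF).mem_children, splitAt_parentOf, Finset.mem_singleton]
  constructor
  · rintro (h1 | ⟨c₀, p₀, h1, h2, h3⟩)
    · exact h1.1
    · have h4 := hF.mem_blocks _ _ h1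
      grind
  · exact fun h1 => .inl ⟨h1, rfl⟩

theorem children_right (h : IsSplitting F v a b) (hF : IsPartitionForest A F) :
    (F.splitAt v a b).children b = F.children v := by
  have hlb := h.right_notMem hF
  have hab := h.ne
  ext c
  rw [(h.isPartitionForest hF).mem_children, splitAt_parentOf, hF.mem_children]
  constructor
  · rintro (h1 | ⟨c₀, p₀, h1, h2, h3⟩)
    · exact (hab h1.2.symm).elim
    · have h4 := hF.mem_blocks _ _ h1
      have h5 := hF.parent_ne h1
      obtain rfl : p₀ = v := by grind
      rwa [h2, if_neg h5]
  · intro h1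
    have h5 := hF.parent_ne h1
    exact .inr ⟨c, v, h1, by rw [if_neg h5], by simp⟩

theorem children_of_ne (h : IsSplitting F v a b) (hF : IsPartitionForest A F) {x : Finset ℕ}
    (hx : x ∈ F.blocks) (hxv : x ≠ v) :
    (F.splitAt v a b).children x = (F.children x).image fun c => if c = v then a else c := by
  have hla := h.left_notMem hF
  have hlb := h.right_notMem hF
  ext c
  simp only [(h.isPartitionForest hF).mem_children, splitAt_parentOf, Finset.mem_image,
    hF.mem_children]
  constructor
  · rintro (h1 | ⟨c₀, p₀, h1, h2, h3⟩)
    · exact (hla (h1.2 ▸ hx)).elim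
    · obtain rfl : p₀ = x := by grind
      exact ⟨c₀, h1, h2.symm⟩
  · rintro ⟨c₀, h1, h2⟩
    exact .inr ⟨c₀, x, h1, h2.symm, by rw [if_neg hxv]⟩

/-- Since `a` is not an old block, renaming `v` to `a` merges no two children, so the number of
children of any other vertex is unchanged. -/
theorem top_injOn (h : IsSplitting F v a b) (hF : IsPartitionForest A F) (x : Finset ℕ) :
    Set.InjOn (fun c => if c = v then a else c) (F.children x : Set (Finset ℕ)) := by
  have hla := h.left_notMem hF
  intro c hc d hd e
  have h1 := (hF.mem_blocks _ _ (hF.mem_children.1 hc)).1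
  have h2 := (hF.mem_blocks _ _ (hF.mem_children.1 hd)).1
  dsimp only at e
  grind

theorem children_eq_singleton_of_ne (h : IsSplitting F v a b) (hF : IsPartitionForest A F)
    {x w : Finset ℕ} (hx : x ∈ F.blocks) (hxv : x ≠ v) (hw : w ∈ F.blocks) :
    (F.splitAt v a b).children x = {if w = v then a else w} ↔ F.children x = {w} := by
  have hla := h.left_notMem hF
  rw [h.children_of_ne hF hx hxv]
  constructor
  · intro e
    have hcard := congrArg Finset.card e
    rw [Finset.card_image_of_injOn (h.top_injOn hF x), Finset.card_singleton,
      Finset.card_eq_one] at hcard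
    obtain ⟨d, hd⟩ := hcard
    have h1 := (hF.mem_blocks _ _ (hF.mem_children.1 (hd ▸ Finset.mem_singleton_self d :
      d ∈ F.children x))).1
    rw [hd, Finset.image_singleton, Finset.singleton_inj] at e
    obtain rfl : d = w := by grind
    exact hd
  · intro e
    rw [e, Finset.image_singleton]

theorem card_children_of_ne (h : IsSplitting F v a b) (hF : IsPartitionForest A F)
    {x : Finset ℕ} (hx : x ∈ F.blocks) (hxv : x ≠ v) :
    ((F.splitAt v a b).children x).card = (F.children x).card := by
  rw [h.children_of_ne hF hx hxv, Finset.card_image_of_injOn (h.top_injOn hF x)]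

end IsSplitting

theorem IsPartitionForest.mem_of_children_eq (hF : IsPartitionForest A F) {x w : Finset ℕ}
    (h : F.children x = {w}) : F.ParentOf w x :=
  hF.mem_children.1 (h ▸ Finset.mem_singleton_self w)

theorem IsPartitionForest.mem_blocks_of_descends (hF : IsPartitionForest A F) {u : Finset ℕ}
    {p : List (Finset ℕ)} (h : F.Descends (u :: p)) (hu : u ∈ F.blocks) :
    ∀ x ∈ u :: p, x ∈ F.blocks := by
  induction p generalizing u with
  | nil => simpa using hu
  | cons w p ih =>
    rw [descends_cons_cons] at h
    have := ih h.2 (hF.mem_blocks _ _ (hF.mem_of_children_eq h.1)).1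
    simp_all

theorem IsPartitionForest.reach_of_descends (hF : IsPartitionForest A F) {u : Finset ℕ}
    {p : List (Finset ℕ)} (h : F.Descends (u :: p)) :
    ∀ x ∈ p, TransGen F.ParentOf x u := by
  induction p generalizing u with
  | nil => simp
  | cons w p ih =>
    rw [descends_cons_cons] at h
    have h1 := hF.mem_of_children_eq h.1
    intro x hx
    rcases List.mem_cons.1 hx with rfl | hx
    · exact .single h1
    · exact (ih h.2 x hx).tail h1

theorem IsPartitionForest.nodup_of_descends (hF : IsPartitionForest A F) {u : Finset ℕ}
    {p : List (Finset ℕ)} (h : F.Descends (u :: p)) : (u :: p).Nodup := by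
  induction p generalizing u with
  | nil => simp
  | cons w p ih =>
    refine List.nodup_cons.2 ⟨fun hu => hF.acyclic u (hF.reach_of_descends h u hu), ?_⟩
    rw [descends_cons_cons] at h
    exact ih h.2

theorem IsPartitionForest.mem_blocks_of_isMinPath (hF : IsPartitionForest A F)
    {p : List (Finset ℕ)} (h : F.IsMinPath p) : ∀ x ∈ p, x ∈ F.blocks := by
  obtain ⟨a, t, rfl, h1, h2⟩ := h.exists_cons
  exact hF.mem_blocks_of_descends h2 (hF.mem_roots.1 h1.1).1

theorem IsPartitionForest.nodup_of_isMinPath (hF : IsPartitionForest A F)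
    {p : List (Finset ℕ)} (h : F.IsMinPath p) : p.Nodup := by
  obtain ⟨a, t, rfl, h1, h2⟩ := h.exists_cons
  exact hF.nodup_of_descends h2

namespace IsSplitting

variable {v a b : Finset ℕ}

theorem descends_splitAt_of_notMem (h : IsSplitting F v a b) (hF : IsPartitionForest A F)
    {p : List (Finset ℕ)} (hp : ∀ x ∈ p, x ∈ F.blocks) (hv : v ∉ p) :
    (F.splitAt v a b).Descends p ↔ F.Descends p := by
  induction p with
  | nil => simp [Descends]
  | cons u p ih =>
    have hu : u ∈ F.blocks := hp u (by simp)
    have huv : u ≠ v := fun e => hv (by simp [e])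
    cases p with
    | nil => rw [descends_singleton, descends_singleton, h.card_children_of_ne hF hu huv]
    | cons w p =>
      have hw : w ∈ F.blocks := hp w (by simp)
      have hwv : w ≠ v := fun e => hv (by simp [e])
      have := h.children_eq_singleton_of_ne hF hu huv hw
      rw [if_neg hwv] at this
      rw [descends_cons_cons, descends_cons_cons, this,
        ih (fun x hx => hp x (List.mem_cons_of_mem _ hx)) fun hx => hv (List.mem_cons_of_mem _ hx)]

/-- The new vertex `a` has `b` as its only child and `b` has the old children of `v`, so the path is
merely lengthened at `v` and stops at the same end. -/
theorem descends_splitAt (h : IsSplitting F v a b) (hF : IsPartitionForest A F)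
    {p q : List (Finset ℕ)} (hp : ∀ x ∈ p ++ v :: q, x ∈ F.blocks) (hv : v ∉ p) (hq : v ∉ q) :
    (F.splitAt v a b).Descends (p ++ a :: b :: q) ↔ F.Descends (p ++ v :: q) := by
  induction p with
  | nil =>
    rw [List.nil_append, List.nil_append, descends_cons_cons, h.children_left hF,
      and_iff_right rfl]
    cases q with
    | nil => rw [descends_singleton, descends_singleton, h.children_right hF]
    | cons w q =>
      rw [descends_cons_cons, descends_cons_cons, h.children_right hF,
        h.descends_splitAt_of_notMem hF (fun x hx => hp x (by simp_all)) hq]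
  | cons u p ih =>
    have hu : u ∈ F.blocks := hp u (by simp)
    have huv : u ≠ v := fun e => hv (by simp [e])
    have ih := ih (fun x hx => hp x (List.mem_cons_of_mem _ hx))
      fun hx => hv (List.mem_cons_of_mem _ hx)
    cases p with
    | nil =>
      have := h.children_eq_singleton_of_ne hF hu huv h.mem
      rw [if_pos rfl] at this
      simp only [List.nil_append, List.cons_append] at ih ⊢
      rw [descends_cons_cons, this, ih, descends_cons_cons (u := u)]
    | cons w p =>
      have hw : w ∈ F.blocks := hp w (by simp)
      have hwv : w ≠ v := fun e => hv (by simp [e])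
      have := h.children_eq_singleton_of_ne hF hu huv hw
      rw [if_neg hwv] at this
      simp only [List.cons_append] at ih ⊢
      rw [descends_cons_cons, this, ih, descends_cons_cons]

theorem isMinPath_splitAt (h : IsSplitting F v a b) (hF : IsPartitionForest A F)
    {p q : List (Finset ℕ)} (hp : ∀ x ∈ p ++ v :: q, x ∈ F.blocks) (hv : v ∉ p) (hq : v ∉ q) :
    (F.splitAt v a b).IsMinPath (p ++ a :: b :: q) ↔ F.IsMinPath (p ++ v :: q) := by
  have hd := h.descends_splitAt hF hp hv hq
  cases p with
  | nil =>
    have h1 := h.isMinRoot_splitAt hF h.mem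
    rw [if_pos rfl] at h1
    rw [List.nil_append, List.nil_append, isMinPath_cons, isMinPath_cons, h1]
    exact and_congr_right fun _ => hd
  | cons u p =>
    have hu : u ∈ F.blocks := hp u (by simp)
    have huv : u ≠ v := fun e => hv (by simp [e])
    have h1 := h.isMinRoot_splitAt hF hu
    rw [if_neg huv] at h1
    rw [List.cons_append, List.cons_append, isMinPath_cons, isMinPath_cons, h1]
    exact and_congr_right fun _ => hd

end IsSplitting

/-! ### Contracting an edge to an only child -/

section contract

variable {u v : Finset ℕ}

theorem IsPartitionForest.union_notMem (hF : IsPartitionForest A F) (hu : u ∈ F.blocks)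
    (hv : v ∈ F.blocks) (huv : u ≠ v) : u ∪ v ∉ F.blocks := by
  intro h
  obtain ⟨x, hx⟩ := hF.nonempty hu
  obtain ⟨y, hy⟩ := hF.nonempty hv
  have h1 := hF.eq_of_mem hu h hx (Finset.mem_union_left _ hx)
  have h2 := hF.eq_of_mem hv h hy (Finset.mem_union_right _ hy)
  exact huv (h1.trans h2.symm)

theorem contract_parentOf {c p : Finset ℕ} :
    (F.contract u v).ParentOf c p ↔ ∃ c₀ p₀, ¬ (c₀ = v ∧ p₀ = u) ∧ F.ParentOf c₀ p₀ ∧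
      c = (if c₀ = u ∨ c₀ = v then u ∪ v else c₀) ∧
      p = (if p₀ = u ∨ p₀ = v then u ∪ v else p₀) := by
  simp only [contract, ParentOf, Finset.mem_image, Finset.mem_erase, Prod.exists, Prod.mk.injEq,
    ne_eq, and_assoc]
  grind

theorem IsPartitionForest.contract (hF : IsPartitionForest A F) (h : F.children u = {v}) :
    IsPartitionForest A (F.contract u v) := by
  have hvu := hF.mem_of_children_eq h
  obtain ⟨hv, hu⟩ := hF.mem_blocks _ _ hvu
  have hne := hF.parent_ne hvu
  have hw := hF.union_notMem hu hv hne.symm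
  have hch : ∀ c, F.ParentOf c u → c = v := fun c hc => by
    simpa [h] using hF.mem_children.2 hc
  refine ⟨?_, ?_, ?_, ?_, ?_, ?_⟩
  · simp only [BlockForest.contract, Finset.mem_insert, Finset.mem_erase, not_or]
    refine ⟨fun e => ?_, fun e => hF.empty_notMem e.2.2⟩
    have := (hF.nonempty hu).mono (Finset.subset_union_left (s₂ := v))
    exact this.ne_empty e.symm
  · have h1 : ∀ x ∈ F.blocks, x ≠ u → x ≠ v → Disjoint (u ∪ v) x := fun x hx h1 h2 =>
      Finset.disjoint_union_left.2 ⟨hF.disjoint u hu x hx h1.symm, hF.disjoint v hv x hx h2.symm⟩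
    intro x hx y hy hxy
    simp only [BlockForest.contract, Finset.mem_insert, Finset.mem_erase] at hx hy
    rcases hx with rfl | ⟨hxv, hxu, hx⟩ <;> rcases hy with rfl | ⟨hyv, hyu, hy⟩
    · exact (hxy rfl).elim
    · exact h1 y hy hyu hyv
    · exact (h1 x hx hxu hxv).symm
    · exact hF.disjoint x hx y hy hxy
  · ext x
    rw [hF.mem_ground_iff]
    simp only [BlockForest.contract, Finset.mem_biUnion, Finset.mem_insert, Finset.mem_erase, id]
    constructor
    · rintro ⟨w, rfl | ⟨_, _, hw⟩, hx⟩
      · rcases Finset.mem_union.1 hx with hx | hx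
        · exact ⟨u, hu, hx⟩
        · exact ⟨v, hv, hx⟩
      · exact ⟨w, hw, hx⟩
    · rintro ⟨w, hw, hx⟩
      by_cases hwu : w = u
      · exact ⟨_, .inl rfl, Finset.mem_union_left _ (hwu ▸ hx)⟩
      by_cases hwv : w = v
      · exact ⟨_, .inl rfl, Finset.mem_union_right _ (hwv ▸ hx)⟩
      exact ⟨w, .inr ⟨hwv, hwu, hw⟩, hx⟩
  · intro c p hcp
    obtain ⟨c₀, p₀, -, h1, rfl, rfl⟩ := contract_parentOf.1 hcp
    have := hF.mem_blocks _ _ h1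
    simp only [BlockForest.contract, Finset.mem_insert, Finset.mem_erase]
    grind
  · intro c p p' hp hp'
    obtain ⟨c₀, p₀, h0, h1, rfl, rfl⟩ := contract_parentOf.1 hp
    obtain ⟨c₁, p₁, h0', h1', e, rfl⟩ := contract_parentOf.1 hp'
    have h2 := hF.mem_blocks _ _ h1
    have h2' := hF.mem_blocks _ _ h1'
    have h3 : c₀ ≠ v := fun e' => h0 ⟨e', hF.parent_unique _ _ _ h1 (e' ▸ hvu)⟩
    have h3' : c₁ ≠ v := fun e' => h0' ⟨e', hF.parent_unique _ _ _ h1' (e' ▸ hvu)⟩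
    obtain rfl : c₀ = c₁ := by grind
    rw [hF.parent_unique _ _ _ h1 h1']
  · obtain ⟨k, hk⟩ := hF.exists_rank
    -- As `v` is the only child of `u`, all edges into the merged vertex come from children of `v`,
    -- whose ranks exceed `k v` and hence `k u`.
    refine acyclic_of_rank (fun x => if x = u ∪ v then k u else k x) ?_
    intro c p hcp
    obtain ⟨c₀, p₀, h0, h1, rfl, rfl⟩ := contract_parentOf.1 hcp
    have h2 := hF.mem_blocks _ _ h1
    have h3 := hk _ _ h1
    have h4 := hk _ _ hvu
    have h5 : c₀ ≠ v := fun e' => h0 ⟨e', hF.parent_unique _ _ _ h1 (e' ▸ hvu)⟩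
    have h6 : p₀ ≠ u := fun e' => h5 (hch _ (e' ▸ h1))
    have h7 : c₀ ≠ u ∪ v := fun e => hw (e ▸ h2.1)
    have h8 : p₀ ≠ u ∪ v := fun e => hw (e ▸ h2.2)
    grind

/-- Makes the lemmas on splittings available for contractions, by applying them to the contracted
forest. -/
theorem IsPartitionForest.isSplitting_contract (hF : IsPartitionForest A F)
    (h : F.children u = {v}) : IsSplitting (F.contract u v) (u ∪ v) u v := by
  have hvu := hF.mem_of_children_eq h
  obtain ⟨hv, hu⟩ := hF.mem_blocks _ _ hvu
  exact ⟨by simp [BlockForest.contract], rfl, hF.disjoint u hu v hv (hF.parent_ne hvu).symm,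
    hF.nonempty hu, hF.nonempty hv⟩

/-- The only-child hypothesis is essential: splitting hands all children to the lower part, so a
further child of `u` would end up below `v`. -/
theorem IsPartitionForest.splitAt_contract (hF : IsPartitionForest A F)
    (h : F.children u = {v}) : (F.contract u v).splitAt (u ∪ v) u v = F := by
  have hvu := hF.mem_of_children_eq h
  obtain ⟨hv, hu⟩ := hF.mem_blocks _ _ hvu
  have hne := hF.parent_ne hvu
  have hw := hF.union_notMem hu hv hne.symm
  have hch : ∀ c, F.ParentOf c u → c = v := fun c hc => by
    simpa [h] using hF.mem_children.2 hc
  ext1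
  · ext x
    simp only [BlockForest.contract, splitAt, Finset.mem_insert, Finset.mem_erase]
    grind
  · ext ⟨c, p⟩
    change ((F.contract u v).splitAt (u ∪ v) u v).ParentOf c p ↔ F.ParentOf c p
    rw [splitAt_parentOf]
    constructor
    · rintro (⟨rfl, rfl⟩ | ⟨c₁, p₁, h0, rfl, rfl⟩)
      · exact hvu
      · obtain ⟨c₀, p₀, hn, h1, rfl, rfl⟩ := contract_parentOf.1 h0
        have h2 := hF.mem_blocks _ _ h1
        have h5 : c₀ ≠ v := fun e' => hn ⟨e', hF.parent_unique _ _ _ h1 (e' ▸ hvu)⟩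
        have h6 : p₀ ≠ u := fun e' => h5 (hch _ (e' ▸ h1))
        convert h1 using 1 <;> grind
    · intro h1
      have h2 := hF.mem_blocks _ _ h1
      by_cases h3 : c = v
      · exact .inl ⟨h3, hF.parent_unique _ _ _ h1 (h3 ▸ hvu)⟩
      have h6 : p ≠ u := fun e' => h3 (hch _ (e' ▸ h1))
      refine .inr ⟨_, _, contract_parentOf.2 ⟨c, p, fun e => h3 e.1, h1, rfl, rfl⟩, ?_, ?_⟩ <;>
        grind

end contract

end BlockForest

/-! ### Deleting the path `h(F)` and restoring it above another forest -/

namespace BlockForest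

variable {A : Finset ℕ} {F F' : BlockForest} {p : List (Finset ℕ)} {a b : Finset ℕ}

/-- The vertices in `p` form the top part of a component with root `a`, and all edges that
leave `p` start at `b`. -/
structure IsStem (F : BlockForest) (p : List (Finset ℕ)) (a b : Finset ℕ) : Prop where
  mem_blocks : ∀ x ∈ p, x ∈ F.blocks
  root : a ∈ F.roots
  first : a ∈ p
  last : b ∈ p
  reach : ∀ x ∈ p, ReflTransGen F.ParentOf x a
  up : ∀ c q, F.ParentOf c q → c ∈ p → q ∈ p
  down : ∀ c q, F.ParentOf c q → q ∈ p → c ∉ p → q = b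
  bottom : ∀ c, F.ParentOf c b → c ∉ p

theorem IsPartitionForest.reach_last (hF : IsPartitionForest A F) {u : Finset ℕ}
    {p : List (Finset ℕ)} (h : F.Descends (u :: p)) {b : Finset ℕ} (hb : b ∈ (u :: p).getLast?) :
    b ∈ u :: p ∧ ∀ x ∈ u :: p, ReflTransGen F.ParentOf b x := by
  refine ⟨List.mem_of_getLast? hb, ?_⟩
  induction p generalizing u with
  | nil =>
    obtain rfl : u = b := by simpa using hb
    simpa using ReflTransGen.refl
  | cons w p ih =>
    rw [descends_cons_cons] at h
    have h1 := hF.mem_of_children_eq h.1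
    have ih := ih h.2 (by simpa using hb)
    intro x hx
    rcases List.mem_cons.1 hx with rfl | hx
    · exact (ih w (by simp)).tail h1
    · exact ih x hx

theorem IsPartitionForest.parent_mem_of_descends (hF : IsPartitionForest A F) {u : Finset ℕ}
    {p : List (Finset ℕ)} (h : F.Descends (u :: p)) :
    ∀ c q, F.ParentOf c q → c ∈ p → q ∈ u :: p := by
  induction p generalizing u with
  | nil => simp
  | cons w p ih =>
    rw [descends_cons_cons] at h
    have h1 := hF.mem_of_children_eq h.1
    intro c q hcq hc
    rcases List.mem_cons.1 hc with rfl | hc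
    · rw [hF.parent_unique _ _ _ hcq h1]
      simp
    · exact List.mem_cons_of_mem _ (ih h.2 c q hcq hc)

theorem IsPartitionForest.child_mem_of_descends (hF : IsPartitionForest A F) {u : Finset ℕ}
    {p : List (Finset ℕ)} (h : F.Descends (u :: p)) {b : Finset ℕ} (hb : b ∈ (u :: p).getLast?) :
    ∀ c q, F.ParentOf c q → q ∈ u :: p → q ≠ b → c ∈ p := by
  induction p generalizing u with
  | nil =>
    obtain rfl : u = b := by simpa using hb
    simp_all
  | cons w p ih =>
    rw [descends_cons_cons] at h
    have ih := ih h.2 (by simpa using hb)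
    intro c q hcq hq hqb
    rcases List.mem_cons.1 hq with rfl | hq
    · have := hF.mem_children.2 hcq
      rw [h.1, Finset.mem_singleton] at this
      simp [this]
    · exact List.mem_cons_of_mem _ (ih c q hcq hq hqb)

/-- Isolates what deletion and restoration need: a path of only children is left upwards nowhere,
and downwards only from its last vertex. -/
theorem IsPartitionForest.isStem (hF : IsPartitionForest A F) {t : List (Finset ℕ)}
    (ha : a ∈ F.roots) (h : F.Descends (a :: t)) (hb : b ∈ (a :: t).getLast?) :
    IsStem F (a :: t) a b := by
  obtain ⟨h1, h2⟩ := hF.reach_last h hb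
  refine ⟨hF.mem_blocks_of_descends h (hF.mem_roots.1 ha).1, ha, by simp, h1, ?_, ?_, ?_, ?_⟩
  · intro x hx
    rcases List.mem_cons.1 hx with rfl | hx
    · exact .refl
    · exact (hF.reach_of_descends h x hx).to_reflTransGen
  · intro c q hcq hc
    rcases List.mem_cons.1 hc with rfl | hc
    · exact ((hF.mem_roots.1 ha).2 _ hcq).elim
    · exact hF.parent_mem_of_descends h c q hcq hc
  · intro c q hcq hq hc
    by_contra hqb
    exact hc (List.mem_cons_of_mem _ (hF.child_mem_of_descends h hb c q hcq hq hqb))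
  · intro c hc hcp
    exact hF.acyclic b (TransGen.tail' (h2 c hcp) hc)

/-- Equality of the sets of children would be too strong a hypothesis: at the last vertex these sets
change under `restore`, and only not having exactly one child survives. -/
theorem descends_congr (h : ∀ x ∈ p, ∀ w, F.children x = {w} ↔ F'.children x = {w}) :
    F.Descends p ↔ F'.Descends p := by
  induction p with
  | nil => simp [Descends]
  | cons u p ih =>
    have ih := ih fun x hx => h x (List.mem_cons_of_mem _ hx)
    cases p with
    | nil =>
      rw [descends_singleton, descends_singleton, ne_eq, ne_eq, Finset.card_eq_one,
        Finset.card_eq_one, not_iff_not]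
      exact exists_congr fun w => h u (by simp) w
    | cons w p => rw [descends_cons_cons, descends_cons_cons, h u (by simp) w, ih]

theorem delete_parentOf {c q : Finset ℕ} :
    (F.delete p).ParentOf c q ↔ F.ParentOf c q ∧ c ∉ p ∧ q ∉ p := by
  simp [delete, ParentOf]

theorem mem_blocks_delete {c : Finset ℕ} :
    c ∈ (F.delete p).blocks ↔ c ∈ F.blocks ∧ c ∉ p := by
  simp [delete]

theorem IsPartitionForest.delete (hF : IsPartitionForest A F) (hp : ∀ x ∈ p, x ∈ F.blocks) :
    IsPartitionForest (A \ p.toFinset.biUnion id) (F.delete p) := by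
  refine ⟨fun h => hF.empty_notMem (mem_blocks_delete.1 h).1, fun u hu v hv h =>
    hF.disjoint u (mem_blocks_delete.1 hu).1 v (mem_blocks_delete.1 hv).1 h, ?_, ?_, ?_, ?_⟩
  · ext x
    simp only [Finset.mem_biUnion, mem_blocks_delete, Finset.mem_sdiff, hF.mem_ground_iff, id,
      List.mem_toFinset, not_exists, not_and]
    constructor
    · rintro ⟨w, ⟨hw, hwp⟩, hx⟩
      refine ⟨⟨w, hw, hx⟩, fun v hv hxv => ?_⟩
      exact hwp (hF.eq_of_mem hw (hp v hv) hx hxv ▸ hv)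
    · rintro ⟨⟨w, hw, hx⟩, h⟩
      exact ⟨w, ⟨hw, fun hwp => h w hwp hx⟩, hx⟩
  · intro c q h
    rw [delete_parentOf] at h
    simp only [mem_blocks_delete]
    have := hF.mem_blocks _ _ h.1
    tauto
  · intro c q q' h h'
    exact hF.parent_unique _ _ _ (delete_parentOf.1 h).1 (delete_parentOf.1 h').1
  · obtain ⟨k, hk⟩ := hF.exists_rank
    exact acyclic_of_rank k fun c q h => hk _ _ (delete_parentOf.1 h).1

/-- The label sets of the components of `F.delete p` that are below `b` in `F`. -/
noncomputable def hangingLabels (F : BlockForest) (p : List (Finset ℕ)) (b : Finset ℕ) :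
    Finset (Finset ℕ) :=
  (F.children b).image (F.delete p).labelsBelow

theorem restore_parentOf {c q : Finset ℕ} :
    (F.restore p b F').ParentOf c q ↔ (F.ParentOf c q ∧ c ∈ p ∧ q ∈ p) ∨ F'.ParentOf c q ∨
      (q = b ∧ c ∈ F'.roots ∧ F'.labelsBelow c ∈ F.hangingLabels p b) := by
  simp only [restore, ParentOf, Finset.mem_union, Finset.mem_filter, Finset.mem_image,
    Prod.mk.injEq, hangingLabels]
  grind

theorem mem_blocks_restore {c : Finset ℕ} :
    c ∈ (F.restore p b F').blocks ↔ c ∈ p ∨ c ∈ F'.blocks := by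
  simp [restore]

/-- The forest from which the stem was taken matters only through its edges inside `p` and the label
sets hanging below `b`. -/
theorem restore_congr {G : BlockForest}
    (h1 : ∀ c q, c ∈ p → q ∈ p → (F.ParentOf c q ↔ G.ParentOf c q))
    (h2 : F.hangingLabels p b = G.hangingLabels p b) :
    F.restore p b F' = G.restore p b F' := by
  ext1
  · ext x
    rw [mem_blocks_restore, mem_blocks_restore]
  · ext ⟨c, q⟩
    change (F.restore p b F').ParentOf c q ↔ (G.restore p b F').ParentOf c q
    rw [restore_parentOf, restore_parentOf, h2]
    have := h1 c q
    tauto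

namespace IsStem

theorem mem_roots_delete (h : IsStem F p a b) (hF : IsPartitionForest A F) {c : Finset ℕ}
    (hc : F.ParentOf c b) : c ∈ (F.delete p).roots := by
  rw [(hF.delete h.mem_blocks).mem_roots, mem_blocks_delete]
  refine ⟨⟨(hF.mem_blocks _ _ hc).1, h.bottom c hc⟩, fun q hq => ?_⟩
  rw [delete_parentOf] at hq
  exact hq.2.2 (hF.parent_unique _ _ _ hc hq.1 ▸ h.last)

theorem hangingLabels_subset (h : IsStem F p a b) (hF : IsPartitionForest A F) :
    F.hangingLabels p b ⊆ (F.delete p).componentLabels := by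
  refine Finset.image_subset_image fun c hc => ?_
  exact h.mem_roots_delete hF (hF.mem_children.1 hc)

/-- Distinct children of `b` become distinct roots after deletion, and distinct roots have distinct
label sets. So the number of children of `b` can be computed from data that `restore` preserves. -/
theorem card_hangingLabels (h : IsStem F p a b) (hF : IsPartitionForest A F) :
    (F.hangingLabels p b).card = (F.children b).card := by
  refine Finset.card_image_of_injOn fun c hc d hd e => ?_
  exact (hF.delete h.mem_blocks).labelsBelow_injOn
    (h.mem_roots_delete hF (hF.mem_children.1 hc)) (h.mem_roots_delete hF (hF.mem_children.1 hd)) e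

theorem restore_delete (h : IsStem F p a b) (hF : IsPartitionForest A F) :
    F.restore p b (F.delete p) = F := by
  ext1
  · ext x
    rw [mem_blocks_restore, mem_blocks_delete]
    have := h.mem_blocks x
    tauto
  · ext ⟨c, q⟩
    change (F.restore p b (F.delete p)).ParentOf c q ↔ F.ParentOf c q
    rw [restore_parentOf, delete_parentOf]
    constructor
    · rintro (h1 | h1 | ⟨rfl, h1, h2⟩)
      · exact h1.1
      · exact h1.1
      · obtain ⟨d, hd, e⟩ := Finset.mem_image.1 h2
        rw [hF.mem_children] at hd
        rwa [← (hF.delete h.mem_blocks).labelsBelow_injOn (h.mem_roots_delete hF hd) h1 e]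
    · intro h1
      by_cases hq : q ∈ p
      · by_cases hc : c ∈ p
        · exact .inl ⟨h1, hc, hq⟩
        · obtain rfl := h.down c q h1 hq hc
          exact .inr (.inr ⟨rfl, h.mem_roots_delete hF h1,
            Finset.mem_image_of_mem _ (hF.mem_children.2 h1)⟩)
      · exact .inr (.inl ⟨h1, fun hc => hq (h.up c q h1 hc), hq⟩)

end IsStem

/-- The situation in which the forest `F'` can be put below the stem `p` of `F`. -/
structure IsGraft (A : Finset ℕ) (F : BlockForest) (p : List (Finset ℕ)) (a b : Finset ℕ)
    (F' : BlockForest) : Prop where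
  forest : IsPartitionForest A F
  stem : IsStem F p a b
  forest' : IsPartitionForest (A \ p.toFinset.biUnion id) F'
  labels : F'.componentLabels = (F.delete p).componentLabels

namespace IsGraft

theorem self (hF : IsPartitionForest A F) (h : IsStem F p a b) :
    IsGraft A F p a b (F.delete p) :=
  ⟨hF, h, hF.delete h.mem_blocks, rfl⟩

variable (h : IsGraft A F p a b F')

include h

theorem notMem {x : Finset ℕ} (hx : x ∈ F'.blocks) : x ∉ p := by
  intro hxp
  obtain ⟨y, hy⟩ := h.forest'.nonempty hx
  have := h.forest'.subset hx hy
  simp only [Finset.mem_sdiff, Finset.mem_biUnion, List.mem_toFinset, not_exists, not_and] at this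
  exact this.2 x hxp hy

/-- Agreement of the component labels guarantees that each component formerly below `b` has a
counterpart in `F'`, so none is lost on reattaching. -/
theorem exists_attached {L : Finset ℕ} (hL : L ∈ F.hangingLabels p b) :
    ∃ r ∈ F'.roots, F'.labelsBelow r = L := by
  have := h.stem.hangingLabels_subset h.forest hL
  rw [← h.labels] at this
  exact Finset.mem_image.1 this

theorem ground_subset : p.toFinset.biUnion id ⊆ A := by
  intro x hx
  obtain ⟨v, hv, hxv⟩ := Finset.mem_biUnion.1 hx
  exact h.forest.subset (h.stem.mem_blocks v (List.mem_toFinset.1 hv)) hxv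

theorem isPartitionForest : IsPartitionForest A (F.restore p b F') := by
  have hd : ∀ u ∈ p, ∀ v ∈ F'.blocks, Disjoint u v := fun u hu v hv => by
    refine Finset.disjoint_left.2 fun x hx hxv => ?_
    have := h.forest'.subset hv hxv
    simp only [Finset.mem_sdiff, Finset.mem_biUnion, List.mem_toFinset, not_exists, not_and] at this
    exact this.2 u hu hx
  have hroot : ∀ {r}, r ∈ F'.roots → r ∈ F'.blocks := fun hr => (h.forest'.mem_roots.1 hr).1
  refine ⟨?_, ?_, ?_, ?_, ?_, ?_⟩
  · rw [mem_blocks_restore]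
    rintro (h1 | h1)
    · exact h.forest.empty_notMem (h.stem.mem_blocks _ h1)
    · exact h.forest'.empty_notMem h1
  · intro u hu v hv huv
    rw [mem_blocks_restore] at hu hv
    rcases hu with hu | hu <;> rcases hv with hv | hv
    · exact h.forest.disjoint u (h.stem.mem_blocks _ hu) v (h.stem.mem_blocks _ hv) huv
    · exact hd u hu v hv
    · exact (hd v hv u hu).symm
    · exact h.forest'.disjoint u hu v hv huv
  · have e : (F.restore p b F').blocks = p.toFinset ∪ F'.blocks := rfl
    rw [e, Finset.union_biUnion, h.forest'.union]
    exact Finset.union_sdiff_of_subset h.ground_subset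
  · intro c q hcq
    rw [mem_blocks_restore, mem_blocks_restore]
    rcases restore_parentOf.1 hcq with h1 | h1 | ⟨rfl, h1, -⟩
    · exact ⟨.inl h1.2.1, .inl h1.2.2⟩
    · have := h.forest'.mem_blocks _ _ h1
      exact ⟨.inr this.1, .inr this.2⟩
    · exact ⟨.inr (hroot h1), .inl h.stem.last⟩
  · intro c q q' g1 g2
    rcases restore_parentOf.1 g1 with h1 | h1 | ⟨rfl, h1, -⟩ <;>
      rcases restore_parentOf.1 g2 with h2 | h2 | ⟨h3, h2, -⟩
    · exact h.forest.parent_unique _ _ _ h1.1 h2.1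
    · exact (h.notMem (h.forest'.mem_blocks _ _ h2).1 h1.2.1).elim
    · exact (h.notMem (hroot h2) h1.2.1).elim
    · exact (h.notMem (h.forest'.mem_blocks _ _ h1).1 h2.2.1).elim
    · exact h.forest'.parent_unique _ _ _ h1 h2
    · exact ((h.forest'.mem_roots.1 h2).2 _ h1).elim
    · exact (h.notMem (hroot h1) h2.2.1).elim
    · exact ((h.forest'.mem_roots.1 h1).2 _ h2).elim
    · exact h3.symm
  · obtain ⟨k, hk⟩ := h.forest.exists_rank
    obtain ⟨k', hk'⟩ := h.forest'.exists_rank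
    -- All of `F'` is ranked above `k b`; this suffices because the only edges from `F'` into the
    -- stem end at `b`.
    refine acyclic_of_rank (fun x => if x ∈ p then k x else k b + 1 + k' x) ?_
    intro c q hcq
    rcases restore_parentOf.1 hcq with h1 | h1 | ⟨rfl, h1, -⟩
    · simpa only [if_pos h1.2.1, if_pos h1.2.2] using hk _ _ h1.1
    · have h2 := h.forest'.mem_blocks _ _ h1
      simp only [if_neg (h.notMem h2.1), if_neg (h.notMem h2.2)]
      have := hk' _ _ h1
      omega
    · simp only [if_neg (h.notMem (hroot h1)), if_pos h.stem.last]
      omega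

theorem parentOf_of_notMem {c q : Finset ℕ} (hq : q ∉ p) :
    (F.restore p b F').ParentOf c q ↔ F'.ParentOf c q := by
  rw [restore_parentOf]
  constructor
  · rintro (h1 | h1 | ⟨rfl, -, -⟩)
    · exact (hq h1.2.2).elim
    · exact h1
    · exact (hq h.stem.last).elim
  · exact fun h1 => .inr (.inl h1)

/-- An edge whose upper end lies outside the stem is an edge of `F'`, so nothing new appears below a
vertex of `F'`. -/
theorem reach_of_notMem {c q : Finset ℕ} (hq : q ∈ F'.blocks) :
    ReflTransGen (F.restore p b F').ParentOf c q ↔ ReflTransGen F'.ParentOf c q := by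
  constructor
  · intro h1
    induction h1 using ReflTransGen.head_induction_on with
    | refl => exact .refl
    | head h1 _ ih =>
      have h2 := h.forest'.mem_blocks_of_reach' hq ih
      exact .head ((h.parentOf_of_notMem (h.notMem h2)).1 h1) ih
  · exact fun h2 => ReflTransGen.lift id (fun c q h1 => restore_parentOf.2 (.inr (.inl h1))) _ _ h2

theorem labelsBelow_of_mem {x : Finset ℕ} (hx : x ∈ F'.blocks) :
    (F.restore p b F').labelsBelow x = F'.labelsBelow x := by
  ext y
  simp only [IsPartitionForest.mem_labelsBelow, h.reach_of_notMem hx, mem_blocks_restore]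
  constructor
  · rintro ⟨c, -, h1, h2⟩
    exact ⟨c, h.forest'.mem_blocks_of_reach' hx h1, h1, h2⟩
  · rintro ⟨c, hc, h1, h2⟩
    exact ⟨c, .inr hc, h1, h2⟩

theorem reach_first {x : Finset ℕ} (hx : x ∈ p) :
    ReflTransGen (F.restore p b F').ParentOf x a := by
  have := h.stem.reach x hx
  induction this using ReflTransGen.head_induction_on with
  | refl => exact .refl
  | head h1 _ ih =>
    have h2 := h.stem.up _ _ h1 hx
    exact .head (restore_parentOf.2 (.inl ⟨h1, hx, h2⟩)) (ih h2)

theorem reach_first_iff {c : Finset ℕ} :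
    ReflTransGen (F.restore p b F').ParentOf c a ↔ c ∈ p ∨ ∃ r ∈ F'.roots,
      F'.labelsBelow r ∈ F.hangingLabels p b ∧ ReflTransGen F'.ParentOf c r := by
  constructor
  · intro h1
    induction h1 using ReflTransGen.head_induction_on with
    | refl => exact .inl h.stem.first
    | head h1 _ ih =>
      rcases restore_parentOf.1 h1 with h1 | h1 | ⟨rfl, h1, h2⟩
      · exact .inl h1.2.1
      · rcases ih with ih | ⟨r, h2, h3, h4⟩
        · exact (h.notMem (h.forest'.mem_blocks _ _ h1).2 ih).elim
        · exact .inr ⟨r, h2, h3, .head h1 h4⟩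
      · exact .inr ⟨_, h1, h2, .refl⟩
  · rintro (h1 | ⟨r, h2, h3, h4⟩)
    · exact h.reach_first h1
    · have h5 := (h.reach_of_notMem (h.forest'.mem_roots.1 h2).1).2 h4
      exact (h5.tail (restore_parentOf.2 (.inr (.inr ⟨rfl, h2, h3⟩)))).trans
        (h.reach_first h.stem.last)

/-- The right-hand side does not mention `F'`: the component of the stem keeps its labels whichever
forest is attached. -/
theorem labelsBelow_first : (F.restore p b F').labelsBelow a =
    p.toFinset.biUnion id ∪ (F.hangingLabels p b).biUnion id := by
  ext y
  simp only [IsPartitionForest.mem_labelsBelow, h.reach_first_iff, mem_blocks_restore,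
    Finset.mem_union, Finset.mem_biUnion, List.mem_toFinset, id]
  constructor
  · rintro ⟨c, hc, h1 | ⟨r, h2, h3, h4⟩, hy⟩
    · exact .inl ⟨c, h1, hy⟩
    · have hr := (h.forest'.mem_roots.1 h2).1
      exact .inr ⟨_, h3, IsPartitionForest.mem_labelsBelow.2
        ⟨c, h.forest'.mem_blocks_of_reach' hr h4, h4, hy⟩⟩
  · rintro (⟨c, hc, hy⟩ | ⟨L, hL, hy⟩)
    · exact ⟨c, .inl hc, .inl hc, hy⟩
    · obtain ⟨r, hr, rfl⟩ := h.exists_attached hL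
      obtain ⟨c, hc, h1, h2⟩ := IsPartitionForest.mem_labelsBelow.1 hy
      exact ⟨c, .inr hc, .inr ⟨r, hr, hL, h1⟩, h2⟩

theorem mem_roots {r : Finset ℕ} : r ∈ (F.restore p b F').roots ↔
    r = a ∨ (r ∈ F'.roots ∧ F'.labelsBelow r ∉ F.hangingLabels p b) := by
  rw [h.isPartitionForest.mem_roots, mem_blocks_restore]
  constructor
  · rintro ⟨h1 | h1, h2⟩
    · rcases ReflTransGen.cases_head (h.reach_first h1) with h3 | ⟨q, hq, -⟩
      · exact .inl h3
      · exact (h2 q hq).elim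
    · have h3 : r ∈ F'.roots := h.forest'.mem_roots.2
        ⟨h1, fun q hq => h2 q (restore_parentOf.2 (.inr (.inl hq)))⟩
      exact .inr ⟨h3, fun h4 => h2 b (restore_parentOf.2 (.inr (.inr ⟨rfl, h3, h4⟩)))⟩
  · rintro (rfl | ⟨h1, h2⟩)
    · refine ⟨.inl h.stem.first, fun q hq => ?_⟩
      rcases restore_parentOf.1 hq with h1 | h1 | ⟨rfl, h1, h2⟩
      · exact (h.forest.mem_roots.1 h.stem.root).2 q h1.1
      · exact h.notMem (h.forest'.mem_blocks _ _ h1).1 h.stem.first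
      · exact h.notMem (h.forest'.mem_roots.1 h1).1 h.stem.first
    · have h3 := h.forest'.mem_roots.1 h1
      refine ⟨.inr h3.1, fun q hq => ?_⟩
      rcases restore_parentOf.1 hq with h4 | h4 | ⟨rfl, h4, h5⟩
      · exact h.notMem h3.1 h4.2.1
      · exact h3.2 _ h4
      · exact h2 h5

theorem componentLabels_eq : (F.restore p b F').componentLabels =
    insert (p.toFinset.biUnion id ∪ (F.hangingLabels p b).biUnion id)
      (F'.componentLabels \ F.hangingLabels p b) := by
  ext L
  simp only [componentLabels, Finset.mem_image, Finset.mem_insert, Finset.mem_sdiff, h.mem_roots]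
  constructor
  · rintro ⟨r, rfl | ⟨h1, h2⟩, rfl⟩
    · exact .inl h.labelsBelow_first
    · rw [h.labelsBelow_of_mem (h.forest'.mem_roots.1 h1).1]
      exact .inr ⟨⟨r, h1, rfl⟩, h2⟩
  · rintro (rfl | ⟨⟨r, h1, rfl⟩, h2⟩)
    · exact ⟨a, .inl rfl, h.labelsBelow_first⟩
    · exact ⟨r, .inr ⟨h1, h2⟩, h.labelsBelow_of_mem (h.forest'.mem_roots.1 h1).1⟩

theorem componentLabels_restore :
    (F.restore p b F').componentLabels = F.componentLabels := by
  -- `F` is itself the restoration of `F.delete p`, and the formula depends on the attached forest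
  -- only through its component labels.
  have h1 := (self h.forest h.stem).componentLabels_eq
  rw [h.stem.restore_delete h.forest] at h1
  rw [h1, h.componentLabels_eq, h.labels]

theorem isMinRoot_restore (h1 : F.IsMinRoot a) : (F.restore p b F').IsMinRoot a := by
  have h2 := (self h.forest h.stem).labelsBelow_first
  rw [h.stem.restore_delete h.forest] at h2
  have hg : (F.restore p b F').ground = F.ground :=
    h.isPartitionForest.union.trans h.forest.union.symm
  rw [IsMinRoot, hg, h.labelsBelow_first, ← h2]
  exact ⟨h.mem_roots.2 (.inl rfl), h1.2⟩

theorem delete_restore : (F.restore p b F').delete p = F' := by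
  ext1
  · ext x
    rw [mem_blocks_delete, mem_blocks_restore]
    have := h.notMem (x := x)
    tauto
  · ext ⟨c, q⟩
    change ((F.restore p b F').delete p).ParentOf c q ↔ F'.ParentOf c q
    rw [delete_parentOf]
    constructor
    · rintro ⟨h1, -, h2⟩
      exact (h.parentOf_of_notMem h2).1 h1
    · intro h1
      have h2 := h.forest'.mem_blocks _ _ h1
      have h3 := h.notMem h2.2
      exact ⟨(h.parentOf_of_notMem h3).2 h1, h.notMem h2.1, h3⟩

theorem parentOf_of_mem {c q : Finset ℕ} (hc : c ∈ p) :
    (F.restore p b F').ParentOf c q ↔ F.ParentOf c q := by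
  rw [restore_parentOf]
  constructor
  · rintro (h1 | h1 | ⟨-, h1, -⟩)
    · exact h1.1
    · exact (h.notMem (h.forest'.mem_blocks _ _ h1).1 hc).elim
    · exact (h.notMem (h.forest'.mem_roots.1 h1).1 hc).elim
  · exact fun h1 => .inl ⟨h1, hc, h.stem.up _ _ h1 hc⟩

theorem isStem_restore : IsStem (F.restore p b F') p a b := by
  refine ⟨fun x hx => mem_blocks_restore.2 (.inl hx), h.mem_roots.2 (.inl rfl), h.stem.first,
    h.stem.last, fun x hx => h.reach_first hx, ?_, ?_, ?_⟩
  · intro c q h1 hc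
    exact h.stem.up c q ((h.parentOf_of_mem hc).1 h1) hc
  · intro c q h1 hq hc
    rcases restore_parentOf.1 h1 with h1 | h1 | h1
    · exact (hc h1.2.1).elim
    · exact (h.notMem (h.forest'.mem_blocks _ _ h1).2 hq).elim
    · exact h1.1
  · intro c h1 hc
    exact h.stem.bottom c ((h.parentOf_of_mem hc).1 h1) hc

/-- The children of `b` are now exactly the roots of `F'` selected by these labels, so a second
restoration attaches at the same places. -/
theorem hangingLabels_restore :
    (F.restore p b F').hangingLabels p b = F.hangingLabels p b := by
  ext L
  rw [hangingLabels, h.delete_restore, Finset.mem_image]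
  have key : ∀ c, c ∈ (F.restore p b F').children b ↔
      c ∈ F'.roots ∧ F'.labelsBelow c ∈ F.hangingLabels p b := by
    intro c
    rw [h.isPartitionForest.mem_children, restore_parentOf]
    constructor
    · rintro (h1 | h1 | h1)
      · exact (h.stem.bottom c h1.1 h1.2.1).elim
      · exact (h.notMem (h.forest'.mem_blocks _ _ h1).2 h.stem.last).elim
      · exact h1.2
    · exact fun h1 => .inr (.inr ⟨rfl, h1⟩)
  simp only [key]
  constructor
  · rintro ⟨c, h1, rfl⟩
    exact h1.2
  · intro hL
    obtain ⟨r, hr, rfl⟩ := h.exists_attached hL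
    exact ⟨r, ⟨hr, hL⟩, rfl⟩

theorem card_children_last :
    ((F.restore p b F').children b).card = (F.children b).card := by
  rw [← h.isStem_restore.card_hangingLabels h.isPartitionForest, h.hangingLabels_restore,
    h.stem.card_hangingLabels h.forest]

theorem children_of_ne {x : Finset ℕ} (hx : x ∈ p) (hxb : x ≠ b) :
    (F.restore p b F').children x = F.children x := by
  ext c
  rw [h.isPartitionForest.mem_children, h.forest.mem_children]
  constructor
  · intro h1
    exact (h.parentOf_of_mem (by_contra fun hc => hxb (h.isStem_restore.down c x h1 hx hc))).1 h1
  · intro h1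
    exact (h.parentOf_of_mem (by_contra fun hc => hxb (h.stem.down c x h1 hx hc))).2 h1

theorem isMinPath_restore (h1 : F.IsMinPath p) (hb : (F.children b).card ≠ 1) :
    (F.restore p b F').IsMinPath p := by
  obtain ⟨a', t, rfl, h2, h3⟩ := h1.exists_cons
  obtain rfl : a = a' := by
    have := h.stem.reach a' (by simp)
    exact (h.forest.eq_of_reach_root h2.1 this).symm
  refine isMinPath_cons.2 ⟨h.isMinRoot_restore h2, (descends_congr fun x hx w => ?_).1 h3⟩
  by_cases hxb : x = b
  · subst hxb
    have h4 := h.card_children_last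
    constructor
    · intro e
      simp [e] at hb
    · intro e
      rw [← h4, e] at hb
      simp at hb
  · rw [h.children_of_ne hx hxb]

/-- The structural half of involutivity in the recursive case: putting the original remainder back
gives `F`. -/
theorem restore_restore : (F.restore p b F').restore p b (F.delete p) = F := by
  rw [restore_congr (G := F) (fun c q hc _ => h.parentOf_of_mem hc) h.hangingLabels_restore,
    h.stem.restore_delete h.forest]

end IsGraft

end BlockForest

/-! ### The recursive map: it is well defined, an involution, and changes parity -/

namespace BlockForest

variable {A : Finset ℕ} {F F' : BlockForest}

theorem IncreasingSingletons.nil : IncreasingSingletons [] := ⟨[], by simp⟩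

/-- By transitivity of `<`, only the comparison with the immediately preceding label has to be
checked; this matches the guards of the steps `split` and `contract`. -/
theorem increasingSingletons_append_singleton {p : List (Finset ℕ)} {v : Finset ℕ} :
    IncreasingSingletons (p ++ [v]) ↔ IncreasingSingletons p ∧ ∃ x, v = {x} ∧
      ∀ u ∈ p.getLast?, ∀ y ∈ u, y < x := by
  constructor
  · rintro ⟨l, hl, e⟩
    obtain ⟨l₁, l₂, rfl, rfl, h2⟩ := List.append_eq_map_iff.1 e
    obtain ⟨x, l₃, rfl, rfl, h4⟩ := List.map_eq_cons_iff.1 h2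
    obtain rfl := List.map_eq_nil_iff.1 h4
    rw [List.pairwise_append] at hl
    refine ⟨⟨l₁, hl.1, rfl⟩, x, rfl, fun u hu y hy => ?_⟩
    obtain ⟨z, hz, rfl⟩ := List.mem_map.1 (List.mem_of_getLast? hu)
    rw [Finset.mem_singleton] at hy
    exact hy ▸ hl.2.2 z hz x (by simp)
  · rintro ⟨⟨l, hl, rfl⟩, x, rfl, h⟩
    refine ⟨l ++ [x], ?_, by simp⟩
    rw [← List.isChain_iff_pairwise] at hl ⊢
    rw [List.isChain_append]
    refine ⟨hl, by simp, fun y hy z hz => ?_⟩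
    obtain rfl : x = z := by simpa using hz
    refine h {y} ?_ y (by simp)
    rw [List.getLast?_map]
    simpa using hy

theorem IncreasingSingletons.left {p q : List (Finset ℕ)} (h : IncreasingSingletons (p ++ q)) :
    IncreasingSingletons p := by
  obtain ⟨l, hl, e⟩ := h
  obtain ⟨l₁, l₂, rfl, rfl, -⟩ := List.append_eq_map_iff.1 e
  exact ⟨l₁, (List.pairwise_append.1 hl).1, rfl⟩

theorem IncreasingSingletons.tail {p : List (Finset ℕ)} {u : Finset ℕ}
    (h : IncreasingSingletons (u :: p)) : IncreasingSingletons p := by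
  obtain ⟨l, hl, e⟩ := h
  obtain ⟨x, l₃, rfl, rfl, h4⟩ := List.map_eq_cons_iff.1 e.symm
  exact ⟨l₃, (List.pairwise_cons.1 hl).2, h4.symm⟩

theorem IncreasingSingletons.head_lt {p : List (Finset ℕ)} {u v : Finset ℕ}
    (h : IncreasingSingletons (u :: p)) (hv : v ∈ p) : ∀ x ∈ u, ∀ y ∈ v, x < y := by
  obtain ⟨l, hl, e⟩ := h
  obtain ⟨x, l₃, rfl, rfl, rfl⟩ := List.map_eq_cons_iff.1 e.symm
  obtain ⟨z, hz, rfl⟩ := List.mem_map.1 hv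
  simpa using (List.pairwise_cons.1 hl).1 z hz

theorem IncreasingSingletons.exists_eq {p : List (Finset ℕ)} {v : Finset ℕ}
    (h : IncreasingSingletons p) (hv : v ∈ p) : ∃ x, v = {x} := by
  obtain ⟨l, hl, rfl⟩ := h
  obtain ⟨z, hz, rfl⟩ := List.mem_map.1 hv
  exact ⟨z, rfl⟩

/-- `v` is the first vertex at which the list `p₁ ++ v :: q` stops to consist of singletons
in increasing order. -/
def IsWitness (p₁ : List (Finset ℕ)) (v : Finset ℕ) : Prop :=
  IncreasingSingletons p₁ ∧ ¬ IncreasingSingletons (p₁ ++ [v])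

theorem exists_isWitness {p : List (Finset ℕ)} (h : ¬ IncreasingSingletons p) :
    ∃ p₁ v q, p = p₁ ++ v :: q ∧ IsWitness p₁ v := by
  induction p using List.reverseRecOn with
  | nil => exact (h .nil).elim
  | append_singleton p v ih =>
    by_cases hp : IncreasingSingletons p
    · exact ⟨p, v, [], rfl, hp, h⟩
    · obtain ⟨p₁, w, q, rfl, hw⟩ := ih hp
      exact ⟨p₁, w, q ++ [v], by simp, hw⟩

theorem IsWitness.not_increasing {p₁ q : List (Finset ℕ)} {v : Finset ℕ} (h : IsWitness p₁ v) :
    ¬ IncreasingSingletons (p₁ ++ v :: q) := fun hi => by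
  refine h.2 (IncreasingSingletons.left (q := q) ?_)
  simpa using hi

/-- Otherwise the shorter prefix together with its witness would be an initial part of the longer
prefix, which is increasing. -/
theorem IsWitness.unique {p₁ p₂ q₁ q₂ : List (Finset ℕ)} {v w : Finset ℕ} (h₁ : IsWitness p₁ v)
    (h₂ : IsWitness p₂ w) (e : p₁ ++ v :: q₁ = p₂ ++ w :: q₂) : p₁ = p₂ ∧ v = w := by
  rcases List.append_eq_append_iff.1 e with ⟨l, rfl, h⟩ | ⟨l, rfl, h⟩
  · cases l with
    | nil => simp_all
    | cons x l =>
      obtain ⟨rfl, -⟩ := List.cons_eq_cons.1 h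
      exact (h₁.not_increasing h₂.1).elim
  · cases l with
    | nil => simp_all
    | cons x l =>
      obtain ⟨rfl, -⟩ := List.cons_eq_cons.1 h
      exact (h₂.not_increasing h₁.1).elim

theorem isWitness_of_two_le {p : List (Finset ℕ)} {v : Finset ℕ} (hp : IncreasingSingletons p)
    (hv : 2 ≤ v.card) : IsWitness p v := by
  refine ⟨hp, fun h => ?_⟩
  obtain ⟨-, x, rfl, -⟩ := increasingSingletons_append_singleton.1 h
  simp at hv

/-- The guard of `contract` thus already forces `v` to be the first failure, so uniqueness of the
witness applies to it. -/
theorem isWitness_of_lt {p : List (Finset ℕ)} {u v : Finset ℕ}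
    (hp : IncreasingSingletons (p ++ [u])) (h : ∀ x ∈ v, ∀ y ∈ u, x < y) :
    IsWitness (p ++ [u]) v := by
  refine ⟨hp, fun hi => ?_⟩
  obtain ⟨-, x, rfl, h1⟩ := increasingSingletons_append_singleton.1 hi
  obtain ⟨-, y, rfl, -⟩ := increasingSingletons_append_singleton.1 hp
  have h2 := h1 {y} (by simp) y (by simp)
  have h3 := h x (by simp) y (by simp)
  omega

/-- The recursion terminates because `h(F)` is non-empty, so deleting it lowers the number of
vertices. The remaining work is to see that the two guards cover every way in which the path can
fail. -/
theorem IsPartitionForest.exists_iota (hF : IsPartitionForest A F) (hA : A.Nonempty) :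
    ∃ F', Iota F F' := by
  induction hn : F.blocks.card using Nat.strong_induction_on generalizing A F with
  | _ n ih =>
    obtain ⟨p, hp⟩ := hF.exists_isMinPath hA
    by_cases hi : IncreasingSingletons p
    · by_cases hd : (F.delete p).blocks = ∅
      · exact ⟨F, .done p hp hi hd⟩
      · have hd' := hF.delete (hF.mem_blocks_of_isMinPath hp)
        obtain ⟨c, hc⟩ := Finset.nonempty_iff_ne_empty.2 hd
        obtain ⟨x, hx⟩ := hd'.nonempty hc
        obtain ⟨b, hb, hb'⟩ := hp.last
        have hlt : (F.delete p).blocks.card < n := by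
          rw [← hn]
          refine Finset.card_lt_card (Finset.filter_ssubset.2 ⟨b, ?_, ?_⟩)
          · exact hF.mem_blocks_of_isMinPath hp b (List.mem_of_getLast? hb)
          · simpa using List.mem_of_getLast? hb
        obtain ⟨F', hF'⟩ := ih _ hlt hd' ⟨x, hd'.subset hc hx⟩ rfl
        exact ⟨_, .recurse p b hp hb hi hd hF'⟩
    · obtain ⟨p₁, v, q, rfl, h1, h2⟩ := exists_isWitness hi
      by_cases h3 : ∀ u ∈ p₁.getLast?, ∃ x ∈ v, ∀ y ∈ u, y < x
      · by_cases h4 : 2 ≤ v.card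
        · exact ⟨_, .split p₁ v q hp h1 h4 h3⟩
        -- A singleton that passes the comparison with its parent would extend the increasing
        -- prefix, so it is not a witness.
        · have hv : v.Nonempty := hF.nonempty (hF.mem_blocks_of_isMinPath hp v (by simp))
          have h5 := Finset.card_pos.2 hv
          obtain ⟨x, rfl⟩ := Finset.card_eq_one.1 (by omega : v.card = 1)
          refine (h2 (increasingSingletons_append_singleton.2 ⟨h1, x, rfl, fun u hu y hy => ?_⟩)).elim
          obtain ⟨z, hz, hz'⟩ := h3 u hu
          rw [Finset.mem_singleton] at hz
          exact hz ▸ hz' y hy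
      · push Not at h3
        obtain ⟨u, hu, h3⟩ := h3
        obtain ⟨p', rfl⟩ := List.getLast?_eq_some_iff.1 hu
        obtain ⟨-, y, rfl, -⟩ := increasingSingletons_append_singleton.1 h1
        have hp' : F.IsMinPath (p' ++ {y} :: v :: q) := by simpa using hp
        refine ⟨_, .contract p' {y} v q hp' h1 fun x hx z hz => ?_⟩
        rw [Finset.mem_singleton] at hz
        subst hz
        obtain ⟨w, hw, hxw⟩ := h3 x hx
        obtain rfl := Finset.mem_singleton.1 hw
        -- Negating the first guard gives only `≤`. Equality would put a common element into two
        -- distinct vertices of the path.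
        refine lt_of_le_of_ne hxw fun e => ?_
        subst e
        have hm := hF.mem_blocks_of_isMinPath hp'
        have h4 := hF.eq_of_mem (hm {x} (by simp)) (hm v (by simp)) (by simp) hx
        have h5 := hF.nodup_of_isMinPath hp'
        subst h4
        simp [List.nodup_append] at h5

/-- The path and its witness are determined by the forest, and the guards exclude each other: one
asks for an element of `v` above the label of the parent, the other puts all elements below it. -/
theorem Iota.unique {F₁ F₂ : BlockForest} (h₁ : Iota F F₁) (hF : IsPartitionForest A F)
    (h₂ : Iota F F₂) : F₁ = F₂ := by
  induction h₁ generalizing A F₂ with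
  | split p v q hp hi hv hl =>
    have hw := isWitness_of_two_le hi hv
    cases h₂ with
    | split p' v' q' hp' hi' hv' hl' =>
      obtain ⟨-, rfl⟩ := hw.unique (isWitness_of_two_le hi' hv') (hF.isMinPath_unique hp hp')
      rfl
    | contract p' u' v' q' hp' hi' h' =>
      obtain ⟨rfl, rfl⟩ := hw.unique (isWitness_of_lt hi' h')
        (by simpa using hF.isMinPath_unique hp hp')
      obtain ⟨x, hx, hl⟩ := hl u' (by simp)
      obtain ⟨-, y, rfl, -⟩ := increasingSingletons_append_singleton.1 hi
      have h1 := hl y (by simp)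
      have h2 := h' x hx y (by simp)
      omega
    | done p' hp' hi' hd' =>
      obtain rfl := hF.isMinPath_unique hp hp'
      exact (hw.not_increasing hi').elim
    | recurse p' b' hp' hb' hi' hd' h' =>
      obtain rfl := hF.isMinPath_unique hp hp'
      exact (hw.not_increasing hi').elim
  | contract p u v q hp hi h =>
    have hw := isWitness_of_lt hi h
    cases h₂ with
    | split p' v' q' hp' hi' hv' hl' =>
      obtain ⟨rfl, rfl⟩ := hw.unique (isWitness_of_two_le hi' hv')
        (by simpa using hF.isMinPath_unique hp hp')
      obtain ⟨x, hx, hl⟩ := hl' u (by simp)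
      obtain ⟨-, y, rfl, -⟩ := increasingSingletons_append_singleton.1 hi
      have h1 := hl y (by simp)
      have h2 := h x hx y (by simp)
      omega
    | contract p' u' v' q' hp' hi' h' =>
      obtain ⟨e, rfl⟩ := hw.unique (isWitness_of_lt hi' h')
        (by simpa using hF.isMinPath_unique hp hp')
      obtain ⟨-, rfl⟩ : p = p' ∧ u = u' := by simpa using e
      rfl
    | done p' hp' hi' hd' =>
      obtain rfl := hF.isMinPath_unique hp hp'
      exact (hw.not_increasing (q := q) (by simpa using hi')).elim
    | recurse p' b' hp' hb' hi' hd' h' =>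
      obtain rfl := hF.isMinPath_unique hp hp'
      exact (hw.not_increasing (q := q) (by simpa using hi')).elim
  | done p hp hi hd =>
    cases h₂ with
    | split p' v' q' hp' hi' hv' hl' =>
      obtain rfl := hF.isMinPath_unique hp hp'
      exact ((isWitness_of_two_le hi' hv').not_increasing hi).elim
    | contract p' u' v' q' hp' hi' h' =>
      obtain rfl := hF.isMinPath_unique hp hp'
      exact ((isWitness_of_lt hi' h').not_increasing (q := q') (by simpa using hi)).elim
    | done => rfl
    | recurse p' b' hp' hb' hi' hd' h' =>
      obtain rfl := hF.isMinPath_unique hp hp'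
      exact (hd' hd).elim
  | recurse p b hp hb hi hd h ih =>
    cases h₂ with
    | split p' v' q' hp' hi' hv' hl' =>
      obtain rfl := hF.isMinPath_unique hp hp'
      exact ((isWitness_of_two_le hi' hv').not_increasing hi).elim
    | contract p' u' v' q' hp' hi' h' =>
      obtain rfl := hF.isMinPath_unique hp hp'
      exact ((isWitness_of_lt hi' h').not_increasing (q := q') (by simpa using hi)).elim
    | done p' hp' hi' hd' =>
      obtain rfl := hF.isMinPath_unique hp hp'
      exact (hd hd').elim
    | recurse p' b' hp' hb' hi' hd' h' =>
      obtain rfl := hF.isMinPath_unique hp hp'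
      obtain rfl : b = b' := Option.mem_unique hb hb'
      rw [ih (hF.delete (hF.mem_blocks_of_isMinPath hp)) h']

theorem sup_id_mem {v : Finset ℕ} (hv : v.Nonempty) : v.sup id ∈ v := by
  obtain ⟨x, hx, e⟩ := Finset.exists_mem_eq_sup v hv id
  exact e ▸ hx

theorem isSplitting_max {v : Finset ℕ} (hv : v ∈ F.blocks) (h2 : 2 ≤ v.card) :
    IsSplitting F v {v.sup id} (v.erase (v.sup id)) := by
  have hm : v.sup id ∈ v := sup_id_mem (Finset.card_pos.1 (by omega))
  refine ⟨hv, ?_, by simp, by simp, ?_⟩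
  · rw [← Finset.insert_eq, Finset.insert_erase hm]
  · rw [← Finset.card_pos, Finset.card_erase_of_mem hm]
    omega

theorem IsPartitionForest.isStem_of_isMinPath (hF : IsPartitionForest A F)
    {p : List (Finset ℕ)} {b : Finset ℕ} (hp : F.IsMinPath p) (hb : b ∈ p.getLast?) :
    (∃ a, IsStem F p a b) ∧ (F.children b).card ≠ 1 := by
  obtain ⟨b', hb', hc⟩ := hp.last
  obtain rfl : b = b' := Option.mem_unique hb hb'
  obtain ⟨a, t, rfl, h2, h3⟩ := hp.exists_cons
  exact ⟨⟨a, hF.isStem h2.1 h3 hb⟩, hc⟩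

theorem IsMinPath.children_eq {p q : List (Finset ℕ)} {u v : Finset ℕ} (hp : F.IsMinPath (p ++ u :: v :: q)) :
    F.children u = {v} :=
  (List.isChain_append_cons_cons.1 hp.chain).2.1

theorem IsGraft.card_blocks {p : List (Finset ℕ)} {a b : Finset ℕ} (h : IsGraft A F p a b F') :
    (F.restore p b F').blocks.card = p.toFinset.card + F'.blocks.card := by
  refine Finset.card_union_of_disjoint (Finset.disjoint_left.2 fun x hx hx' => ?_)
  exact h.notMem hx' (List.mem_toFinset.1 hx)

/-- The properties of the image of a forest under `Iota`. -/
structure IotaSpec (A : Finset ℕ) (F F' : BlockForest) : Prop where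
  forest : IsPartitionForest A F'
  symm : Iota F' F
  labels : F'.componentLabels = F.componentLabels
  parity : F' = F ∨ Odd (F.blocks.card + F'.blocks.card)

/-- After a splitting, `{max v}` continues the increasing prefix and its child is smaller, which is
the guard for contraction; after a contraction, the maximum of the merged vertex is the old parent
label, so splitting it restores the edge. In the recursive case the invariance of the component
labels makes the graft legitimate, and the restored forest has the same path. -/
theorem Iota.spec (h : Iota F F') (hF : IsPartitionForest A F) : IotaSpec A F F' := by
  induction h generalizing A with
  | split p v q hp hi hv hl =>
    rename_i F
    have hm := hF.mem_blocks_of_isMinPath hp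
    have hs := isSplitting_max (hm v (by simp)) hv
    have hnd := hF.nodup_of_isMinPath hp
    rw [List.nodup_middle, List.nodup_cons, List.mem_append, not_or] at hnd
    rw [split_eq_splitAt]
    refine ⟨hs.isPartitionForest hF, ?_, hs.componentLabels_splitAt hF, .inr ?_⟩
    · have h1 := Iota.contract p _ _ q ((hs.isMinPath_splitAt hF hm hnd.1.1 hnd.1.2).2 hp) ?_ ?_
      · rwa [hs.contract_splitAt hF] at h1
      · refine increasingSingletons_append_singleton.2 ⟨hi, _, rfl, fun u hu y hy => ?_⟩
        obtain ⟨x, hx, hxu⟩ := hl u hu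
        exact (hxu y hy).trans_le (Finset.le_sup (f := id) hx)
      · intro x hx y hy
        rw [Finset.mem_singleton] at hy
        rw [Finset.mem_erase] at hx
        exact hy ▸ lt_of_le_of_ne (Finset.le_sup (f := id) hx.2) hx.1
    · rw [hs.card_blocks hF]
      exact ⟨F.blocks.card, by ring⟩
  | contract p u v q hp hi hlt =>
    rename_i F
    have hch := hp.children_eq
    have hF' := hF.contract hch
    have hs := hF.isSplitting_contract hch
    have he := hF.splitAt_contract hch
    have hm := hF.mem_blocks_of_isMinPath hp
    have hnd := hF.nodup_of_isMinPath hp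
    have hvu := hF.mem_of_children_eq hch
    obtain ⟨hv, hu⟩ := hF.mem_blocks _ _ hvu
    have hw := hF.union_notMem hu hv (hF.parent_ne hvu).symm
    have hnd1 : u ∉ p ∧ u ∉ q ∧ v ∉ p ∧ v ∉ q := by
      rw [List.nodup_append] at hnd
      simp only [List.nodup_cons, List.mem_cons, not_or] at hnd
      exact ⟨fun h => hnd.2.2 u h u (by simp) rfl, hnd.2.1.1.2,
        fun h => hnd.2.2 v h v (by simp) rfl, hnd.2.1.2.1⟩
    have hwp : u ∪ v ∉ p := fun h => hw (hm _ (by simp [h]))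
    have hwq : u ∪ v ∉ q := fun h => hw (hm _ (by simp [h]))
    have hm' : ∀ x ∈ p ++ (u ∪ v) :: q, x ∈ (F.contract u v).blocks := by
      intro x hx
      simp only [BlockForest.contract, Finset.mem_insert, Finset.mem_erase]
      have := hm x
      simp only [List.mem_append, List.mem_cons] at this hx
      grind
    obtain ⟨hip, m, rfl, hl⟩ := increasingSingletons_append_singleton.1 hi
    -- The guard puts `v` below `m`, so splitting off the maximum separates precisely the two merged
    -- vertices.
    have hsup : ({m} ∪ v).sup id = m := by
      rw [Finset.sup_union, Finset.sup_singleton, id, sup_eq_left]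
      exact Finset.sup_le fun x hx => (hlt x hx m (by simp)).le
    have herase : ({m} ∪ v).erase m = v := by
      rw [← Finset.insert_eq]
      exact Finset.erase_insert fun h => lt_irrefl _ (hlt m h m (by simp))
    have hsplit : (F.contract {m} v).split ({m} ∪ v) = F := by
      rw [split_eq_splitAt, hsup, herase, he]
    refine ⟨hF', ?_, ?_, .inr ?_⟩
    · have h1 := Iota.split (F := F.contract {m} v) p ({m} ∪ v) q
        ((hs.isMinPath_splitAt hF' hm' hwp hwq).1 (by rwa [he])) hip ?_ ?_
      · rwa [hsplit] at h1
      · have h3 := Finset.card_pos.2 (hF.nonempty hv)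
        rw [Finset.card_union_of_disjoint hs.disjoint, Finset.card_singleton]
        omega
      · exact fun u hu => ⟨m, by simp, hl u hu⟩
    · have := hs.componentLabels_splitAt hF'
      rw [he] at this
      exact this.symm
    · have := hs.card_blocks hF'
      rw [he] at this
      rw [this]
      exact ⟨(F.contract {m} v).blocks.card, by ring⟩
  | done p hp hi hd => exact ⟨hF, .done p hp hi hd, rfl, .inl rfl⟩
  | recurse p b hp hb hi hd h ih =>
    rename_i F F'
    have hm := hF.mem_blocks_of_isMinPath hp
    obtain ⟨⟨a, hst⟩, hc⟩ := hF.isStem_of_isMinPath hp hb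
    have h1 := ih (hF.delete hm)
    have hg : IsGraft A F p a b F' := ⟨hF, hst, h1.forest, h1.labels⟩
    refine ⟨hg.isPartitionForest, ?_, hg.componentLabels_restore, ?_⟩
    · have h2 : Iota (F.restore p b F') ((F.restore p b F').restore p b (F.delete p)) := by
        refine .recurse p b (hg.isMinPath_restore hp hc) hb hi ?_ ?_
        · rw [hg.delete_restore]
          -- The result of the recursion covers the same labels as `F.delete p`, so it cannot be
          -- empty.
          intro e
          have h3 := h1.forest.union
          rw [e, Finset.biUnion_empty, ← (hF.delete hm).union] at h3
          obtain ⟨c, hc⟩ := Finset.nonempty_iff_ne_empty.2 hd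
          obtain ⟨x, hx⟩ := (hF.delete hm).nonempty hc
          have : x ∈ (F.delete p).blocks.biUnion id := Finset.mem_biUnion.2 ⟨c, hc, hx⟩
          simp [← h3] at this
        · rw [hg.delete_restore]
          exact h1.symm
      rwa [hg.restore_restore] at h2
    · rcases h1.parity with h2 | h2
      · left
        rw [h2, hst.restore_delete hF]
      · right
        have h3 := (IsGraft.self hF hst).card_blocks
        rw [hst.restore_delete hF] at h3
        rw [hg.card_blocks, h3]
        -- The stem occurs in both forests, so it contributes an even number and the parity comes
        -- from the recursion.
        have : p.toFinset.card + (F.delete p).blocks.card + (p.toFinset.card + F'.blocks.card) =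
          2 * p.toFinset.card + ((F.delete p).blocks.card + F'.blocks.card) := by ring
        rw [this]
        exact (even_two_mul _).add_odd h2

/-! ### Fixed points as increasing forests -/

/-- All vertices are singletons, and the label of a vertex that has exactly one child is
smaller than the label of this child. -/
def IsIncreasing (F : BlockForest) : Prop :=
  (∀ v ∈ F.blocks, v.card = 1) ∧
    ∀ x y : ℕ, F.ParentOf {y} {x} → (∀ c, F.ParentOf c {x} → c = {y}) → x < y

theorem IsPartitionForest.lt_of_descends (hF : IsPartitionForest A F) {u : Finset ℕ}
    {p : List (Finset ℕ)} (h : F.Descends (u :: p)) (hi : IncreasingSingletons (u :: p))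
    {c q : Finset ℕ} (hc : c ∈ u :: p) (hq : q ∈ u :: p) (hcq : F.ParentOf c q) :
    ∀ x ∈ q, ∀ y ∈ c, x < y := by
  induction p generalizing u with
  | nil =>
    rw [List.mem_singleton] at hc hq
    exact (hF.parent_ne hcq (hc.trans hq.symm)).elim
  | cons w p ih =>
    rcases List.mem_cons.1 hc with rfl | hc'
    · rcases List.mem_cons.1 hq with rfl | hq
      · exact (hF.parent_ne hcq rfl).elim
      · exact (hF.acyclic q ((hF.reach_of_descends h q hq).tail hcq)).elim
    · rcases List.mem_cons.1 hq with rfl | hq'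
      · exact hi.head_lt hc'
      · exact ih (descends_cons_cons.1 h).2 hi.tail hc' hq'

/-- Along the path the condition is that the labels increase; at its last vertex it is vacuous,
because that vertex does not have exactly one child; elsewhere the children are the same in both
forests. -/
theorem IsPartitionForest.isIncreasing_iff_delete (hF : IsPartitionForest A F)
    {p : List (Finset ℕ)} (hp : F.IsMinPath p) (hi : IncreasingSingletons p) :
    F.IsIncreasing ↔ (F.delete p).IsIncreasing := by
  obtain ⟨b, hb, hbc⟩ := hp.last
  obtain ⟨⟨a, hst⟩, -⟩ := hF.isStem_of_isMinPath hp hb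
  have key : ∀ {x y : Finset ℕ}, x ∉ p → F.ParentOf y x → (F.delete p).ParentOf y x :=
    fun hx hy => delete_parentOf.2 ⟨hy, fun hyp => hx (hst.up _ _ hy hyp), hx⟩
  constructor
  · rintro ⟨h1, h2⟩
    refine ⟨fun v hv => h1 v (mem_blocks_delete.1 hv).1, fun x y hxy h3 => ?_⟩
    have h4 := delete_parentOf.1 hxy
    exact h2 x y h4.1 fun c hc => h3 c (key h4.2.2 hc)
  · rintro ⟨h1, h2⟩
    refine ⟨fun v hv => ?_, fun x y hxy h3 => ?_⟩
    · by_cases hvp : v ∈ p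
      · obtain ⟨x, rfl⟩ := hi.exists_eq hvp
        simp
      · exact h1 v (mem_blocks_delete.2 ⟨hv, hvp⟩)
    · by_cases hx : ({x} : Finset ℕ) ∈ p
      · by_cases hy : ({y} : Finset ℕ) ∈ p
        · obtain ⟨a', t, rfl, -, h5⟩ := hp.exists_cons
          exact hF.lt_of_descends h5 hi hy hx hxy x (by simp) y (by simp)
        · obtain rfl := hst.down _ _ hxy hx hy
          refine (hbc (Finset.card_eq_one.2 ⟨{y}, ?_⟩)).elim
          ext c
          rw [hF.mem_children, Finset.mem_singleton]
          exact ⟨h3 c, fun e => e ▸ hxy⟩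
      · exact h2 x y (key hx hxy) fun c hc => h3 c (delete_parentOf.1 hc).1

theorem isIncreasing_of_blocks_eq_empty (hF : IsPartitionForest A F) (h : F.blocks = ∅) :
    F.IsIncreasing := by
  refine ⟨by simp [h], fun x y hxy => ?_⟩
  have := (hF.mem_blocks _ _ hxy).1
  simp [h] at this

/-- Splitting and contracting change the number of vertices, and their guards contradict being
increasing. The recursive case passes to the remainder, which can be recovered by deleting the path
again. -/
theorem Iota.eq_iff (h : Iota F F') (hF : IsPartitionForest A F) : F' = F ↔ F.IsIncreasing := by
  induction h generalizing A with
  | split p v q hp hi hv hl =>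
    have hm := hF.mem_blocks_of_isMinPath hp v (by simp)
    have hs := isSplitting_max hm hv
    constructor
    · intro e
      have := hs.card_blocks hF
      rw [← split_eq_splitAt, e] at this
      omega
    · intro h1
      have := h1.1 v hm
      omega
  | contract p u v q hp hi hlt =>
    have hch := hp.children_eq
    constructor
    · intro e
      have := (hF.isSplitting_contract hch).card_blocks (hF.contract hch)
      rw [hF.splitAt_contract hch, e] at this
      omega
    · intro h1
      have hm := hF.mem_blocks_of_isMinPath hp
      obtain ⟨x, rfl⟩ := Finset.card_eq_one.1 (h1.1 u (hm u (by simp)))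
      obtain ⟨y, rfl⟩ := Finset.card_eq_one.1 (h1.1 v (hm v (by simp)))
      have h2 := h1.2 x y (hF.mem_of_children_eq hch) fun c hc => by
        simpa [hch] using hF.mem_children.2 hc
      have := hlt y (by simp) x (by simp)
      omega
  | done p hp hi hd =>
    rw [hF.isIncreasing_iff_delete hp hi]
    exact iff_of_true rfl
      (isIncreasing_of_blocks_eq_empty (hF.delete (hF.mem_blocks_of_isMinPath hp)) hd)
  | recurse p b hp hb hi hd h ih =>
    rename_i F F'
    have hm := hF.mem_blocks_of_isMinPath hp
    obtain ⟨⟨a, hst⟩, hc⟩ := hF.isStem_of_isMinPath hp hb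
    have h1 := h.spec (hF.delete hm)
    have hg : IsGraft A F p a b F' := ⟨hF, hst, h1.forest, h1.labels⟩
    rw [hF.isIncreasing_iff_delete hp hi, ← ih (hF.delete hm)]
    constructor
    · intro e
      rw [← hg.delete_restore, e]
    · intro e
      rw [e, hst.restore_delete hF]

end BlockForest

/-! ### Quasi-threshold graphs and dominating vertices of connected sets -/

/-- `G.ConnectedOn C`: the set `C` is non-empty, and no proper non-empty subset of it is closed under
adjacency in `C`. -/
def SimpleGraph.ConnectedOn {V : Type*} (G : SimpleGraph V) (C : Set V) : Prop :=
  C.Nonempty ∧ ∀ T ⊆ C, T.Nonempty → (∀ x ∈ T, ∀ y ∈ C, G.Adj x y → y ∈ T) → T = C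

/-- Every connected set of vertices contains a vertex that is adjacent to all others. -/
def SimpleGraph.HasDominators {V : Type*} (G : SimpleGraph V) : Prop :=
  ∀ C : Set V, G.ConnectedOn C → ∃ x ∈ C, ∀ y ∈ C, y ≠ x → G.Adj x y

namespace SimpleGraph

variable {V W : Type*} {G : SimpleGraph V} {H : SimpleGraph W}

theorem induce_connected_iff {C : Set V} : (G.induce C).Connected ↔ G.ConnectedOn C := by
  constructor
  · intro h
    obtain ⟨v⟩ := h.nonempty
    refine ⟨⟨v.1, v.2⟩, fun T hT ⟨x, hx⟩ hcl => hT.antisymm fun y hy => ?_⟩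
    have h1 := (reachable_iff_reflTransGen _ _).1 (h.preconnected ⟨x, hT hx⟩ ⟨y, hy⟩)
    have key : ∀ z : C, ReflTransGen (G.induce C).Adj ⟨x, hT hx⟩ z → z.1 ∈ T := by
      intro z hz
      induction hz with
      | refl => exact hx
      | tail _ h2 ih => exact hcl _ ih _ (Subtype.prop _) h2
    exact key _ h1
  · rintro ⟨⟨v, hv⟩, h⟩
    have : Nonempty C := ⟨⟨v, hv⟩⟩
    refine ⟨fun x y => ?_⟩
    -- The set of vertices reachable from `x` inside `C` is closed under adjacency, hence all of
    -- `C`.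
    have h1 := h {z | ∃ hz : z ∈ C, (G.induce C).Reachable x ⟨z, hz⟩} (fun z hz => hz.1)
      ⟨x, x.2, .refl _⟩ ?_
    · obtain ⟨_, h2⟩ := h1.ge y.2
      exact h2
    · rintro z ⟨hz, hxz⟩ w hw hzw
      refine ⟨hw, hxz.trans (Adj.reachable ?_)⟩
      exact hzw

theorem ConnectedOn.of_image (f : G ↪g H) {C : Set V} (h : H.ConnectedOn (f '' C)) :
    G.ConnectedOn C := by
  refine ⟨Set.image_nonempty.1 h.1, fun T hT hne hcl => ?_⟩
  refine f.injective.image_injective (h.2 _ (Set.image_mono hT) (hne.image f) ?_)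
  rintro _ ⟨x, hx, rfl⟩ _ ⟨y, hy, rfl⟩ hxy
  exact ⟨y, hcl x hx y hy (f.map_rel_iff.1 hxy), rfl⟩

theorem HasDominators.exists_of_image (f : G ↪g H) (hG : G.HasDominators) {C : Set V}
    (h : H.ConnectedOn (f '' C)) : ∃ x ∈ f '' C, ∀ y ∈ f '' C, y ≠ x → H.Adj x y := by
  obtain ⟨x, hx, hx'⟩ := hG C (h.of_image f)
  refine ⟨f x, ⟨x, hx, rfl⟩, ?_⟩
  rintro _ ⟨y, hy, rfl⟩ hyx
  exact f.map_rel_iff.2 (hx' y hy fun e => hyx (e ▸ rfl))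

theorem ConnectedOn.image (f : G ↪g H) {C : Set V} (h : G.ConnectedOn C) :
    H.ConnectedOn (f '' C) := by
  refine ⟨h.1.image f, fun T hT hne hcl => ?_⟩
  have h1 : T = f '' (f ⁻¹' T) := by
    rw [Set.image_preimage_eq_inter_range, Set.inter_eq_left.2]
    exact hT.trans (Set.image_subset_range _ _)
  have h2 : f ⁻¹' T ⊆ C := fun x hx => by
    obtain ⟨y, hy, e⟩ := hT hx
    exact f.injective e ▸ hy
  rw [h1, h.2 _ h2 (Set.image_nonempty.1 (h1 ▸ hne)) fun x hx y hy hxy =>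
    hcl _ hx _ ⟨y, hy, rfl⟩ (f.map_rel_iff.2 hxy)]

/-- The property passes to induced subgraphs, which supports the induction on the number of
vertices. -/
theorem HasDominators.of_embedding (f : G ↪g H) (hH : H.HasDominators) : G.HasDominators := by
  intro C hC
  obtain ⟨_, ⟨x, hx, rfl⟩, h⟩ := hH _ (hC.image f)
  exact ⟨x, hx, fun y hy hyx => f.map_rel_iff.1 (h _ ⟨y, hy, rfl⟩ (f.injective.ne hyx))⟩

/-- Vertices outside `A` become isolated, so a connected set that contains one is a singleton; all
other connected sets come from `G`. -/
theorem hasDominators_map {A : Finset ℕ} {G : SimpleGraph A} (hG : G.HasDominators) :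
    (G.map (Function.Embedding.subtype fun x => x ∈ A)).HasDominators := by
  intro C hC
  by_cases h : ∃ x ∈ C, x ∉ A
  · obtain ⟨x, hx, hxA⟩ := h
    have : {x} = C := hC.2 {x} (by simpa using hx) (by simp) fun y hy z hz hyz => by
      obtain ⟨-, u, v, -, h1, -⟩ := hyz
      have h2 := u.2
      rw [Set.mem_singleton_iff] at hy
      subst hy
      rw [← h1] at hxA
      exact (hxA h2).elim
    refine ⟨x, hx, fun y hy hyx => ?_⟩
    rw [← this] at hy
    exact (hyx hy).elim
  · push Not at h
    have e : C = SimpleGraph.Embedding.map (Function.Embedding.subtype fun x => x ∈ A) G ''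
        (Subtype.val ⁻¹' C) := by
      ext x
      constructor
      · exact fun hx => ⟨⟨x, h x hx⟩, hx, rfl⟩
      · rintro ⟨y, hy, rfl⟩
        exact hy
    rw [e] at hC ⊢
    exact hG.exists_of_image _ hC

end SimpleGraph

open SimpleGraph

/-- A connected set either contains the added vertex, which dominates it, or lies in the old graph;
in a disjoint union it lies in one of the two parts. -/
theorem IsQuasiThreshold.hasDominators {V : Type} {G : SimpleGraph V} (h : IsQuasiThreshold G) :
    G.HasDominators := by
  induction h with
  | single => exact fun C hC => ⟨(), hC.1.some_mem, fun y _ hy => (hy rfl).elim⟩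
  | @dominating V G _ ih =>
    intro C hC
    by_cases h : none ∈ C
    · refine ⟨none, h, fun y _ hy => ?_⟩
      cases y with
      | none => exact (hy rfl).elim
      | some y => trivial
    · let f : G ↪g addDominating G := ⟨⟨some, Option.some_injective _⟩, Iff.rfl⟩
      have e : C = f '' (some ⁻¹' C) := by
        ext x
        constructor
        · intro hx
          cases x with
          | none => exact (h hx).elim
          | some x => exact ⟨x, hx, rfl⟩
        · rintro ⟨y, hy, rfl⟩
          exact hy
      rw [e] at hC ⊢
      exact ih.exists_of_image f hC
  | @disjointUnion V W G H _ _ ihG ihH =>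
    intro C hC
    let f : G ↪g G.sum H := ⟨⟨Sum.inl, Sum.inl_injective⟩, Iff.rfl⟩
    let g : H ↪g G.sum H := ⟨⟨Sum.inr, Sum.inr_injective⟩, Iff.rfl⟩
    obtain ⟨x | x, hx⟩ := hC.1
    · have e : f '' (Sum.inl ⁻¹' C) = C := by
        refine hC.2 _ ?_ ⟨_, x, hx, rfl⟩ ?_
        · rintro _ ⟨y, hy, rfl⟩
          exact hy
        · rintro _ ⟨y, hy, rfl⟩ (z | z) hz hyz
          · exact ⟨z, hz, rfl⟩
          · exact absurd hyz Bool.false_ne_true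
      rw [← e] at hC ⊢
      exact ihG.exists_of_image f hC
    · have e : g '' (Sum.inr ⁻¹' C) = C := by
        refine hC.2 _ ?_ ⟨_, x, hx, rfl⟩ ?_
        · rintro _ ⟨y, hy, rfl⟩
          exact hy
        · rintro _ ⟨y, hy, rfl⟩ (z | z) hz hyz
          · exact absurd hyz Bool.false_ne_true
          · exact ⟨z, hz, rfl⟩
      rw [← e] at hC ⊢
      exact ihH.exists_of_image g hC
  | iso h _ ih =>
    obtain ⟨f⟩ := h
    exact ih.of_embedding f.symm.toEmbedding

/-- If the whole graph is connected, remove a dominating vertex; otherwise a proper closed set of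
vertices and its complement form a disjoint union. Non-emptiness is needed because the inductive
family starts with one vertex. -/
theorem isQuasiThreshold_of_hasDominators {V : Type} [Finite V] [Nonempty V] {G : SimpleGraph V}
    (hG : G.HasDominators) : IsQuasiThreshold G := by
  induction hn : Nat.card V using Nat.strong_induction_on generalizing V with
  | _ n ih =>
    have hsub : ∀ S : Set V, S.Nonempty → S ≠ Set.univ → IsQuasiThreshold (G.induce S) := by
      intro S hS hne
      have : Nonempty S := hS.to_subtype
      refine ih _ ?_ (hG.of_embedding (SimpleGraph.Embedding.induce S)) rfl
      rw [← hn, Nat.card_coe_set_eq, ← Set.ncard_univ]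
      exact Set.ncard_lt_ncard (Set.ssubset_univ_iff.2 hne)
    by_cases hc : G.ConnectedOn Set.univ
    · obtain ⟨x, -, hx⟩ := hG _ hc
      by_cases hy : ∃ y, y ≠ x
      · obtain ⟨y, hy⟩ := hy
        have h1 := hsub {y | y ≠ x} ⟨y, hy⟩ fun e => (e.ge (Set.mem_univ x) : x ≠ x) rfl
        classical
        refine .iso ⟨⟨Equiv.optionSubtypeNe x, ?_⟩⟩ (.dominating h1)
        rintro (_ | ⟨u, hu⟩) (_ | ⟨w, hw⟩)
        · simp [addDominating]
        · simpa [addDominating] using hx w trivial hw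
        · simpa [addDominating] using (hx u trivial hu).symm
        · simp [addDominating]
      · push Not at hy
        refine .iso ⟨⟨⟨fun _ => x, fun _ => (), fun _ => rfl, fun y => (hy y).symm⟩, ?_⟩⟩ .single
        simp
    · have h0 : (Set.univ : Set V).Nonempty := Set.univ_nonempty
      obtain ⟨T, hT⟩ := not_forall.1 fun h => hc ⟨h0, h⟩
      push Not at hT
      obtain ⟨-, hne, hcl, hT⟩ := hT
      have h1 := hsub T hne hT
      have h2 := hsub Tᶜ (Set.nonempty_compl.2 hT) fun e => by
        rw [Set.compl_univ_iff] at e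
        exact hne.ne_empty e
      classical
      refine .iso ⟨⟨Equiv.Set.sumCompl T, ?_⟩⟩ (.disjointUnion h1 h2)
      rintro (⟨u, hu⟩ | ⟨u, hu⟩) (⟨w, hw⟩ | ⟨w, hw⟩)
      · simp
      · simpa using fun h => hw (hcl u hu w trivial h)
      · simpa using fun h : G.Adj u w => hu (hcl w hw u trivial h.symm)
      · simp

/-! ### Components and dominating vertices of induced subgraphs -/

namespace BlockForest

variable {G : SimpleGraph ℕ} {S K : Finset ℕ}

theorem mem_components : K ∈ components G S ↔ K ⊆ S ∧ G.ConnectedOn (K : Set ℕ) ∧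
    ∀ x ∈ K, ∀ y ∈ S, y ∉ K → ¬ G.Adj x y := by
  simp only [components, Finset.mem_filter, Finset.mem_powerset]
  exact and_congr_right fun _ => and_congr_left fun _ => induce_connected_iff

/-- Inside `K` the intersection of two components is closed under adjacency, so if it is non-empty
it is all of `K`. -/
theorem components_eq_of_mem {K' : Finset ℕ} (hK : K ∈ components G S)
    (hK' : K' ∈ components G S) {x : ℕ} (hx : x ∈ K) (hx' : x ∈ K') : K = K' := by
  have key : ∀ {K K' : Finset ℕ}, K ∈ components G S → K' ∈ components G S → x ∈ K → x ∈ K' →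
      K ⊆ K' := by
    intro K K' hK hK' hx hx'
    rw [mem_components] at hK hK'
    have := hK.2.1.2 (K ∩ K' : Set ℕ) Set.inter_subset_left ⟨x, hx, hx'⟩ ?_
    · exact fun y hy => (this.ge hy).2
    · rintro y ⟨-, hy⟩ z hz hyz
      refine ⟨hz, by_contra fun hz' => hK'.2.2 y hy z (hK.1 hz) hz' hyz⟩
  exact (key hK hK' hx hx').antisymm (key hK' hK hx' hx)

theorem exists_component {x : ℕ} (hx : x ∈ S) : ∃ K ∈ components G S, x ∈ K := by
  classical
  let R : ℕ → ℕ → Prop := fun y z => z ∈ S ∧ G.Adj y z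
  have hR : ∀ {y}, ReflTransGen R x y → y ∈ S := fun h => by
    rcases ReflTransGen.cases_tail h with rfl | ⟨_, -, h⟩
    · exact hx
    · exact h.1
  refine ⟨S.filter fun y => ReflTransGen R x y, mem_components.2 ⟨Finset.filter_subset _ _,
    ⟨⟨x, by simp [hx, ReflTransGen.refl]⟩, fun T hT ⟨y, hy⟩ hcl => hT.antisymm ?_⟩, ?_⟩,
    by simp [hx, ReflTransGen.refl]⟩
  -- Closure of `T` only propagates forwards, so the walk from `x` to an element of `T` is first
  -- traversed backwards to bring `x` into `T`.
  · have hsymm : ∀ {z}, ReflTransGen R x z → z ∈ T → x ∈ T := by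
      intro z hz
      induction hz with
      | refl => exact id
      | tail h1 h2 ih =>
        refine fun hz => ih (hcl _ hz _ ?_ h2.2.symm)
        simp [hR h1, h1]
    have hxT : x ∈ T := hsymm (by simpa using (Finset.mem_filter.1 (hT hy)).2) hy
    intro z hz
    have hz' : ReflTransGen R x z := (Finset.mem_filter.1 hz).2
    clear hz
    induction hz' with
    | refl => exact hxT
    | tail h1 h2 ih =>
      refine hcl _ ih _ ?_ h2.2
      simp [h2.1, h1.tail h2]
  · intro y hy z hz hz' hyz
    rw [Finset.mem_filter] at hy hz'
    exact hz' ⟨hz, hy.2.tail ⟨hz, hyz⟩⟩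

theorem component_nonempty (hK : K ∈ components G S) : K.Nonempty :=
  Finset.coe_nonempty.1 (mem_components.1 hK).2.1.1

theorem mem_dominatingVertices {x : ℕ} :
    x ∈ dominatingVertices G S ↔ x ∈ S ∧ ∀ y ∈ S, y ≠ x → G.Adj x y := by
  simp [dominatingVertices]

theorem dominatingVertices_subset : dominatingVertices G S ⊆ S := fun _ hx =>
  (mem_dominatingVertices.1 hx).1

theorem dominatingVertices_nonempty (hG : G.HasDominators) (hS : G.ConnectedOn (S : Set ℕ)) :
    (dominatingVertices G S).Nonempty := by
  obtain ⟨x, hx, h⟩ := hG _ hS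
  exact ⟨x, mem_dominatingVertices.2 ⟨hx, h⟩⟩

/-- Deleting the dominating vertices never leaves exactly one component. -/
theorem exists_other_component (hG : G.HasDominators)
    {I : Finset (Finset ℕ)} (hI : I = components G (S \ dominatingVertices G S))
    (hK : K ∈ I) : ∃ K' ∈ I, K' ≠ K := by
  subst hI
  by_contra! h
  have hsub := (mem_components.1 hK).1
  have e : K = S \ dominatingVertices G S := hsub.antisymm fun y hy => by
    obtain ⟨K', hK', hy'⟩ := exists_component (G := G) hy
    exact h K' hK' ▸ hy'
  -- A dominating vertex of a sole remaining component is also adjacent to all deleted vertices. It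
  -- would dominate `S` and so would have been deleted.
  obtain ⟨x, hx, hx'⟩ := hG _ (mem_components.1 hK).2.1
  have hxS := Finset.mem_sdiff.1 (hsub hx)
  refine hxS.2 (mem_dominatingVertices.2 ⟨hxS.1, fun y hy hyx => ?_⟩)
  by_cases hyd : y ∈ dominatingVertices G S
  · exact ((mem_dominatingVertices.1 hyd).2 x hxS.1 hyx.symm).symm
  · refine hx' y ?_ hyx
    rw [e]
    exact Finset.mem_coe.2 (Finset.mem_sdiff.2 ⟨hy, hyd⟩)

end BlockForest

/-! ### The block forest of a graph -/

namespace BlockForest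

open SimpleGraph

variable {A C S : Finset ℕ} {F F' : BlockForest} {G : SimpleGraph ℕ}

/-- `F` is a rooted partition forest on `C` in which no vertex has exactly one child, and
two elements of `C` are adjacent in `G` exactly if their blocks are comparable in `F`. -/
structure IsEncoding (G : SimpleGraph ℕ) (C : Finset ℕ) (F : BlockForest) : Prop where
  forest : IsPartitionForest C F
  branching : ∀ c p, F.ParentOf c p → ∃ c', c' ≠ c ∧ F.ParentOf c' p
  adj : ∀ u ∈ F.blocks, ∀ v ∈ F.blocks, ∀ x ∈ u, ∀ y ∈ v, x ≠ y →
    (G.Adj x y ↔ ReflTransGen F.ParentOf u v ∨ ReflTransGen F.ParentOf v u)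

theorem isEncoding_single (hC : C.Nonempty) (h : G.IsClique (C : Set ℕ)) :
    IsEncoding G C (single C) := by
  have hp : ∀ c p, ¬ (single C).ParentOf c p := by simp [ParentOf, single]
  have hb : ∀ v, v ∈ (single C).blocks ↔ v = C := by simp [single]
  refine ⟨⟨?_, ?_, ?_, ?_, ?_, ?_⟩, ?_, ?_⟩
  · rw [hb]
    exact hC.ne_empty.symm
  · intro u hu v hv huv
    rw [hb] at hu hv
    exact (huv (hu.trans hv.symm)).elim
  · simp [single]
  · exact fun c p hcp => (hp c p hcp).elim
  · exact fun c p _ hcp => (hp c p hcp).elim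
  · exact acyclic_of_rank (fun _ => 0) fun c p hcp => (hp c p hcp).elim
  · exact fun c p hcp => (hp c p hcp).elim
  · intro u hu v hv x hx y hy hxy
    rw [hb] at hu hv
    subst hu hv
    exact iff_of_true (h hx hy hxy) (.inl .refl)

section addRoot

variable {D : Finset ℕ}

theorem addRoot_parentOf {c p : Finset ℕ} :
    (F.addRoot D).ParentOf c p ↔ F.ParentOf c p ∨ p = D ∧ c ∈ F.roots := by
  simp only [addRoot, ParentOf, Finset.mem_union, Finset.mem_image, Prod.mk.injEq]
  grind

theorem mem_blocks_addRoot {c : Finset ℕ} :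
    c ∈ (F.addRoot D).blocks ↔ c = D ∨ c ∈ F.blocks := by
  simp [addRoot]

/-- Every vertex lies below `D`, matching that elements of `D` are adjacent to all others;
comparability below `D` is unchanged. The hypothesis `hr` supplies the branching at the new root. -/
theorem isEncoding_addRoot (hD : D.Nonempty) (hDC : D ⊆ C) (hF : IsEncoding G (C \ D) F)
    (hr : ∀ r ∈ F.roots, ∃ r' ∈ F.roots, r' ≠ r) (hadj : ∀ x ∈ D, ∀ y ∈ C, y ≠ x → G.Adj x y) :
    IsEncoding G C (F.addRoot D) := by
  have hdisj : ∀ v ∈ F.blocks, Disjoint D v := fun v hv =>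
    Finset.disjoint_of_subset_right (hF.forest.subset hv) Finset.disjoint_sdiff
  have hDn : D ∉ F.blocks := fun h => hD.ne_empty (disjoint_self.1 (hdisj D h))
  have hne : ∀ {v}, v ∈ F.blocks → v ≠ D := fun hv e => hDn (e ▸ hv)
  have hroot : ∀ {r}, r ∈ F.roots → r ∈ F.blocks := fun h => (hF.forest.mem_roots.1 h).1
  have hmono : ∀ {u v}, ReflTransGen F.ParentOf u v → ReflTransGen (F.addRoot D).ParentOf u v :=
    fun h => ReflTransGen.lift id (fun c p h => addRoot_parentOf.2 (.inl h)) _ _ h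
  have hreach : ∀ {u v}, v ∈ F.blocks →
      (ReflTransGen (F.addRoot D).ParentOf u v ↔ ReflTransGen F.ParentOf u v) := by
    refine fun {u v} hv => ⟨fun h => ?_, hmono⟩
    induction h using ReflTransGen.head_induction_on with
    | refl => exact .refl
    | head h1 _ ih =>
      rcases addRoot_parentOf.1 h1 with h1 | ⟨rfl, -⟩
      · exact .head h1 ih
      · exact (hDn (hF.forest.mem_blocks_of_reach' hv ih)).elim
  have htop : ∀ {u}, u ∈ (F.addRoot D).blocks → ReflTransGen (F.addRoot D).ParentOf u D := by
    intro u hu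
    rcases mem_blocks_addRoot.1 hu with rfl | hu
    · exact .refl
    · obtain ⟨r, hr, hur⟩ := hF.forest.exists_root hu
      exact (hmono hur).tail (addRoot_parentOf.2 (.inr ⟨rfl, hr⟩))
  have hsub : ∀ {u}, u ∈ (F.addRoot D).blocks → u ⊆ C := fun hu => by
    rcases mem_blocks_addRoot.1 hu with rfl | hu
    · exact hDC
    · exact (hF.forest.subset hu).trans Finset.sdiff_subset
  refine ⟨⟨?_, ?_, ?_, ?_, ?_, ?_⟩, ?_, ?_⟩
  · rw [mem_blocks_addRoot, not_or]
    exact ⟨hD.ne_empty.symm, hF.forest.empty_notMem⟩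
  · intro u hu v hv huv
    rcases mem_blocks_addRoot.1 hu with hu | hu' <;> rcases mem_blocks_addRoot.1 hv with hv | hv'
    · exact (huv (hu.trans hv.symm)).elim
    · exact hu ▸ hdisj v hv'
    · exact hv ▸ (hdisj u hu').symm
    · exact hF.forest.disjoint u hu' v hv' huv
  · rw [addRoot, Finset.biUnion_insert, hF.forest.union]
    exact Finset.union_sdiff_of_subset hDC
  · intro c p g
    rw [mem_blocks_addRoot, mem_blocks_addRoot]
    rcases addRoot_parentOf.1 g with h | ⟨rfl, h⟩
    · have := hF.forest.mem_blocks _ _ h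
      exact ⟨.inr this.1, .inr this.2⟩
    · exact ⟨.inr (hroot h), .inl rfl⟩
  · intro c p p' g g'
    rcases addRoot_parentOf.1 g with h | ⟨h1, h⟩ <;>
      rcases addRoot_parentOf.1 g' with h' | ⟨h1', h'⟩
    · exact hF.forest.parent_unique _ _ _ h h'
    · exact ((hF.forest.mem_roots.1 h').2 _ h).elim
    · exact ((hF.forest.mem_roots.1 h).2 _ h').elim
    · exact h1.trans h1'.symm
  · obtain ⟨k, hk⟩ := hF.forest.exists_rank
    refine acyclic_of_rank (fun x => if x = D then 0 else k x + 1) fun c p g => ?_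
    rcases addRoot_parentOf.1 g with h | ⟨rfl, h⟩
    · have h1 := hF.forest.mem_blocks _ _ h
      simpa only [if_neg (hne h1.1), if_neg (hne h1.2), add_lt_add_iff_right] using hk _ _ h
    · simp [hne (hroot h)]
  · intro c p g
    rcases addRoot_parentOf.1 g with h | ⟨rfl, h⟩
    · obtain ⟨c', h1, h2⟩ := hF.branching c p h
      exact ⟨c', h1, addRoot_parentOf.2 (.inl h2)⟩
    · obtain ⟨r', h1, h2⟩ := hr c h
      exact ⟨r', h2, addRoot_parentOf.2 (.inr ⟨rfl, h1⟩)⟩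
  · intro u hu v hv x hx y hy hxy
    rcases mem_blocks_addRoot.1 hu with rfl | hu'
    · exact iff_of_true (hadj x hx y (hsub hv hy) hxy.symm) (.inr (htop hv))
    rcases mem_blocks_addRoot.1 hv with rfl | hv'
    · exact iff_of_true (hadj y hy x (hsub hu hx) hxy).symm (.inl (htop hu))
    rw [hreach hu', hreach hv']
    exact hF.adj u hu' v hv' x hx y hy hxy

end addRoot

section union

variable {I : Finset (Finset ℕ)} {T : Finset ℕ → BlockForest}

theorem union_parentOf {c p : Finset ℕ} :
    (BlockForest.union I T).ParentOf c p ↔ ∃ K ∈ I, (T K).ParentOf c p := by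
  simp [BlockForest.union, ParentOf]

theorem mem_blocks_union {c : Finset ℕ} :
    c ∈ (BlockForest.union I T).blocks ↔ ∃ K ∈ I, c ∈ (T K).blocks := by
  simp [BlockForest.union]

theorem eq_of_mem_blocks_union (hI : I = components G S)
    (hT : ∀ K ∈ I, IsEncoding G K (T K)) {K K' v : Finset ℕ} (hK : K ∈ I) (hK' : K' ∈ I)
    (h : v ∈ (T K).blocks) (h' : v ∈ (T K').blocks) : K = K' := by
  obtain ⟨x, hx⟩ := (hT K hK).forest.nonempty h
  have h1 := (hT K hK).forest.subset h hx
  have h2 := (hT K' hK').forest.subset h' hx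
  subst hI
  exact components_eq_of_mem hK hK' h1 h2

/-- The trees live on disjoint label sets and each is closed under taking parents, so labels from
different components are neither comparable nor adjacent. -/
theorem isEncoding_union (hI : I = components G S) (hT : ∀ K ∈ I, IsEncoding G K (T K)) :
    IsEncoding G S (BlockForest.union I T) := by
  have hinj := fun {K K' v} => eq_of_mem_blocks_union hI hT (K := K) (K' := K') (v := v)
  have hcomp : ∀ {K K' : Finset ℕ} {x}, K ∈ I → K' ∈ I → x ∈ K → x ∈ K' → K = K' := by
    subst hI
    exact fun hK hK' => components_eq_of_mem hK hK'
  have hpar : ∀ {K c p}, K ∈ I → c ∈ (T K).blocks → (BlockForest.union I T).ParentOf c p →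
      (T K).ParentOf c p := by
    intro K c p hK hc h
    obtain ⟨K', hK', h⟩ := union_parentOf.1 h
    rwa [hinj hK hK' hc ((hT K' hK').forest.mem_blocks _ _ h).1]
  have htrans : ∀ {K u v}, K ∈ I → u ∈ (T K).blocks → TransGen (BlockForest.union I T).ParentOf u v →
      TransGen (T K).ParentOf u v ∧ v ∈ (T K).blocks := by
    intro K u v hK hu h
    induction h with
    | single h1 =>
      have h2 := hpar hK hu h1
      exact ⟨.single h2, ((hT K hK).forest.mem_blocks _ _ h2).2⟩
    | tail _ h1 ih =>
      have h2 := hpar hK ih.2 h1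
      exact ⟨.tail ih.1 h2, ((hT K hK).forest.mem_blocks _ _ h2).2⟩
  have hreach : ∀ {K u v}, K ∈ I → u ∈ (T K).blocks →
      (ReflTransGen (BlockForest.union I T).ParentOf u v ↔ ReflTransGen (T K).ParentOf u v) := by
    refine fun {K u v} hK hu => ⟨fun h => ?_, fun h =>
      ReflTransGen.lift id (fun c p h => union_parentOf.2 ⟨K, hK, h⟩) _ _ h⟩
    rcases reflTransGen_iff_eq_or_transGen.1 h with rfl | h
    · exact .refl
    · exact (htrans hK hu h).1.to_reflTransGen
  refine ⟨⟨?_, ?_, ?_, ?_, ?_, ?_⟩, ?_, ?_⟩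
  · rw [mem_blocks_union]
    rintro ⟨K, hK, h⟩
    exact (hT K hK).forest.empty_notMem h
  · intro u hu v hv huv
    obtain ⟨K, hK, hu⟩ := mem_blocks_union.1 hu
    obtain ⟨K', hK', hv⟩ := mem_blocks_union.1 hv
    refine Finset.disjoint_left.2 fun x hx hx' => huv ?_
    obtain rfl := hcomp hK hK' ((hT K hK).forest.subset hu hx) ((hT K' hK').forest.subset hv hx')
    exact (hT K hK).forest.eq_of_mem hu hv hx hx'
  · ext x
    simp only [Finset.mem_biUnion, mem_blocks_union, id]
    constructor
    · rintro ⟨v, ⟨K, hK, hv⟩, hx⟩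
      have := (hT K hK).forest.subset hv hx
      subst hI
      exact (mem_components.1 hK).1 this
    · intro hx
      obtain ⟨K, hK, hxK⟩ := exists_component (G := G) hx
      rw [← hI] at hK
      obtain ⟨v, hv, hxv⟩ := (hT K hK).forest.mem_ground_iff.1 hxK
      exact ⟨v, ⟨K, hK, hv⟩, hxv⟩
  · intro c p h
    obtain ⟨K, hK, h⟩ := union_parentOf.1 h
    have := (hT K hK).forest.mem_blocks _ _ h
    exact ⟨mem_blocks_union.2 ⟨K, hK, this.1⟩, mem_blocks_union.2 ⟨K, hK, this.2⟩⟩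
  · intro c p p' h h'
    obtain ⟨K, hK, h⟩ := union_parentOf.1 h
    exact (hT K hK).forest.parent_unique _ _ _ h
      (hpar hK ((hT K hK).forest.mem_blocks _ _ h).1 h')
  · intro v hv
    obtain ⟨w, hw, -⟩ := TransGen.head'_iff.1 hv
    obtain ⟨K, hK, h⟩ := union_parentOf.1 hw
    exact (hT K hK).forest.acyclic v (htrans hK ((hT K hK).forest.mem_blocks _ _ h).1 hv).1
  · intro c p h
    obtain ⟨K, hK, h⟩ := union_parentOf.1 h
    obtain ⟨c', h1, h2⟩ := (hT K hK).branching c p h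
    exact ⟨c', h1, union_parentOf.2 ⟨K, hK, h2⟩⟩
  · intro u hu v hv x hx y hy hxy
    obtain ⟨K, hK, hu⟩ := mem_blocks_union.1 hu
    obtain ⟨K', hK', hv⟩ := mem_blocks_union.1 hv
    rw [hreach hK hu, hreach hK' hv]
    have hxK := (hT K hK).forest.subset hu hx
    have hyK := (hT K' hK').forest.subset hv hy
    by_cases e : K = K'
    · subst e
      exact (hT K hK).adj u hu v hv x hx y hy hxy
    · refine iff_of_false ?_ ?_
      · subst hI
        exact (mem_components.1 hK).2.2 x hxK y ((mem_components.1 hK').1 hyK)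
          fun h => e (hcomp hK hK' h hyK)
      · rintro (h | h)
        · exact e (hinj hK hK' ((hT K hK).forest.mem_blocks_of_reach hu h) hv)
        · exact e (hinj hK hK' hu ((hT K' hK').forest.mem_blocks_of_reach hv h))

theorem mem_roots_union (hI : I = components G S) (hT : ∀ K ∈ I, IsEncoding G K (T K))
    {r : Finset ℕ} :
    r ∈ (BlockForest.union I T).roots ↔ ∃ K ∈ I, r ∈ (T K).roots := by
  rw [(isEncoding_union hI hT).forest.mem_roots, mem_blocks_union]
  constructor
  · rintro ⟨⟨K, hK, h1⟩, h2⟩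
    exact ⟨K, hK, (hT K hK).forest.mem_roots.2
      ⟨h1, fun p hp => h2 p (union_parentOf.2 ⟨K, hK, hp⟩)⟩⟩
  · rintro ⟨K, hK, h1⟩
    have h2 := (hT K hK).forest.mem_roots.1 h1
    refine ⟨⟨K, hK, h2.1⟩, fun p hp => ?_⟩
    obtain ⟨K', hK', h3⟩ := union_parentOf.1 hp
    have h4 := ((hT K' hK').forest.mem_blocks _ _ h3).1
    obtain rfl := eq_of_mem_blocks_union hI hT hK hK' h2.1 h4
    exact h2.2 p h3

end union

/-- `exists_other_component` rules out that the root of a non-complete component has exactly one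
child. -/
theorem EncodesTree.isEncoding {T : BlockForest} (h : EncodesTree G C T)
    (hG : G.HasDominators) (hC : G.ConnectedOn (C : Set ℕ)) : IsEncoding G C T := by
  induction h with
  | complete h1 h2 => exact isEncoding_single h1 h2
  | @step C T h1 _ ih =>
    set I := components G (C \ dominatingVertices G C) with hI
    have ih : ∀ K ∈ I, IsEncoding G K (T K) := fun K hK => ih K hK (mem_components.1 hK).2.1
    refine isEncoding_addRoot (dominatingVertices_nonempty hG hC) dominatingVertices_subset
      (isEncoding_union hI ih) (fun r hr => ?_) fun x hx => (mem_dominatingVertices.1 hx).2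
    obtain ⟨K, hK, hr⟩ := (mem_roots_union hI ih).1 hr
    obtain ⟨K', hK', hne⟩ := exists_other_component hG hI hK
    obtain ⟨x, hx⟩ := component_nonempty hK'
    obtain ⟨r', hr', -⟩ := (ih K' hK').forest.exists_root_of_mem hx
    refine ⟨r', (mem_roots_union hI ih).2 ⟨K', hK', hr'⟩, ?_⟩
    rintro rfl
    exact hne (eq_of_mem_blocks_union hI ih hK' hK ((ih K' hK').forest.mem_roots.1 hr').1
      ((ih K hK).forest.mem_roots.1 hr).1)

/-- Each component that remains is smaller, because at least one dominating vertex has been deleted.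
-/
theorem exists_encodesTree (hG : G.HasDominators) (hC : G.ConnectedOn (C : Set ℕ)) :
    ∃ T, EncodesTree G C T := by
  induction hn : C.card using Nat.strong_induction_on generalizing C with
  | _ n ih =>
    by_cases h : G.IsClique (C : Set ℕ)
    · exact ⟨_, .complete (Finset.coe_nonempty.1 hC.1) h⟩
    -- The constructor wants a total function `T`; off the components its value is arbitrary, here
    -- `single K`.
    · have key : ∀ K, ∃ T, K ∈ components G (C \ dominatingVertices G C) → EncodesTree G K T := by
        intro K
        by_cases hK : K ∈ components G (C \ dominatingVertices G C)
        · have h1 := mem_components.1 hK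
          have hlt : K.card < n := by
            rw [← hn]
            obtain ⟨x, hx⟩ := dominatingVertices_nonempty hG hC
            refine Finset.card_lt_card ((Finset.ssubset_iff_of_subset
              (h1.1.trans Finset.sdiff_subset)).2 ⟨x, dominatingVertices_subset hx, fun hxK => ?_⟩)
            exact (Finset.mem_sdiff.1 (h1.1 hxK)).2 hx
          obtain ⟨T, hT⟩ := ih _ hlt h1.2.1 rfl
          exact ⟨T, fun _ => hT⟩
        · exact ⟨single K, fun h => (hK h).elim⟩
      choose T hT using key
      exact ⟨_, .step T h hT⟩

theorem exists_encodesForest (hG : G.HasDominators) : ∃ F, EncodesForest G S F := by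
  have key : ∀ K, ∃ T, K ∈ components G S → EncodesTree G K T := by
    intro K
    by_cases hK : K ∈ components G S
    · obtain ⟨T, hT⟩ := exists_encodesTree hG (mem_components.1 hK).2.1
      exact ⟨T, fun _ => hT⟩
    · exact ⟨single K, fun h => (hK h).elim⟩
  choose T hT using key
  exact ⟨_, T, hT, rfl⟩

theorem EncodesForest.isEncoding (h : EncodesForest G S F) (hG : G.HasDominators) :
    IsEncoding G S F := by
  obtain ⟨T, hT, rfl⟩ := h
  exact isEncoding_union rfl fun K hK => (hT K hK).isEncoding hG (mem_components.1 hK).2.1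

/-! ### Expanding vertices into paths -/

/-- The element `x` is above the element `y` after the expansion of `F`. -/
def ElemBelow (F : BlockForest) (y x : ℕ) : Prop :=
  (∃ v ∈ F.blocks, y ∈ v ∧ x ∈ v ∧ x < y) ∨
    ∃ u ∈ F.blocks, ∃ v ∈ F.blocks, y ∈ u ∧ x ∈ v ∧ TransGen F.ParentOf u v

/-- The element `x` is immediately above the element `y` after the expansion of `F`. -/
def ElemParent (F : BlockForest) (y x : ℕ) : Prop :=
  (∃ v ∈ F.blocks, y ∈ v ∧ x ∈ v ∧ x < y ∧ ∀ z ∈ v, ¬ (x < z ∧ z < y)) ∨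
    ∃ c p, F.ParentOf c p ∧ IsLeast (c : Set ℕ) y ∧ IsGreatest (p : Set ℕ) x

theorem IsPartitionForest.expand_parentOf (hF : IsPartitionForest A F) {c p : Finset ℕ} :
    (expand F).ParentOf c p ↔ ∃ y x, c = {y} ∧ p = {x} ∧ F.ElemParent y x := by
  have hg : F.ground = A := hF.union
  simp only [expand, ParentOf, Finset.mem_image, Finset.mem_filter, Finset.mem_product, Prod.exists,
    Prod.mk.injEq, hg]
  constructor
  · rintro ⟨y, x, ⟨-, h⟩, rfl, rfl⟩
    exact ⟨y, x, rfl, rfl, h⟩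
  · rintro ⟨y, x, rfl, rfl, h⟩
    refine ⟨y, x, ⟨?_, h⟩, rfl, rfl⟩
    rcases h with ⟨v, hv, hy, hx, -⟩ | ⟨c, p, hcp, hy, hx⟩
    · exact ⟨hF.subset hv hy, hF.subset hv hx⟩
    · have := hF.mem_blocks _ _ hcp
      exact ⟨hF.subset this.1 hy.1, hF.subset this.2 hx.1⟩

theorem IsPartitionForest.mem_blocks_expand (hF : IsPartitionForest A F) {v : Finset ℕ} :
    v ∈ (expand F).blocks ↔ ∃ x ∈ A, v = {x} := by
  have hg : F.ground = A := hF.union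
  simp [expand, hg, eq_comm]

theorem IsPartitionForest.elemBelow_of_elemParent (hF : IsPartitionForest A F) {y x : ℕ}
    (h : F.ElemParent y x) : F.ElemBelow y x := by
  rcases h with ⟨v, hv, hy, hx, hlt, -⟩ | ⟨c, p, hcp, hy, hx⟩
  · exact .inl ⟨v, hv, hy, hx, hlt⟩
  · have := hF.mem_blocks _ _ hcp
    exact .inr ⟨c, this.1, p, this.2, hy.1, hx.1, .single hcp⟩

theorem IsPartitionForest.elemBelow_trans (hF : IsPartitionForest A F) {x y z : ℕ}
    (h₁ : F.ElemBelow x y) (h₂ : F.ElemBelow y z) : F.ElemBelow x z := by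
  rcases h₁ with ⟨v, hv, hx, hy, hlt⟩ | ⟨u, hu, v, hv, hx, hy, h⟩ <;>
    rcases h₂ with ⟨w, hw, hy', hz, hlt'⟩ | ⟨u', hu', w, hw, hy', hz, h'⟩
  · obtain rfl := hF.eq_of_mem hv hw hy hy'
    exact .inl ⟨v, hv, hx, hz, hlt'.trans hlt⟩
  · obtain rfl := hF.eq_of_mem hv hu' hy hy'
    exact .inr ⟨v, hv, w, hw, hx, hz, h'⟩
  · obtain rfl := hF.eq_of_mem hv hw hy hy'
    exact .inr ⟨u, hu, v, hv, hx, hz, h⟩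
  · obtain rfl := hF.eq_of_mem hv hu' hy hy'
    exact .inr ⟨u, hu, w, hw, hx, hz, h.trans h'⟩

theorem IsPartitionForest.not_elemBelow_self (hF : IsPartitionForest A F) (x : ℕ) :
    ¬ F.ElemBelow x x := by
  rintro (⟨v, hv, -, -, hlt⟩ | ⟨u, hu, v, hv, hx, hy, h⟩)
  · exact lt_irrefl _ hlt
  · obtain rfl := hF.eq_of_mem hu hv hx hy
    exact hF.acyclic u h

/-- Either `x` is immediately above `y`, or there is an element in between that is
immediately above `y`. -/
theorem IsPartitionForest.exists_elemParent (hF : IsPartitionForest A F) {y x : ℕ}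
    (h : F.ElemBelow y x) : ∃ z ∈ A, F.ElemParent y z ∧ (z = x ∨ F.ElemBelow z x) := by
  obtain ⟨u, hu, hy⟩ : ∃ u ∈ F.blocks, y ∈ u := by
    rcases h with ⟨v, hv, hy, -⟩ | ⟨u, hu, v, -, hy, -⟩
    · exact ⟨v, hv, hy⟩
    · exact ⟨u, hu, hy⟩
  -- If `y` is not least in its block, the next vertex up is its predecessor there; otherwise it is
  -- the maximum of the parent block.
  by_cases hmin : ∃ w ∈ u, w < y
  · have hne : (u.filter fun w => w < y).Nonempty := by
      obtain ⟨w, hw⟩ := hmin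
      exact ⟨w, Finset.mem_filter.2 hw⟩
    set z := (u.filter fun w => w < y).max' hne with hz
    have hzm := Finset.mem_filter.1 (Finset.max'_mem _ hne)
    have hzmax : ∀ w ∈ u, w < y → w ≤ z := fun w hw hwy =>
      Finset.le_max' _ _ (Finset.mem_filter.2 ⟨hw, hwy⟩)
    rw [← hz] at hzm
    refine ⟨z, hF.subset hu hzm.1, .inl ⟨u, hu, hy, hzm.1, hzm.2, fun w hw h1 =>
      not_le.2 h1.1 (hzmax w hw h1.2)⟩, ?_⟩
    rcases h with ⟨v, hv, hy', hx, hlt⟩ | ⟨u', hu', v, hv, hy', hx, h⟩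
    · obtain rfl := hF.eq_of_mem hu hv hy hy'
      rcases (hzmax x hx hlt).eq_or_lt with h1 | h1
      · exact .inl h1.symm
      · exact .inr (.inl ⟨u, hu, hzm.1, hx, h1⟩)
    · obtain rfl := hF.eq_of_mem hu hu' hy hy'
      exact .inr (.inr ⟨u, hu, v, hv, hzm.1, hx, h⟩)
  · push Not at hmin
    rcases h with ⟨v, hv, hy', hx, hlt⟩ | ⟨u', hu', v, hv, hy', hx, h⟩
    · obtain rfl := hF.eq_of_mem hu hv hy hy'
      exact (not_le.2 hlt (hmin x hx)).elim
    · obtain rfl := hF.eq_of_mem hu hu' hy hy'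
      obtain ⟨p, hp, hpv⟩ := TransGen.head'_iff.1 h
      have hpm := (hF.mem_blocks _ _ hp).2
      have hpne := hF.nonempty hpm
      refine ⟨p.max' hpne, hF.subset hpm (p.max'_mem hpne), .inr ⟨u, p, hp, ⟨hy, hmin⟩,
        p.isGreatest_max' hpne⟩, ?_⟩
      rcases reflTransGen_iff_eq_or_transGen.1 hpv with rfl | hpv
      · rcases (Finset.le_max' _ x hx).eq_or_lt with h1 | h1
        · exact .inl h1.symm
        · exact .inr (.inl ⟨v, hv, Finset.max'_mem _ _, hx, h1⟩)
      · exact .inr (.inr ⟨p, hpm, v, hv, p.max'_mem hpne, hx, hpv⟩)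

/-- One direction is transitivity. For the other, climb one step at a time towards `x`; the set of
elements above the current one shrinks strictly. -/
theorem IsPartitionForest.transGen_expand_iff (hF : IsPartitionForest A F) {y x : ℕ} :
    TransGen (expand F).ParentOf {y} {x} ↔ F.ElemBelow y x := by
  constructor
  · have key : ∀ c p, TransGen (expand F).ParentOf c p →
        ∃ y x, c = {y} ∧ p = {x} ∧ F.ElemBelow y x := by
      intro c p h
      induction h with
      | single h1 =>
        obtain ⟨y, x, rfl, rfl, h⟩ := hF.expand_parentOf.1 h1
        exact ⟨y, x, rfl, rfl, hF.elemBelow_of_elemParent h⟩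
      | tail _ h1 ih =>
        obtain ⟨y, x, rfl, rfl, h⟩ := ih
        obtain ⟨y', x', e, rfl, h'⟩ := hF.expand_parentOf.1 h1
        obtain rfl := Finset.singleton_inj.1 e
        exact ⟨y, x', rfl, rfl, hF.elemBelow_trans h (hF.elemBelow_of_elemParent h')⟩
    intro h
    obtain ⟨y', x', e, e', h⟩ := key _ _ h
    rwa [Finset.singleton_inj.1 e, Finset.singleton_inj.1 e']
  · classical
    intro h
    induction hn : (A.filter fun z => F.ElemBelow y z).card using Nat.strong_induction_on
      generalizing y with
    | _ n ih =>
      obtain ⟨z, hzA, hyz, hzx⟩ := hF.exists_elemParent h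
      have hp : (expand F).ParentOf {y} {z} := hF.expand_parentOf.2 ⟨y, z, rfl, rfl, hyz⟩
      rcases hzx with rfl | hzx
      · exact .single hp
      · refine .head hp (ih _ ?_ hzx rfl)
        rw [← hn]
        have hyz := hF.elemBelow_of_elemParent hyz
        refine Finset.card_lt_card ((Finset.ssubset_iff_of_subset fun w hw => ?_).2 ⟨z, ?_, ?_⟩)
        · rw [Finset.mem_filter] at hw ⊢
          exact ⟨hw.1, hF.elemBelow_trans hyz hw.2⟩
        · exact Finset.mem_filter.2 ⟨hzA, hyz⟩
        · exact fun hz => hF.not_elemBelow_self z (Finset.mem_filter.1 hz).2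

/-- The two clauses exclude each other: the first provides a smaller element in the block of `y`,
the second makes `y` its least element. -/
theorem IsPartitionForest.elemParent_unique (hF : IsPartitionForest A F) {y x x' : ℕ}
    (h : F.ElemParent y x) (h' : F.ElemParent y x') : x = x' := by
  rcases h with ⟨v, hv, hy, hx, hlt, hz⟩ | ⟨c, p, hcp, hy, hx⟩ <;>
    rcases h' with ⟨v', hv', hy', hx', hlt', hz'⟩ | ⟨c', p', hcp', hy', hx'⟩
  · obtain rfl := hF.eq_of_mem hv hv' hy hy'
    have h1 := hz x' hx'
    have h2 := hz' x hx
    omega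
  · obtain rfl := hF.eq_of_mem hv (hF.mem_blocks _ _ hcp').1 hy hy'.1
    have := hy'.2 hx
    omega
  · obtain rfl := hF.eq_of_mem (hF.mem_blocks _ _ hcp).1 hv' hy.1 hy'
    have := hy.2 hx'
    omega
  · obtain rfl := hF.eq_of_mem (hF.mem_blocks _ _ hcp).1 (hF.mem_blocks _ _ hcp').1 hy.1 hy'.1
    obtain rfl := hF.parent_unique _ _ _ hcp hcp'
    exact hx.unique hx'

theorem IsPartitionForest.expand (hF : IsPartitionForest A F) :
    IsPartitionForest A (expand F) := by
  refine ⟨?_, ?_, ?_, ?_, ?_, ?_⟩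
  · rw [hF.mem_blocks_expand]
    rintro ⟨x, -, h⟩
    exact Finset.singleton_ne_empty x h.symm
  · intro u hu v hv huv
    obtain ⟨x, -, rfl⟩ := hF.mem_blocks_expand.1 hu
    obtain ⟨y, -, rfl⟩ := hF.mem_blocks_expand.1 hv
    exact Finset.disjoint_singleton.2 fun e => huv (e ▸ rfl)
  · ext x
    simp only [Finset.mem_biUnion, hF.mem_blocks_expand, id]
    constructor
    · rintro ⟨v, ⟨y, hy, rfl⟩, hx⟩
      exact Finset.mem_singleton.1 hx ▸ hy
    · exact fun hx => ⟨{x}, ⟨x, hx, rfl⟩, by simp⟩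
  · intro c p g
    obtain ⟨y, x, rfl, rfl, h⟩ := hF.expand_parentOf.1 g
    rw [hF.mem_blocks_expand, hF.mem_blocks_expand]
    rcases h with ⟨v, hv, hy, hx, -⟩ | ⟨c, p, hcp, hy, hx⟩
    · exact ⟨⟨y, hF.subset hv hy, rfl⟩, ⟨x, hF.subset hv hx, rfl⟩⟩
    · have := hF.mem_blocks _ _ hcp
      exact ⟨⟨y, hF.subset this.1 hy.1, rfl⟩, ⟨x, hF.subset this.2 hx.1, rfl⟩⟩
  · intro c p p' g g'
    obtain ⟨y, x, rfl, rfl, h⟩ := hF.expand_parentOf.1 g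
    obtain ⟨y', x', e, rfl, h'⟩ := hF.expand_parentOf.1 g'
    obtain rfl := Finset.singleton_inj.1 e
    rw [hF.elemParent_unique h h']
  · intro v hv
    obtain ⟨w, hw, -⟩ := TransGen.head'_iff.1 hv
    obtain ⟨y, x, rfl, rfl, h⟩ := hF.expand_parentOf.1 hw
    exact hF.not_elemBelow_self y (hF.transGen_expand_iff.1 hv)

/-- `F` is an increasing forest whose comparability graph is `G`. -/
structure Represents (A : Finset ℕ) (F : BlockForest) (G : SimpleGraph ℕ) : Prop where
  forest : IsPartitionForest A F
  increasing : F.IsIncreasing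
  adj : ∀ x ∈ A, ∀ y ∈ A, G.Adj x y ↔
    TransGen F.ParentOf {x} {y} ∨ TransGen F.ParentOf {y} {x}

/-- Elements of one block form a chain after expansion, in agreement with the reflexive
comparability of blocks. The branching condition leaves only edges inside blocks to be checked for
increase. -/
theorem IsEncoding.represents_expand (h : IsEncoding G A F) : Represents A (expand F) G := by
  have hF := h.forest
  refine ⟨hF.expand, ⟨fun v hv => ?_, fun x y hxy h1 => ?_⟩, fun x hx y hy => ?_⟩
  · obtain ⟨x, -, rfl⟩ := hF.mem_blocks_expand.1 hv
    simp
  · obtain ⟨y', x', e, e', h2⟩ := hF.expand_parentOf.1 hxy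
    obtain rfl := Finset.singleton_inj.1 e
    obtain rfl := Finset.singleton_inj.1 e'
    rcases h2 with ⟨v, hv, hy, hx, hlt, -⟩ | ⟨c, p, hcp, hy, hx⟩
    · exact hlt
    -- The least element of a sibling block would be a second child of `{x}`.
    · obtain ⟨c', hne, hcp'⟩ := h.branching c p hcp
      have hc'm := (hF.mem_blocks _ _ hcp').1
      have hc' := hF.nonempty hc'm
      have h3 := h1 {c'.min' hc'} (hF.expand_parentOf.2 ⟨_, _, rfl, rfl,
        .inr ⟨c', p, hcp', c'.isLeast_min' hc', hx⟩⟩)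
      have h4 : c'.min' hc' ∈ c := Finset.singleton_inj.1 h3 ▸ hy.1
      exact (hne (hF.eq_of_mem hc'm (hF.mem_blocks _ _ hcp).1 (c'.min'_mem hc') h4)).elim
  · rw [hF.transGen_expand_iff, hF.transGen_expand_iff]
    by_cases hxy : x = y
    · subst hxy
      exact iff_of_false (G.loopless.irrefl x) (by simp [hF.not_elemBelow_self])
    obtain ⟨u, hu, hxu⟩ := hF.mem_ground_iff.1 hx
    obtain ⟨v, hv, hyv⟩ := hF.mem_ground_iff.1 hy
    rw [h.adj u hu v hv x hxu y hyv hxy]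
    have key : ∀ {u v : Finset ℕ} {x y : ℕ}, u ∈ F.blocks → v ∈ F.blocks → x ∈ u → y ∈ v →
        x ≠ y → ReflTransGen F.ParentOf u v → F.ElemBelow x y ∨ F.ElemBelow y x := by
      intro u v x y hu hv hx hy hxy h1
      rcases reflTransGen_iff_eq_or_transGen.1 h1 with rfl | h1
      · rcases lt_or_gt_of_ne hxy with h2 | h2
        · exact .inr (.inl ⟨_, hu, hy, hx, h2⟩)
        · exact .inl (.inl ⟨_, hu, hx, hy, h2⟩)
      · exact .inl (.inr ⟨u, hu, v, hv, hx, hy, h1⟩)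
    have key' : ∀ {u v : Finset ℕ} {x y : ℕ}, u ∈ F.blocks → v ∈ F.blocks → x ∈ u → y ∈ v →
        F.ElemBelow x y → ReflTransGen F.ParentOf u v := by
      rintro u v x y hu hv hx hy (⟨w, hw, hx', hy', -⟩ | ⟨u', hu', v', hv', hx', hy', h1⟩)
      · obtain rfl := hF.eq_of_mem hu hw hx hx'
        obtain rfl := hF.eq_of_mem hv hw hy hy'
        exact .refl
      · obtain rfl := hF.eq_of_mem hu hu' hx hx'
        obtain rfl := hF.eq_of_mem hv hv' hy hy'
        exact h1.to_reflTransGen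
    constructor
    · rintro (h1 | h1)
      · exact key hu hv hxu hyv hxy h1
      · exact (key hv hu hyv hxu (Ne.symm hxy) h1).symm
    · rintro (h1 | h1)
      · exact .inl (key' hu hv hxu hyv h1)
      · exact .inr (key' hv hu hyv hxu h1)

end BlockForest

/-! ### Recovering an increasing forest from its comparability graph -/

namespace BlockForest

open SimpleGraph

variable {A : Finset ℕ} {F F' : BlockForest} {G : SimpleGraph ℕ}

/-- The parent is the nearest proper ancestor, so the edges are determined by the ancestor relation
alone. -/
theorem IsPartitionForest.parentOf_iff_transGen (hF : IsPartitionForest A F) {c p : Finset ℕ} :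
    F.ParentOf c p ↔ TransGen F.ParentOf c p ∧
      ∀ q, TransGen F.ParentOf c q → q = p ∨ TransGen F.ParentOf p q := by
  constructor
  · refine fun h => ⟨.single h, fun q hq => ?_⟩
    obtain ⟨p', hp', hpq⟩ := TransGen.head'_iff.1 hq
    obtain rfl := hF.parent_unique _ _ _ h hp'
    exact reflTransGen_iff_eq_or_transGen.1 hpq
  · rintro ⟨h1, h2⟩
    obtain ⟨q, hq, hqp⟩ := TransGen.head'_iff.1 h1
    rcases h2 q (.single hq) with rfl | h3
    · exact hq
    · exact (hF.acyclic p (h3.trans_left hqp)).elim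

namespace Represents

theorem mem_blocks (h : Represents A F G) {v : Finset ℕ} :
    v ∈ F.blocks ↔ ∃ x ∈ A, v = {x} := by
  constructor
  · intro hv
    obtain ⟨x, rfl⟩ := Finset.card_eq_one.1 (h.increasing.1 v hv)
    exact ⟨x, h.forest.subset hv (by simp), rfl⟩
  · rintro ⟨x, hx, rfl⟩
    obtain ⟨v, hv, hxv⟩ := h.forest.mem_ground_iff.1 hx
    obtain ⟨y, rfl⟩ := Finset.card_eq_one.1 (h.increasing.1 v hv)
    rwa [Finset.mem_singleton.1 hxv]

/-- The closed neighbourhood of a vertex is contained in those of the vertices above it. -/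
theorem adj_of_transGen (h : Represents A F G) {x y : ℕ} (hx : x ∈ A) (hy : y ∈ A)
    (hxy : TransGen F.ParentOf {x} {y}) :
    ∀ z ∈ A, (z = x ∨ G.Adj x z) → (z = y ∨ G.Adj y z) := by
  rintro z hz (rfl | hxz)
  · exact .inr ((h.adj _ hy _ hz).2 (.inr hxy))
  · rw [h.adj x hx z hz] at hxz
    rw [h.adj y hy z hz]
    rcases hxz with h1 | h1
    · rcases h.forest.reach_total hxy.to_reflTransGen h1.to_reflTransGen with h2 | h2 <;>
        rcases reflTransGen_iff_eq_or_transGen.1 h2 with h3 | h3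
      · exact .inl (Finset.singleton_inj.1 h3)
      · exact .inr (.inl h3)
      · exact .inl (Finset.singleton_inj.1 h3.symm)
      · exact .inr (.inr h3)
    · exact .inr (.inr (h1.trans hxy))

/-- If a vertex and one above it have the same closed neighbourhood, then the labels on the path
between them are increasing. -/
theorem lt_of_transGen (h : Represents A F G) {x y : ℕ}
    (hx : x ∈ A) (hy : y ∈ A) (hxy : TransGen F.ParentOf {x} {y})
    (hn : ∀ z ∈ A, (z = y ∨ G.Adj y z) → (z = x ∨ G.Adj x z)) : y < x := by
  obtain ⟨k, hk⟩ := h.forest.exists_rank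
  induction hm : k {x} using Nat.strong_induction_on generalizing x with
  | _ n ih =>
    obtain ⟨p, hp, hpy⟩ := TransGen.head'_iff.1 hxy
    obtain ⟨w, hw, rfl⟩ := h.mem_blocks.1 (h.forest.mem_blocks _ _ hp).2
    have hlt : w < x := by
      refine h.increasing.2 w x hp fun c hc => ?_
      obtain ⟨z, hz, rfl⟩ := h.mem_blocks.1 (h.forest.mem_blocks _ _ hc).1
      -- Another child of `w` would be adjacent to `y`, hence equal or adjacent to `x` by `hn`; but
      -- siblings are incomparable. So `x` is an only child and increase applies.
      by_contra hzx
      have h1 := hn z hz (.inr ((h.adj y hy z hz).2 (.inr (TransGen.head' hc hpy))))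
      rcases h1 with rfl | h1
      · exact hzx rfl
      · rcases (h.adj x hx z hz).1 h1 with h2 | h2
        · obtain ⟨q, hq, hqz⟩ := TransGen.head'_iff.1 h2
          obtain rfl := h.forest.parent_unique _ _ _ hp hq
          exact h.forest.acyclic _ (TransGen.head' hc hqz)
        · obtain ⟨q, hq, hqz⟩ := TransGen.head'_iff.1 h2
          obtain rfl := h.forest.parent_unique _ _ _ hc hq
          exact h.forest.acyclic _ (TransGen.head' hp hqz)
    rcases reflTransGen_iff_eq_or_transGen.1 hpy with h1 | h1
    · rwa [Finset.singleton_inj.1 h1]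
    · have := ih (k {w}) (hm ▸ hk _ _ hp) hw h1
        (fun z hz hyz => h.adj_of_transGen hx hw (.single hp) z hz (hn z hz hyz)) rfl
      exact this.trans hlt

/-- The right-hand side mentions only the graph and the labels. Equal closed neighbourhoods occur
only along stretches where the labels increase downwards, so the labels settle the direction. -/
theorem transGen_iff (h : Represents A F G) {x y : ℕ} (hx : x ∈ A) (hy : y ∈ A) :
    TransGen F.ParentOf {x} {y} ↔ G.Adj x y ∧
      (∀ z ∈ A, (z = x ∨ G.Adj x z) → (z = y ∨ G.Adj y z)) ∧
      ((∀ z ∈ A, (z = y ∨ G.Adj y z) → (z = x ∨ G.Adj x z)) → y < x) := by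
  constructor
  · intro hxy
    exact ⟨(h.adj x hx y hy).2 (.inl hxy), h.adj_of_transGen hx hy hxy,
      h.lt_of_transGen hx hy hxy⟩
  · rintro ⟨h1, h2, h3⟩
    rcases (h.adj x hx y hy).1 h1 with h4 | h4
    · exact h4
    · have h5 := h3 (h.adj_of_transGen hy hx h4)
      have h6 := h.lt_of_transGen hy hx h4 h2
      omega

/-- An increasing forest is determined by its comparability graph. -/
theorem unique (h : Represents A F G) (h' : Represents A F' G) : F = F' := by
  have key : ∀ {F F' : BlockForest}, Represents A F G → Represents A F' G → ∀ {c p},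
      TransGen F.ParentOf c p → TransGen F'.ParentOf c p := by
    intro F F' h h' c p hcp
    have hm := transGen_mem_blocks h.forest.mem_blocks hcp
    obtain ⟨x, hx, rfl⟩ := h.mem_blocks.1 hm.1
    obtain ⟨y, hy, rfl⟩ := h.mem_blocks.1 hm.2
    rwa [h'.transGen_iff hx hy, ← h.transGen_iff hx hy]
  have key' : ∀ {c p}, TransGen F.ParentOf c p ↔ TransGen F'.ParentOf c p :=
    ⟨key h h', key h' h⟩
  ext1
  · ext v
    rw [h.mem_blocks, h'.mem_blocks]
  · ext ⟨c, p⟩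
    change F.ParentOf c p ↔ F'.ParentOf c p
    rw [h.forest.parentOf_iff_transGen, h'.forest.parentOf_iff_transGen]
    simp only [key']

end Represents

theorem map_subtype_adj {G : SimpleGraph A} {x y : ℕ} (hx : x ∈ A) (hy : y ∈ A) :
    (G.map (Function.Embedding.subtype fun x => x ∈ A)).Adj x y ↔ G.Adj ⟨x, hx⟩ ⟨y, hy⟩ :=
  (SimpleGraph.Embedding.map (Function.Embedding.subtype fun x => x ∈ A) G).map_rel_iff
    (a := ⟨x, hx⟩) (b := ⟨y, hy⟩)

theorem Encodes.represents {G : SimpleGraph A} (hG : IsQuasiThreshold G) (h : Encodes G F) :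
    Represents A F (G.map (Function.Embedding.subtype fun x => x ∈ A)) := by
  obtain ⟨F₀, h1, rfl⟩ := h
  exact (h1.isEncoding (hasDominators_map hG.hasDominators)).represents_expand

theorem exists_encodes {G : SimpleGraph A} (hG : IsQuasiThreshold G) : ∃ F, Encodes G F := by
  obtain ⟨F₀, h⟩ := exists_encodesForest (S := A) (hasDominators_map hG.hasDominators)
  exact ⟨_, F₀, h, rfl⟩

theorem Encodes.injective {G G' : SimpleGraph A} (hG : IsQuasiThreshold G)
    (hG' : IsQuasiThreshold G') (h : Encodes G F) (h' : Encodes G' F) : G = G' := by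
  ext ⟨x, hx⟩ ⟨y, hy⟩
  rw [← map_subtype_adj, ← map_subtype_adj, (h.represents hG).adj x hx y hy,
    (h'.represents hG').adj x hx y hy]

/-- The graph of comparable labels of a forest whose vertices are singletons. -/
def comparabilityGraph (A : Finset ℕ) (F : BlockForest) (hF : IsPartitionForest A F) :
    SimpleGraph A where
  Adj x y := TransGen F.ParentOf {x.1} {y.1} ∨ TransGen F.ParentOf {y.1} {x.1}
  symm := ⟨fun _ _ h => h.symm⟩
  loopless := ⟨fun _ h => hF.acyclic _ (h.elim id id)⟩

theorem IsPartitionForest.comparabilityGraph_hasDominators (hF : IsPartitionForest A F) :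
    (comparabilityGraph A F hF).HasDominators := by
  intro C hC
  obtain ⟨k, hk⟩ := hF.exists_rank
  have hk' : ∀ c p, TransGen F.ParentOf c p → k p < k c := by
    intro c p h
    induction h with
    | single h1 => exact hk _ _ h1
    | tail _ h2 ih => exact (hk _ _ h2).trans ih
  obtain ⟨x, hx, hmin⟩ := (measure fun x : A => k {x.1}).wf.has_min C hC.1
  -- Take `x` in `C` of least rank, that is, as near to a root as possible. The elements of `C`
  -- below it are closed under comparability, because an ancestor of such an element is comparable
  -- with `x` and cannot be strictly above it.
  have e : {z ∈ C | ReflTransGen F.ParentOf {z.1} {x.1}} = C := by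
    refine hC.2 _ (Set.sep_subset _ _) ⟨x, hx, .refl⟩ ?_
    rintro z ⟨hz, hzx⟩ w hw (h | h)
    · refine ⟨hw, ?_⟩
      rcases hF.reach_total hzx h.to_reflTransGen with h1 | h1
      · rcases reflTransGen_iff_eq_or_transGen.1 h1 with h2 | h2
        · rw [h2]
        · exact (hmin w hw (hk' _ _ h2)).elim
      · exact h1
    · exact ⟨hw, h.to_reflTransGen.trans hzx⟩
  refine ⟨x, hx, fun y hy hyx => .inr ?_⟩
  rcases reflTransGen_iff_eq_or_transGen.1 (e.ge hy).2 with h | h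
  · exact (hyx (Subtype.ext (Finset.singleton_inj.1 h.symm))).elim
  · exact h

/-- For the converse, encode the comparability graph of `F`; the resulting forest and `F` represent
the same graph, so they are equal. -/
theorem exists_encodes_iff (hA : A.Nonempty) (hF : IsPartitionForest A F) :
    (∃ G : QTGraph A, Encodes G.1 F) ↔ F.IsIncreasing := by
  constructor
  · rintro ⟨G, h⟩
    exact (h.represents G.2).increasing
  · intro h
    have : Nonempty A := hA.to_subtype
    have hG := isQuasiThreshold_of_hasDominators hF.comparabilityGraph_hasDominators
    obtain ⟨F', hF'⟩ := exists_encodes hG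
    refine ⟨⟨_, hG⟩, ?_⟩
    have : Represents A F
        ((comparabilityGraph A F hF).map (Function.Embedding.subtype fun x => x ∈ A)) :=
      ⟨hF, h, fun x hx y hy => map_subtype_adj hx hy⟩
    exact (hF'.represents hG).unique this ▸ hF'

/-! ### The encoding and the involution as functions -/

/-- The forest that encodes a quasi-threshold graph. -/
noncomputable def encoding (G : QTGraph A) : BlockForest := (exists_encodes G.2).choose

/-- A graph may a priori have several encodings, since `Encodes` is a relation; they agree because
all of them represent the same graph. -/
theorem encodes_iff (G : QTGraph A) : Encodes G.1 F ↔ F = encoding G := by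
  have h := (exists_encodes G.2).choose_spec
  exact ⟨fun h' => (h'.represents G.2).unique (h.represents G.2), fun e => e ▸ h⟩

/-- The encoding as a bijection onto the quasi-threshold forests. -/
noncomputable def encodingEquiv (A : Finset ℕ) : QTGraph A ≃ quasiThresholdForests A :=
  Equiv.ofBijective
    (fun G => ⟨⟨encoding G, (((encodes_iff G).2 rfl).represents G.2).forest⟩, G,
      (encodes_iff G).2 rfl⟩) <| by
    constructor
    · intro G G' h
      have h1 : encoding G = encoding G' := congrArg (fun F => F.1.1) h
      exact Subtype.ext (Encodes.injective G.2 G'.2 ((encodes_iff G).2 rfl)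
        ((encodes_iff G').2 h1))
    · rintro ⟨⟨F, hF⟩, G, hG⟩
      exact ⟨G, Subtype.ext (Subtype.ext ((encodes_iff G).1 hG).symm)⟩

theorem mem_quasiThresholdForests (hA : A.Nonempty) {F : PartitionForest A} :
    F ∈ quasiThresholdForests A ↔ F.1.IsIncreasing :=
  exists_encodes_iff hA F.2

/-- The involution on rooted partition forests. -/
noncomputable def iota (hA : A.Nonempty) (F : PartitionForest A) : PartitionForest A :=
  ⟨(F.2.exists_iota hA).choose, ((F.2.exists_iota hA).choose_spec.spec F.2).forest⟩

theorem iota_iff (hA : A.Nonempty) (F : PartitionForest A) : Iota F.1 F' ↔ F' = (iota hA F).1 := by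
  have h := (F.2.exists_iota hA).choose_spec
  exact ⟨fun h' => h'.unique F.2 h, fun e => e ▸ h⟩

theorem iota_spec (hA : A.Nonempty) (F : PartitionForest A) : IotaSpec A F.1 (iota hA F).1 :=
  ((iota_iff hA F).2 rfl).spec F.2

theorem iota_involutive (hA : A.Nonempty) : Function.Involutive (iota hA) := fun F =>
  Subtype.ext ((iota_iff hA (iota hA F)).1 (iota_spec hA F).symm).symm

theorem odd_card_add_card_iota (hA : A.Nonempty) {F : PartitionForest A} (h : iota hA F ≠ F) :
    Odd (F.1.blocks.card + (iota hA F).1.blocks.card) :=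
  (iota_spec hA F).parity.resolve_left fun e => h (Subtype.ext e)

/-- Both sides amount to the forest being increasing. -/
theorem iota_eq_iff (hA : A.Nonempty) {F : PartitionForest A} :
    iota hA F = F ↔ F ∈ quasiThresholdForests A := by
  rw [mem_quasiThresholdForests hA, ← ((iota_iff hA F).2 rfl).eq_iff F.2]
  exact Subtype.ext_iff

theorem card_eq_one_of_mem_quasiThresholdForests {F : PartitionForest A}
    (h : F ∈ quasiThresholdForests A) : ∀ v ∈ F.1.blocks, v.card = 1 := by
  obtain ⟨G, hG⟩ := h
  exact (hG.represents G.2).increasing.1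

end BlockForest

/-! ### Cayley's formula for rooted forests -/

/-- `f` gives every vertex in `S` a parent in `S` or a root in `R`, without cycles. -/
def AcyclicMap {S R : Type*} (f : S → S ⊕ R) : Prop :=
  ∃ k : S → ℕ, ∀ x y, f x = .inl y → k y < k x

namespace AcyclicMap

variable {S R : Type*}

/-- An element of least rank can only be sent to a root. -/
theorem isEmpty_of_isEmpty [Nonempty S] [IsEmpty R] : IsEmpty {f : S → S ⊕ R // AcyclicMap f} := by
  refine ⟨fun ⟨f, k, hk⟩ => ?_⟩
  obtain ⟨x, -, hmin⟩ := (measure k).wf.has_min Set.univ Set.univ_nonempty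
  cases h : f x with
  | inl y => exact hmin y trivial (hk x y h)
  | inr r => exact isEmptyElim r

/-- Split off the vertices whose parents are roots. -/
noncomputable def equivSigma [DecidableEq S] [Fintype S] : {f : S → S ⊕ R // AcyclicMap f} ≃
    Σ T : Finset S, (T → R) × {f : {x // x ∉ T} → {x // x ∉ T} ⊕ T // AcyclicMap f} :=
  Equiv.symm <| Equiv.ofBijective
    (fun ⟨T, g, f⟩ => ⟨fun x => if h : x ∈ T then .inr (g ⟨x, h⟩) else
      .inl ((f.1 ⟨x, h⟩).elim Subtype.val Subtype.val), by
        obtain ⟨k, hk⟩ := f.2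
        -- The elements of `T` hang directly below roots and get rank 0; all others are shifted up
        -- by one.
        refine ⟨fun x => if h : x ∈ T then 0 else k ⟨x, h⟩ + 1, fun x y hxy => ?_⟩
        dsimp only at hxy ⊢
        split_ifs at hxy with hx
        rw [dif_neg hx]
        split_ifs with hy
        · omega
        · have h1 : f.1 ⟨x, hx⟩ = .inl ⟨y, hy⟩ := by
            rw [Sum.inl.injEq] at hxy
            subst hxy
            have aux : ∀ (z : {x // x ∉ T} ⊕ T) (hz : z.elim Subtype.val Subtype.val ∉ T),
                z = .inl ⟨_, hz⟩ := by
              rintro (z | z) hz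
              · rfl
              · exact (hz z.2).elim
            exact aux _ hy
          have := hk _ _ h1
          omega⟩) <| by
    constructor
    · rintro ⟨T, g, f, hf⟩ ⟨T', g', f', hf'⟩ h
      have h1 := fun x => congrFun (congrArg Subtype.val h) x
      dsimp only at h1
      obtain rfl : T = T' := by
        ext x
        have := h1 x
        split_ifs at this <;> simp_all
      have h2 : g = g' := by
        funext ⟨x, hx⟩
        have := h1 x
        rw [dif_pos hx, dif_pos hx] at this
        exact Sum.inr_injective this
      have h3 : f = f' := by
        funext ⟨x, hx⟩
        have := h1 x
        rw [dif_neg hx, dif_neg hx, Sum.inl.injEq] at this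
        rcases h4 : f ⟨x, hx⟩ with ⟨y, hy⟩ | ⟨y, hy⟩ <;>
          rcases h5 : f' ⟨x, hx⟩ with ⟨z, hz⟩ | ⟨z, hz⟩ <;>
          · rw [h4, h5] at this
            dsimp at this
            subst this
            first | rfl | contradiction
      subst h2 h3
      rfl
    · rintro ⟨f, k, hk⟩
      let T : Finset S := Finset.univ.filter fun x => (f x).isRight
      have hT : ∀ x, x ∈ T ↔ (f x).isRight := by simp [T]
      let g : T → R := fun x => (f x).getRight ((hT x).1 x.2)
      have hl : ∀ x : {x // x ∉ T}, (f x).isLeft := fun x => by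
        have := x.2
        rw [hT] at this
        simpa using this
      -- Once the first level `T` is split off, its elements act as the roots for the rest.
      let f' : {x // x ∉ T} → {x // x ∉ T} ⊕ T := fun x =>
        if h : (f x).getLeft (hl x) ∈ T then .inr ⟨_, h⟩ else .inl ⟨_, h⟩
      refine ⟨⟨T, g, f', fun x => k x, fun x y h => ?_⟩, Subtype.ext (funext fun x => ?_)⟩
      · dsimp only [f'] at h
        split_ifs at h with h1
        rw [Sum.inl.injEq] at h
        subst h
        exact hk _ _ (by simp)
      · dsimp only
        split_ifs with h
        · simp [g]
        · dsimp only [f']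
          split_ifs <;> simp

/-- Absorption, `(m + 1) * C(s + 1, m + 1) = (s + 1) * C(s, m)`, turns the sum into the binomial
expansion of `(r + q) ^ s`. -/
theorem sum_card_mul_pow (s r q : ℕ) :
    ∑ T : Finset (Fin (s + 1)), T.card * r ^ T.card * q ^ (s + 1 - T.card) =
      (s + 1) * (r * (r + q) ^ s) := by
  rw [← Finset.powerset_univ, Finset.sum_powerset_apply_card
    (fun m => m * r ^ m * q ^ (s + 1 - m)), Finset.card_univ, Fintype.card_fin,
    Finset.sum_range_succ', add_pow]
  simp only [smul_eq_mul, zero_mul, mul_zero, add_zero, Finset.mul_sum, Nat.cast_id]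
  refine Finset.sum_congr rfl fun m _ => ?_
  have h1 := Nat.add_one_mul_choose_eq s m
  have h2 : s + 1 - (m + 1) = s - m := by omega
  rw [h2]
  calc (s + 1).choose (m + 1) * ((m + 1) * r ^ (m + 1) * q ^ (s - m))
      = ((s + 1).choose (m + 1) * (m + 1)) * r ^ (m + 1) * q ^ (s - m) := by ring
    _ = _ := by rw [← h1]; ring

theorem sum_card_mul_pow' [Fintype S] [Nonempty S] (r q : ℕ) :
    ∑ T : Finset S, T.card * r ^ T.card * q ^ (Fintype.card S - T.card) =
      Fintype.card S * (r * (r + q) ^ (Fintype.card S - 1)) := by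
  obtain ⟨s, hs⟩ := Nat.exists_eq_succ_of_ne_zero (Fintype.card_ne_zero (α := S))
  let e : S ≃ Fin (s + 1) := Fintype.equivFinOfCardEq hs
  rw [hs, Nat.succ_sub_one, ← sum_card_mul_pow]
  exact Fintype.sum_equiv e.finsetCongr _ _ fun T => by simp

/-- The number of rooted forests on `S ∪ R` with set of roots `R`. -/
theorem card_mul {S R : Type} [Finite S] [Finite R] : (Nat.card R + Nat.card S) *
    Nat.card {f : S → S ⊕ R // AcyclicMap f} =
      Nat.card R * (Nat.card R + Nat.card S) ^ Nat.card S := by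
  induction hn : Nat.card S using Nat.strong_induction_on generalizing S R with
  | _ n ih =>
    subst hn
    classical
    have := Fintype.ofFinite S
    have := Fintype.ofFinite R
    rcases isEmpty_or_nonempty S with hS | hS
    · have : Nat.card {f : S → S ⊕ R // AcyclicMap f} = 1 := by
        rw [Nat.card_eq_one_iff_unique]
        exact ⟨inferInstance, ⟨⟨fun x => isEmptyElim x, fun _ => 0, fun x => isEmptyElim x⟩⟩⟩
      rw [this]
      simp
    -- With `T` as roots and its complement as vertices, the total is `|S|`, so induction gives the
    -- count multiplied by `|S|`. Induction is unavailable for empty `T`, but then there are no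
    -- roots and both sides vanish.
    · have hT : ∀ T : Finset S, Nat.card S *
          Nat.card {f : {x // x ∉ T} → {x // x ∉ T} ⊕ T // AcyclicMap f} =
          T.card * Nat.card S ^ (Nat.card S - T.card) := by
        intro T
        have hc : Nat.card {x // x ∉ T} = Nat.card S - T.card := by
          rw [Nat.card_eq_fintype_card, Nat.card_eq_fintype_card, Fintype.card_subtype_compl,
            Fintype.card_coe]
        have hle : T.card ≤ Nat.card S := by
          rw [Nat.card_eq_fintype_card]
          exact T.card_le_univ
        have hc' : Nat.card T = T.card := by simp
        rcases T.eq_empty_or_nonempty with rfl | hne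
        · have : Nonempty {x : S // x ∉ (∅ : Finset S)} := ⟨⟨hS.some, by simp⟩⟩
          have := isEmpty_of_isEmpty (S := {x : S // x ∉ (∅ : Finset S)})
            (R := ((∅ : Finset S) : Type))
          simp
        · have h0 := hne.card_pos
          have := ih (Nat.card {x // x ∉ T}) (by omega) (S := {x // x ∉ T}) (R := T) rfl
          rw [hc, hc', Nat.add_sub_cancel' hle] at this
          exact this
      -- The extra factor `|S|` is the one that the counts in `hT` carry; it is cancelled below to
      -- give `r * (r + s) ^ (s - 1)`.
      have h1 : Nat.card S * Nat.card {f : S → S ⊕ R // AcyclicMap f} =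
          Nat.card S * (Nat.card R * (Nat.card R + Nat.card S) ^ (Nat.card S - 1)) := by
        rw [Nat.card_congr equivSigma, Nat.card_sigma, Finset.mul_sum]
        have h2 := sum_card_mul_pow' (S := S) (Nat.card R) (Nat.card S)
        rw [← Nat.card_eq_fintype_card] at h2
        rw [← h2]
        refine Finset.sum_congr rfl fun T _ => ?_
        rw [Nat.card_prod, Nat.card_fun]
        have := hT T
        have hc' : Nat.card T = T.card := by simp
        rw [hc']
        calc _ = Nat.card R ^ T.card * (Nat.card S *
            Nat.card {f : {x // x ∉ T} → {x // x ∉ T} ⊕ T // AcyclicMap f}) := by ring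
          _ = _ := by rw [this]; ring
      have hpos : 0 < Nat.card S := Nat.card_pos
      rw [Nat.eq_of_mul_eq_mul_left hpos h1]
      obtain ⟨s, hs⟩ := Nat.exists_eq_succ_of_ne_zero hpos.ne'
      rw [hs, Nat.succ_sub_one, pow_succ]
      ring

end AcyclicMap

/-! ### Counting set partitions -/

/-- `B` is the set of blocks of a partition of `A`. -/
structure IsBlocks (A : Finset ℕ) (B : Finset (Finset ℕ)) : Prop where
  empty_notMem : ∅ ∉ B
  disjoint : ∀ u ∈ B, ∀ v ∈ B, u ≠ v → Disjoint u v
  union : B.biUnion id = A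

namespace IsBlocks

variable {A : Finset ℕ} {B : Finset (Finset ℕ)} {a : ℕ}

theorem subset (h : IsBlocks A B) {v : Finset ℕ} (hv : v ∈ B) : v ⊆ A := fun x hx => by
  rw [← h.union]
  exact Finset.mem_biUnion.2 ⟨v, hv, hx⟩

theorem eq_of_mem (h : IsBlocks A B) {u v : Finset ℕ} {x : ℕ} (hu : u ∈ B) (hv : v ∈ B)
    (hx : x ∈ u) (hx' : x ∈ v) : u = v := by
  by_contra hne
  exact Finset.disjoint_left.1 (h.disjoint u hu v hv hne) hx hx'

theorem exists_mem (h : IsBlocks A B) {x : ℕ} (hx : x ∈ A) : ∃ v ∈ B, x ∈ v := by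
  rw [← h.union] at hx
  simpa using hx

/-- Add a new block. -/
theorem insert (h : IsBlocks A B) {c : Finset ℕ} (hc : c.Nonempty) (hd : Disjoint c A) :
    IsBlocks (c ∪ A) (insert c B) := by
  have hx : ∀ v ∈ B, ∀ x ∈ c, x ∉ v := fun v hv x hx hxv =>
    Finset.disjoint_left.1 hd hx (h.subset hv hxv)
  refine ⟨?_, ?_, ?_⟩
  · rw [Finset.mem_insert, not_or]
    exact ⟨hc.ne_empty.symm, h.empty_notMem⟩
  · intro u hu v hv hne
    rcases Finset.mem_insert.1 hu with hu | hu <;> rcases Finset.mem_insert.1 hv with hv | hv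
    · exact (hne (hu.trans hv.symm)).elim
    · exact hu ▸ Finset.disjoint_left.2 fun x h1 => hx v hv x h1
    · exact hv ▸ (Finset.disjoint_left.2 fun x h1 => hx u hu x h1).symm
    · exact h.disjoint u hu v hv hne
  · rw [Finset.biUnion_insert, h.union, id]

/-- Remove a block. -/
theorem erase (h : IsBlocks A B) {c : Finset ℕ} (hc : c ∈ B) : IsBlocks (A \ c) (B.erase c) := by
  refine ⟨fun h1 => h.empty_notMem (Finset.mem_of_mem_erase h1), fun u hu v hv =>
    h.disjoint u (Finset.mem_of_mem_erase hu) v (Finset.mem_of_mem_erase hv), ?_⟩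
  ext x
  simp only [Finset.mem_biUnion, Finset.mem_erase, id, Finset.mem_sdiff]
  constructor
  · rintro ⟨v, ⟨hne, hv⟩, hx⟩
    exact ⟨h.subset hv hx, fun hx' => hne (h.eq_of_mem hv hc hx hx')⟩
  · rintro ⟨hx, hx'⟩
    obtain ⟨v, hv, hxv⟩ := h.exists_mem hx
    exact ⟨v, ⟨fun e => hx' (e ▸ hxv), hv⟩, hxv⟩

end IsBlocks

open Classical in
/-- The partitions of `A`, as sets of blocks. -/
noncomputable def partitions (A : Finset ℕ) : Finset (Finset (Finset ℕ)) :=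
  A.powerset.powerset.filter (IsBlocks A)

theorem mem_partitions {A : Finset ℕ} {B : Finset (Finset ℕ)} :
    B ∈ partitions A ↔ IsBlocks A B := by
  simp only [partitions, Finset.mem_filter, Finset.mem_powerset, and_iff_right_iff_imp]
  exact fun h v hv => Finset.mem_powerset.2 (h.subset hv)

/-- The new element is either a block of its own or joins one of the existing blocks. An arbitrary
weight is used because the induction in `sum_partitions` replaces `w` by a different one. -/
theorem sum_partitions_insert {A : Finset ℕ} {a : ℕ} (ha : a ∉ A) (w : ℕ → ℚ) :
    ∑ B ∈ partitions (insert a A), w B.card =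
      ∑ B ∈ partitions A, (w (B.card + 1) + B.card * w B.card) := by
  have haB : ∀ {B v}, IsBlocks A B → v ∈ B → a ∉ v := fun h hv h1 => ha (h.subset hv h1)
  have hsing : ∀ {B}, IsBlocks A B → ({a} : Finset ℕ) ∉ B := fun h h1 => haB h h1 (by simp)
  have hins : ∀ {B v}, IsBlocks A B → insert a v ∉ B := fun h h1 => haB h h1 (by simp)
  rw [Finset.sum_add_distrib, ← Finset.sum_filter_add_sum_filter_not _ fun B => {a} ∈ B]
  congr 1
  · refine Finset.sum_nbij' (fun B => B.erase {a}) (fun B => insert {a} B) ?_ ?_ ?_ ?_ ?_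
    · intro B hB
      rw [Finset.mem_filter, mem_partitions] at hB
      rw [mem_partitions]
      have := hB.1.erase hB.2
      rwa [Finset.insert_sdiff_of_mem _ (by simp), Finset.sdiff_singleton_eq_erase,
        Finset.erase_eq_of_notMem ha] at this
    · intro B hB
      rw [mem_partitions] at hB
      rw [Finset.mem_filter, mem_partitions]
      exact ⟨hB.insert (c := {a}) (by simp) (by simpa using ha), by simp⟩
    · intro B hB
      exact Finset.insert_erase (Finset.mem_filter.1 hB).2
    · intro B hB
      exact Finset.erase_insert (hsing (mem_partitions.1 hB))
    · intro B hB
      have h1 := (Finset.mem_filter.1 hB).2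
      have := Finset.card_pos.2 ⟨_, h1⟩
      rw [Finset.card_erase_of_mem h1, Nat.sub_add_cancel this]
  · have e : ∑ B ∈ partitions A, (B.card : ℚ) * w B.card =
        ∑ x ∈ (partitions A).sigma fun B => B, w x.1.card := by
      rw [Finset.sum_sigma]
      simp
    rw [e]
    symm
    have key : ∀ x ∈ (partitions A).sigma fun B => B,
        IsBlocks (insert a A) (insert (insert a x.2) (x.1.erase x.2)) ∧
        insert a x.2 ∉ x.1.erase x.2 ∧ {a} ∉ insert (insert a x.2) (x.1.erase x.2) := by
      rintro ⟨B, c⟩ hx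
      obtain ⟨hB, hc⟩ := Finset.mem_sigma.1 hx
      rw [mem_partitions] at hB
      dsimp only at hB hc ⊢
      have hcne : c.Nonempty := Finset.nonempty_iff_ne_empty.2 fun e => hB.empty_notMem (e ▸ hc)
      refine ⟨?_, fun h => hins hB (Finset.mem_of_mem_erase h), ?_⟩
      · have := (hB.erase hc).insert (c := insert a c) (by simp) ?_
        · rwa [Finset.insert_union, Finset.union_sdiff_of_subset (hB.subset hc)] at this
        · rw [Finset.disjoint_insert_left]
          exact ⟨fun h => ha (Finset.mem_sdiff.1 h).1, Finset.disjoint_sdiff⟩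
      · rw [Finset.mem_insert, not_or]
        refine ⟨fun e => ?_, fun h => hsing hB (Finset.mem_of_mem_erase h)⟩
        obtain ⟨x, hx⟩ := hcne
        have h1 : x ∈ ({a} : Finset ℕ) := e ▸ Finset.mem_insert_of_mem hx
        rw [Finset.mem_singleton] at h1
        exact haB hB hc (h1 ▸ hx)
    -- Partitions in which `a` is not alone correspond to partitions of `A` with a chosen block, to
    -- which `a` is added.
    refine Finset.sum_bij (fun x _ => insert (insert a x.2) (x.1.erase x.2)) ?_ ?_ ?_ ?_
    · intro x hx
      rw [Finset.mem_filter, mem_partitions]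
      exact ⟨(key x hx).1, (key x hx).2.2⟩
    · rintro ⟨B, c⟩ hx ⟨B', c'⟩ hx' h
      have k1 := key _ hx
      have k2 := key _ hx'
      obtain ⟨hB, hc⟩ := Finset.mem_sigma.1 hx
      obtain ⟨hB', hc'⟩ := Finset.mem_sigma.1 hx'
      rw [mem_partitions] at hB hB'
      dsimp only at hB hB' hc hc' h k1 k2
      have h1 : insert a c = insert a c' := k1.1.eq_of_mem (by simp) (by rw [h]; simp)
        (Finset.mem_insert_self a c) (Finset.mem_insert_self a c')
      have h2 : c = c' := by
        rw [← Finset.erase_insert (haB hB hc), h1, Finset.erase_insert (haB hB' hc')]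
      subst h2
      have h3 : B.erase c = B'.erase c := by
        rw [← Finset.erase_insert k1.2.1, h, Finset.erase_insert k2.2.1]
      have h4 : B = B' := by
        rw [← Finset.insert_erase hc, h3, Finset.insert_erase hc']
      subst h4
      rfl
    · intro B' hB'
      rw [Finset.mem_filter, mem_partitions] at hB'
      obtain ⟨hB', hna⟩ := hB'
      obtain ⟨b, hb, hab⟩ := hB'.exists_mem (Finset.mem_insert_self a A)
      have hne : (b.erase a).Nonempty := by
        rw [Finset.nonempty_iff_ne_empty]
        intro e
        rw [Finset.erase_eq_empty_iff] at e
        rcases e with rfl | rfl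
        · simp at hab
        · exact hna hb
      have hsub : b.erase a ⊆ A := fun x hx => by
        rw [Finset.mem_erase] at hx
        exact (Finset.mem_insert.1 (hB'.subset hb hx.2)).resolve_left hx.1
      have hnot : b.erase a ∉ B'.erase b := fun h => by
        obtain ⟨x, hx⟩ := hne
        exact (Finset.mem_erase.1 h).1
          (hB'.eq_of_mem (Finset.mem_of_mem_erase h) hb hx (Finset.mem_of_mem_erase hx))
      refine ⟨⟨insert (b.erase a) (B'.erase b), b.erase a⟩, ?_, ?_⟩
      · rw [Finset.mem_sigma, mem_partitions]
        refine ⟨?_, by simp⟩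
        have h1 : insert a A \ b = A \ b.erase a := by
          ext x
          simp only [Finset.mem_sdiff, Finset.mem_insert, Finset.mem_erase]
          grind
        have h2 := (hB'.erase hb).insert hne ?_
        · rwa [h1, Finset.union_sdiff_of_subset hsub] at h2
        · rw [h1]
          exact Finset.disjoint_sdiff
      · dsimp only
        rw [Finset.erase_insert hnot, Finset.insert_erase hab, Finset.insert_erase hb]
    · intro x hx
      have h1 := (Finset.mem_sigma.1 hx).2
      have := Finset.card_pos.2 ⟨_, h1⟩
      rw [Finset.card_insert_of_notMem (key x hx).2.1, Finset.card_erase_of_mem h1,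
        Nat.sub_add_cancel this]

theorem sum_partitions (A : Finset ℕ) (w : ℕ → ℚ) : ∑ B ∈ partitions A, w B.card =
    ∑ k ∈ Finset.range (A.card + 1), (Nat.stirlingSecond A.card k : ℚ) * w k := by
  induction A using Finset.induction_on generalizing w with
  | empty =>
    have : partitions ∅ = {∅} := by
      ext B
      rw [mem_partitions, Finset.mem_singleton]
      constructor
      · intro h
        refine Finset.eq_empty_of_forall_notMem fun v hv => h.empty_notMem ?_
        rwa [Finset.subset_empty.1 (h.subset hv)] at hv
      · rintro rfl
        exact ⟨by simp, by simp, by simp⟩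
    simp [this]
  | insert a A ha ih =>
    rw [sum_partitions_insert ha, ih fun k => w (k + 1) + k * w k, Finset.card_insert_of_notMem ha,
      Finset.sum_range_succ' _ (A.card + 1)]
    set n := A.card
    -- An index shift: the term at `0` has a factor 0, and the term at `n + 1` vanishes because
    -- `S(n, n + 1) = 0`.
    have h1 : ∑ k ∈ Finset.range (n + 1), ((k + 1 : ℕ) : ℚ) * Nat.stirlingSecond n (k + 1) * w (k + 1) =
        ∑ k ∈ Finset.range (n + 1), (k : ℚ) * Nat.stirlingSecond n k * w k := by
      have h2 := Finset.sum_range_succ' (fun k => (k : ℚ) * Nat.stirlingSecond n k * w k) (n + 1)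
      rw [Finset.sum_range_succ, Nat.stirlingSecond_eq_zero_of_lt (Nat.lt_succ_self n)] at h2
      simpa using h2.symm
    simp only [Nat.stirlingSecond_succ_zero, Nat.stirlingSecond_succ_succ, Nat.cast_add,
      Nat.cast_mul, mul_add, add_mul, Finset.sum_add_distrib, Nat.cast_zero, zero_mul, add_zero]
    simp only [Nat.cast_add, add_mul, Finset.sum_add_distrib] at h1
    rw [h1, add_comm]
    congr 1
    exact Finset.sum_congr rfl fun k _ => by ring

/-! ### Counting partition forests and the signed sum -/

namespace BlockForest

variable {A : Finset ℕ} {B : Finset (Finset ℕ)}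

theorem IsPartitionForest.isBlocks {F : BlockForest} (h : IsPartitionForest A F) :
    IsBlocks A F.blocks := ⟨h.empty_notMem, h.disjoint, h.union⟩

open Classical in
/-- The forest with set of blocks `B` in which the parents are given by `f`. -/
noncomputable def ofParents (B : Finset (Finset ℕ)) (f : B → B ⊕ Unit) : BlockForest where
  blocks := B
  edges := (B ×ˢ B).filter fun e => ∃ c p : B, f c = .inl p ∧ e = (c.1, p.1)

theorem ofParents_parentOf {f : B → B ⊕ Unit} {c p : Finset ℕ} :
    (ofParents B f).ParentOf c p ↔ ∃ (hc : c ∈ B) (hp : p ∈ B), f ⟨c, hc⟩ = .inl ⟨p, hp⟩ := by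
  simp only [ofParents, ParentOf, Finset.mem_filter, Finset.mem_product, Prod.mk.injEq]
  constructor
  · rintro ⟨-, c, p, h, rfl, rfl⟩
    exact ⟨c.2, p.2, h⟩
  · rintro ⟨hc, hp, h⟩
    exact ⟨⟨hc, hp⟩, ⟨c, hc⟩, ⟨p, hp⟩, h, rfl, rfl⟩

theorem isPartitionForest_ofParents (hB : IsBlocks A B) {f : B → B ⊕ Unit} (hf : AcyclicMap f) :
    IsPartitionForest A (ofParents B f) := by
  refine ⟨hB.empty_notMem, hB.disjoint, hB.union, fun c p h => ?_, fun c p p' h h' => ?_, ?_⟩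
  · obtain ⟨hc, hp, -⟩ := ofParents_parentOf.1 h
    exact ⟨hc, hp⟩
  · obtain ⟨hc, hp, h⟩ := ofParents_parentOf.1 h
    obtain ⟨hc', hp', h'⟩ := ofParents_parentOf.1 h'
    rw [h, Sum.inl.injEq] at h'
    exact congrArg Subtype.val h'
  · obtain ⟨k, hk⟩ := hf
    refine acyclic_of_rank (fun c => if hc : c ∈ B then k ⟨c, hc⟩ else 0) fun c p h => ?_
    obtain ⟨hc, hp, h⟩ := ofParents_parentOf.1 h
    simpa only [dif_pos hc, dif_pos hp] using hk _ _ h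

/-- The forests with given blocks correspond to the acyclic maps on these blocks. -/
noncomputable def acyclicMapEquiv (hB : IsBlocks A B) :
    {f : B → B ⊕ Unit // AcyclicMap f} ≃ {F : PartitionForest A // F.1.blocks = B} :=
  Equiv.ofBijective
    (fun f => ⟨⟨ofParents B f.1, isPartitionForest_ofParents hB f.2⟩, rfl⟩) <| by
    constructor
    · rintro ⟨f, hf⟩ ⟨f', hf'⟩ h
      have h1 : ofParents B f = ofParents B f' := congrArg (fun F => F.1.1) h
      refine Subtype.ext (funext fun c => ?_)
      have key : ∀ p, f c = .inl p ↔ f' c = .inl p := fun p => by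
        have h2 := ofParents_parentOf (f := f) (c := c.1) (p := p.1)
        rw [h1, ofParents_parentOf] at h2
        simpa using h2.symm
      dsimp only
      rcases h3 : f c with p | u
      · exact ((key p).1 h3).symm
      · rcases h4 : f' c with p | u'
        · rw [(key p).2 h4] at h3
          simp at h3
        · rfl
    · rintro ⟨⟨F, hF⟩, rfl⟩
      classical
      let f : F.blocks → F.blocks ⊕ Unit := fun c =>
        if h : ∃ p : F.blocks, F.ParentOf c p then .inl h.choose else .inr ()
      have key : ∀ c p, f c = .inl p ↔ F.ParentOf c p := by
        intro c p
        dsimp only [f]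
        split_ifs with h
        · rw [Sum.inl.injEq]
          constructor
          · rintro rfl
            exact h.choose_spec
          · exact fun h1 => Subtype.ext (hF.parent_unique _ _ _ h.choose_spec h1)
        · simpa using fun h1 => h ⟨p, h1⟩
      have hf : AcyclicMap f := by
        obtain ⟨k, hk⟩ := hF.exists_rank
        exact ⟨fun c => k c, fun x y h => hk _ _ ((key x y).1 h)⟩
      refine ⟨⟨f, hf⟩, Subtype.ext (Subtype.ext ?_)⟩
      dsimp only
      ext1
      · rfl
      · ext ⟨c, p⟩
        change (ofParents F.blocks f).ParentOf c p ↔ F.ParentOf c p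
        rw [ofParents_parentOf]
        constructor
        · rintro ⟨hc, hp, h⟩
          exact (key _ _).1 h
        · intro h
          have := hF.mem_blocks _ _ h
          exact ⟨this.1, this.2, (key _ _).2 h⟩

/-- A virtual vertex placed above all roots makes this the count with a single root. The integer
exponent gives the correct value 1 when there are no blocks. -/
theorem card_forests_of_blocks (hB : IsBlocks A B) :
    (Nat.card {F : PartitionForest A // F.1.blocks = B} : ℚ) =
      ((B.card : ℚ) + 1) ^ ((B.card : ℤ) - 1) := by
  rw [← Nat.card_congr (acyclicMapEquiv hB)]
  have h := AcyclicMap.card_mul (S := B) (R := Unit)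
  have hc : Nat.card B = B.card := by simp
  rw [hc, Nat.card_unique, one_mul] at h
  have h0 : (B.card : ℚ) + 1 ≠ 0 := by positivity
  rw [zpow_sub_one₀ h0, zpow_natCast, eq_mul_inv_iff_mul_eq₀ h0, mul_comm]
  have h1 := congrArg (Nat.cast (R := ℚ)) h
  push_cast at h1
  rw [add_comm] at h1
  exact h1

instance : Finite (PartitionForest A) := by
  have key : ∀ F : PartitionForest A, F.1.blocks ⊆ A.powerset ∧
      F.1.edges ⊆ A.powerset ×ˢ A.powerset := by
    rintro ⟨F, hF⟩
    have h1 : ∀ v ∈ F.blocks, v ∈ A.powerset := fun v hv => Finset.mem_powerset.2 (hF.subset hv)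
    refine ⟨h1, fun ⟨c, p⟩ h => ?_⟩
    have := hF.mem_blocks _ _ h
    exact Finset.mem_product.2 ⟨h1 _ this.1, h1 _ this.2⟩
  refine Finite.of_injective (β := A.powerset.powerset × (A.powerset ×ˢ A.powerset).powerset)
    (fun F => (⟨F.1.blocks, Finset.mem_powerset.2 (key F).1⟩,
      ⟨F.1.edges, Finset.mem_powerset.2 (key F).2⟩)) fun F F' h => ?_
  simp only [Prod.mk.injEq, Subtype.mk.injEq] at h
  exact Subtype.ext (BlockForest.ext h.1 h.2)

noncomputable instance : Fintype (PartitionForest A) := Fintype.ofFinite _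

/-- Group the forests by their vertex sets; within a group the weight is constant. -/
theorem sum_forests (A : Finset ℕ) (w : ℕ → ℚ) :
    ∑ F : PartitionForest A, w F.1.blocks.card = ∑ k ∈ Finset.range (A.card + 1),
      (Nat.stirlingSecond A.card k : ℚ) * (w k * ((k : ℚ) + 1) ^ ((k : ℤ) - 1)) := by
  classical
  rw [← sum_partitions A fun k => w k * ((k : ℚ) + 1) ^ ((k : ℤ) - 1),
    ← Finset.sum_fiberwise_of_maps_to (g := fun F : PartitionForest A => F.1.blocks)
      (t := partitions A) fun F _ => mem_partitions.2 F.2.isBlocks]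
  refine Finset.sum_congr rfl fun B hB => ?_
  rw [← card_forests_of_blocks (mem_partitions.1 hB), Nat.card_eq_fintype_card,
    Fintype.card_subtype, mul_comm, ← nsmul_eq_mul]
  refine Finset.sum_eq_card_nsmul fun F hF => ?_
  rw [(Finset.mem_filter.1 hF).2]

theorem card_eq_sum (F : PartitionForest A) : A.card = ∑ v ∈ F.1.blocks, v.card := by
  have h := Finset.card_biUnion (t := id)
    fun u hu v hv h => F.2.disjoint u hu v hv h
  rwa [F.2.union] at h

theorem card_blocks_le (F : PartitionForest A) : F.1.blocks.card ≤ A.card := by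
  rw [card_eq_sum F, Finset.card_eq_sum_ones]
  exact Finset.sum_le_sum fun v hv => Finset.card_pos.2 (F.2.nonempty hv)

theorem card_blocks_eq {F : PartitionForest A} (h : F ∈ quasiThresholdForests A) :
    F.1.blocks.card = A.card := by
  rw [card_eq_sum F, Finset.card_eq_sum_ones]
  exact Finset.sum_congr rfl fun v hv => (card_eq_one_of_mem_quasiThresholdForests h v hv).symm

/-- The forests outside `quasiThresholdForests A` cancel in pairs under `iota`; each remaining
forest has `A.card` vertices and contributes 1. -/
theorem card_qtGraph (hA : A.Nonempty) : (Nat.card (QTGraph A) : ℚ) =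
    ∑ F : PartitionForest A, (-1) ^ (A.card - F.1.blocks.card) := by
  classical
  -- Replaces the truncated difference in the exponent by a sum of the same parity, so that the sign
  -- factors.
  have hsign : ∀ F : PartitionForest A, ((-1) ^ (A.card - F.1.blocks.card) : ℚ) =
      (-1) ^ (A.card + F.1.blocks.card) := by
    intro F
    obtain ⟨m, hm⟩ := Nat.exists_eq_add_of_le (card_blocks_le F)
    rw [hm, Nat.add_sub_cancel_left, show F.1.blocks.card + m + F.1.blocks.card =
      m + 2 * F.1.blocks.card by ring, pow_add, pow_mul]
    simp
  rw [← Finset.sum_filter_add_sum_filter_not _ fun F => F ∈ quasiThresholdForests A]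
  have h0 : ∑ F with F ∉ quasiThresholdForests A,
      ((-1) ^ (A.card - F.1.blocks.card) : ℚ) = 0 := by
    refine Finset.sum_involution (fun F _ => iota hA F) ?_ ?_ ?_ ?_
    · intro F hF
      have h1 : iota hA F ≠ F := fun e => (Finset.mem_filter.1 hF).2 ((iota_eq_iff hA).1 e)
      rw [hsign, hsign, pow_add, pow_add, ← mul_add]
      have h2 := Nat.odd_add.1 (odd_card_add_card_iota hA h1)
      rcases Nat.even_or_odd (iota hA F).1.blocks.card with e | e
      · rw [e.neg_one_pow, (h2.2 e).neg_one_pow]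
        norm_num
      · have h3 : Even F.1.blocks.card :=
          Nat.not_odd_iff_even.1 fun o => Nat.not_even_iff_odd.2 e (h2.1 o)
        rw [e.neg_one_pow, h3.neg_one_pow]
        norm_num
    · exact fun F hF _ e => (Finset.mem_filter.1 hF).2 ((iota_eq_iff hA).1 e)
    · intro F hF
      refine Finset.mem_filter.2 ⟨Finset.mem_univ _, fun h => (Finset.mem_filter.1 hF).2 ?_⟩
      have h1 := (iota_eq_iff hA).2 h
      rw [iota_involutive hA F] at h1
      rw [h1]
      exact h
    · exact fun F _ => iota_involutive hA F
  rw [h0, add_zero, Finset.sum_congr rfl (g := fun _ => (1 : ℚ)) fun F hF => by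
    rw [card_blocks_eq (Finset.mem_filter.1 hF).2, Nat.sub_self, pow_zero],
    Nat.card_congr (encodingEquiv A), Nat.card_eq_fintype_card,
    Fintype.card_of_subtype (Finset.univ.filter fun F => F ∈ quasiThresholdForests A) (by simp)]
  simp

end BlockForest

open BlockForest in
theorem qtCount_eq (n : ℕ) (hn : 1 ≤ n) :
    (qtCount n : ℚ) = ∑ k ∈ Finset.range (n + 1),
      (-1) ^ (n - k) * (Nat.stirlingSecond n k : ℚ) * ((k : ℚ) + 1) ^ ((k : ℤ) - 1) := by
  have h := sum_forests (Finset.Icc 1 n) fun k => (-1) ^ (n - k)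
  rw [Nat.card_Icc, Nat.add_sub_cancel] at h
  have hA : (Finset.Icc 1 n).Nonempty := Finset.nonempty_Icc.2 hn
  have h1 := card_qtGraph hA
  rw [Nat.card_Icc, Nat.add_sub_cancel, h] at h1
  rw [qtCount, h1]
  exact Finset.sum_congr rfl fun k _ => by ring

theorem mainTheorem2 :
    (∀ n : ℕ, 1 ≤ n →
      (qtCount n : ℚ) = ∑ k ∈ Finset.range (n + 1),
        (-1) ^ (n - k) * (Nat.stirlingSecond n k : ℚ) * ((k : ℚ) + 1) ^ ((k : ℤ) - 1)) ∧
    (∀ A : Finset ℕ, A.Nonempty →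
      (∃ e : QTGraph A ≃ quasiThresholdForests A,
        ∀ (G : QTGraph A) (F : BlockForest), BlockForest.Encodes G.1 F ↔ F = (e G).1.1) ∧
      (∀ F ∈ quasiThresholdForests A, ∀ v ∈ F.1.blocks, v.card = 1) ∧
      (∃ ι : PartitionForest A → PartitionForest A,
        (∀ (F : PartitionForest A) (F' : BlockForest),
          BlockForest.Iota F.1 F' ↔ F' = (ι F).1) ∧
        Function.Involutive ι ∧
        (∀ F : PartitionForest A, ι F ≠ F →
          (Even ((A.card : ℤ) - (F.1.blocks.card : ℤ)) ↔
            Odd ((A.card : ℤ) - ((ι F).1.blocks.card : ℤ)))) ∧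
        (∀ F : PartitionForest A, ι F = F ↔ F ∈ quasiThresholdForests A))) := by
  refine ⟨qtCount_eq, fun A hA => ⟨⟨BlockForest.encodingEquiv A, fun G F =>
    BlockForest.encodes_iff G⟩, fun F hF => BlockForest.card_eq_one_of_mem_quasiThresholdForests hF,
    BlockForest.iota hA, fun F F' => BlockForest.iota_iff hA F, BlockForest.iota_involutive hA,
    fun F hF => ?_, fun F => BlockForest.iota_eq_iff hA⟩⟩
  obtain ⟨m, hm⟩ := BlockForest.odd_card_add_card_iota hA hF
  rw [Int.even_iff, Int.odd_iff]
  omega
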